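/- Let $\mathbb H=\{z=x+iy\in\mathbb C: y>0\}$ and $\Delta_0=y^2\left(\frac{\partial^2}{\partial x^2}+\frac{\partial^2}{\partial y^2}\right)$. For an integer $m\ge 1$ let $V_0^m(0)$ be the complex vector space of weight $0$ $m$-harmonic Maass forms of moderate growth for $\mathrm{PSL}(2,\mathbb Z)$, that is, of smooth functions $f:\mathbb H\to\mathbb C$ such that 1. $f\left(\frac{az+b}{cz+d}\right)=f(z)$ for all $z\in\mathbb H$ and all $\begin{pmatrix}a&b\\c&d\end{pmatrix}\in \mathrm{SL}(2,\mathbb Z)$; 2. $\Delta_0^m f=0$; 3. there is $\alpha\in\mathbb R$ with $f(x+iy)=O(y^\alpha)$ as $y\to\infty$, uniformly in $x\in\mathbb R$. Let $V_0^{m-1/2}(0)$ be the space of smooth functions $f:\mathbb H\to\mathbb C$ that satisfy 1 and 3 and for which $\Delta_0^{m-1}f$ is a (possibly zero) holomorphic modular form of weight $0$ for $\mathrm{SL}(2,\mathbb Z)$. For $z\in\mathbb H$ and $\operatorname{Re}(s)>1$ put $$E_0(z,s)=\frac12\sum_{(m,n)\in\mathbb Z^2\setminus\{(0,0)\}}\frac{y^s}{|mz+n|^{2s}},\qquad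 \widehat{\widehat E}_0(z,s)=s(s-1)\pi^{-s}\Gamma(s)E_0(z,s).$$ **Theorem.** For each $z\in\mathbb H$ the function $s\mapsto\widehat{\widehat E}_0(z,s)$ continues analytically to an entire function of $s$; let $F_n(z)$ be its Taylor coefficients at $s=0$, so that $\widehat{\widehat E}_0(z,s)=\sum_{n\ge0}F_n(z)s^n$. For every integer $m\ge1$ one has $V_0^m(0)=V_0^{m-1/2}(0)$, this space has dimension $m$ over $\mathbb C$, and the functions $F_0,\dots,F_{m-1}$ form a basis of it. -/

import Mathlib

open scoped UpperHalfPlane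

noncomputable section

namespace PolyharmonicMaass

open UpperHalfPlane Filter Asymptotics
open scoped MatrixGroups ContDiff Topology Laplacian

/-- `f : ℍ → ℂ` is smooth (in the real sense). -/
def IsSmooth (f : ℍ → ℂ) : Prop :=
  ContDiffOn ℝ ∞ (f ∘ ofComplex) {z : ℂ | 0 < z.im}

/-- The weight `0` hyperbolic Laplacian `Δ₀ = y² (∂²/∂x² + ∂²/∂y²)`. -/
def hypLaplacian (f : ℍ → ℂ) : ℍ → ℂ :=
  fun z ↦ (z.im : ℂ) ^ 2 * (Δ (f ∘ ofComplex)) (z : ℂ)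

/-- Moderate growth at the cusp: `f(x+iy) = O(y^α)` as `y → ∞`, uniformly in `x`. -/
def ModerateGrowth (f : ℍ → ℂ) : Prop :=
  ∃ α : ℝ, f =O[atImInfty] fun z : ℍ ↦ z.im ^ α

theorem IsSmooth.contDiffAt {f : ℍ → ℂ} (hf : IsSmooth f) (z : ℍ) :
    ContDiffAt ℝ ∞ (f ∘ ofComplex) (z : ℂ) :=
  ContDiffOn.contDiffAt hf (isOpen_upperHalfPlaneSet.mem_nhds z.im_pos)

theorem IsSmooth.add {f g : ℍ → ℂ} (hf : IsSmooth f) (hg : IsSmooth g) : IsSmooth (f + g) :=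
  ContDiffOn.add hf hg

theorem IsSmooth.smul {f : ℍ → ℂ} (c : ℂ) (hf : IsSmooth f) : IsSmooth (c • f) :=
  ContDiffOn.const_smul c hf

theorem IsSmooth.hypLaplacian {f : ℍ → ℂ} (hf : IsSmooth f) :
    IsSmooth (hypLaplacian f) := by
  have ho : IsOpen {z : ℂ | 0 < z.im} := isOpen_upperHalfPlaneSet
  have h1 : ContDiffOn ℝ ∞ (iteratedFDeriv ℝ 2 (f ∘ ofComplex)) {z : ℂ | 0 < z.im} := by
    intro z hz
    exact ((hf.contDiffAt ⟨z, hz⟩).iteratedFDeriv_right (i := 2) (m := ∞)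
      (WithTop.coe_le_coe.2 (le_top : (⊤ : ℕ∞) + 2 ≤ ⊤))).contDiffWithinAt
  have h3 (v : Fin 2 → ℂ) :
      ContDiffOn ℝ ∞ (fun z ↦ iteratedFDeriv ℝ 2 (f ∘ ofComplex) z v) {z : ℂ | 0 < z.im} :=
    (ContinuousMultilinearMap.apply ℝ (fun _ : Fin 2 ↦ ℂ) ℂ v).contDiff.comp_contDiffOn h1
  have h4 : ContDiff ℝ ∞ (fun z : ℂ ↦ ((z.im : ℂ)) ^ 2) :=
    (Complex.ofRealCLM.contDiff.comp Complex.imCLM.contDiff).pow 2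
  refine (h4.contDiffOn.mul ((h3 ![1, 1]).add (h3 ![Complex.I, Complex.I]))).congr ?_
  intro z hz
  have : ofComplex z = ⟨z, hz⟩ := ofComplex_apply_of_im_pos hz
  simp only [Function.comp_apply, this, PolyharmonicMaass.hypLaplacian,
    InnerProductSpace.laplacian_eq_iteratedFDeriv_complexPlane]
  rfl

theorem hypLaplacian_add {f g : ℍ → ℂ} (hf : IsSmooth f) (hg : IsSmooth g) :
    hypLaplacian (f + g) = hypLaplacian f + hypLaplacian g := by
  funext z
  have h := ContDiffAt.laplacian_add ((hf.contDiffAt z).of_le (m := 2) (WithTop.coe_le_coe.2 (le_top : (2 : ℕ∞) ≤ ⊤)))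
    ((hg.contDiffAt z).of_le (m := 2) (WithTop.coe_le_coe.2 (le_top : (2 : ℕ∞) ≤ ⊤)))
  change _ * Δ (f ∘ ofComplex + g ∘ ofComplex) (z : ℂ) = _ * _ + _ * _
  rw [h, mul_add]

theorem hypLaplacian_smul {f : ℍ → ℂ} (c : ℂ) (hf : IsSmooth f) :
    hypLaplacian (c • f) = c • hypLaplacian f := by
  funext z
  have h := InnerProductSpace.laplacian_smul c
    ((hf.contDiffAt z).of_le (m := 2) (WithTop.coe_le_coe.2 (le_top : (2 : ℕ∞) ≤ ⊤)))
  change _ * Δ (c • (f ∘ ofComplex)) (z : ℂ) = c * (_ * _)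
  rw [h, smul_eq_mul]
  ring

theorem iterate_hypLaplacian_add (m : ℕ) {f g : ℍ → ℂ} (hf : IsSmooth f) (hg : IsSmooth g) :
    hypLaplacian^[m] (f + g) = hypLaplacian^[m] f + hypLaplacian^[m] g := by
  induction m generalizing f g with
  | zero => rfl
  | succ m ih =>
    simp only [Function.iterate_succ_apply, hypLaplacian_add hf hg]
    exact ih hf.hypLaplacian hg.hypLaplacian

theorem iterate_hypLaplacian_smul (m : ℕ) {f : ℍ → ℂ} (c : ℂ) (hf : IsSmooth f) :
    hypLaplacian^[m] (c • f) = c • hypLaplacian^[m] f := by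
  induction m generalizing f with
  | zero => rfl
  | succ m ih =>
    simp only [Function.iterate_succ_apply, hypLaplacian_smul c hf]
    exact ih hf.hypLaplacian

theorem ModerateGrowth.add {f g : ℍ → ℂ} (hf : ModerateGrowth f) (hg : ModerateGrowth g) :
    ModerateGrowth (f + g) := by
  obtain ⟨α, hα⟩ := hf
  obtain ⟨β, hβ⟩ := hg
  have key {γ : ℝ} (h : γ ≤ max α β) :
      (fun z : ℍ ↦ z.im ^ γ) =O[atImInfty] fun z : ℍ ↦ z.im ^ max α β := by
    refine IsBigO.of_bound 1 ?_
    filter_upwards [(atImInfty_mem {z | 1 ≤ z.im}).2 ⟨1, fun _ h ↦ h⟩] with z hz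
    rw [one_mul, Real.norm_of_nonneg (by positivity), Real.norm_of_nonneg (by positivity)]
    exact Real.rpow_le_rpow_of_exponent_le hz h
  exact ⟨max α β, (hα.trans (key (le_max_left _ _))).add (hβ.trans (key (le_max_right _ _)))⟩

/-- The smooth functions on `ℍ` that are invariant under the modular group (weight `0`) and have
moderate growth at the cusp. -/
def automorphicFunctions : Submodule ℂ (ℍ → ℂ) where
  carrier := {f | IsSmooth f ∧ (∀ (γ : SL(2, ℤ)) (z : ℍ), f (γ • z) = f z) ∧ ModerateGrowth f}
  zero_mem' := ⟨contDiffOn_const (c := (0 : ℂ)), fun _ _ ↦ rfl, 0, isBigO_zero _ _⟩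
  add_mem' := by
    rintro f g ⟨hf, hf', hf''⟩ ⟨hg, hg', hg''⟩
    exact ⟨hf.add hg, fun γ z ↦ by rw [Pi.add_apply, Pi.add_apply, hf', hg'], hf''.add hg''⟩
  smul_mem' := by
    rintro c f ⟨hf, hf', α, hα⟩
    exact ⟨hf.smul c, fun γ z ↦ by rw [Pi.smul_apply, Pi.smul_apply, hf'], α, hα.const_smul_left c⟩

/-- The space `V₀^m(0)`, for an integer `m`, of weight `0` `m`-harmonic Maass forms: the functions
in `automorphicFunctions` that satisfy `Δ₀^m f = 0`. -/
def V (m : ℕ) : Submodule ℂ (ℍ → ℂ) where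
  carrier := {f | f ∈ automorphicFunctions ∧ hypLaplacian^[m] f = 0}
  zero_mem' := by
    refine ⟨zero_mem _, ?_⟩
    have h := iterate_hypLaplacian_smul m (f := 0) 0 (zero_mem automorphicFunctions).1
    simpa using h
  add_mem' := by
    rintro f g ⟨hf, hf'⟩ ⟨hg, hg'⟩
    exact ⟨add_mem hf hg, by rw [iterate_hypLaplacian_add m hf.1 hg.1, hf', hg', add_zero]⟩
  smul_mem' := by
    rintro c f ⟨hf, hf'⟩
    exact ⟨Submodule.smul_mem _ c hf, by rw [iterate_hypLaplacian_smul m c hf.1, hf', smul_zero]⟩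

/-- The space `V₀^{n+1/2}(0)`: the functions `f` in `automorphicFunctions` such that `Δ₀^n f` is a
holomorphic modular form of weight `0` for the full modular group (possibly zero). -/
def VHalf (n : ℕ) : Submodule ℂ (ℍ → ℂ) where
  carrier := {f | f ∈ automorphicFunctions ∧ ∃ g : ModularForm 𝒮ℒ 0, hypLaplacian^[n] f = ⇑g}
  zero_mem' := by
    refine ⟨zero_mem _, 0, ?_⟩
    have h := iterate_hypLaplacian_smul n (f := 0) 0 (zero_mem automorphicFunctions).1
    rw [FunLike.coe_zero]
    simpa using h
  add_mem' := by
    rintro f₁ f₂ ⟨hf, g₁, hg₁⟩ ⟨hf', g₂, hg₂⟩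
    exact ⟨add_mem hf hf', g₁ + g₂, by
      rw [iterate_hypLaplacian_add n hf.1 hf'.1, hg₁, hg₂, FunLike.coe_add]⟩
  smul_mem' := by
    rintro c f ⟨hf, g, hg⟩
    exact ⟨Submodule.smul_mem _ c hf, c • g, by
      rw [iterate_hypLaplacian_smul n c hf.1, hg]; rfl⟩

/-- The non-holomorphic Eisenstein series
`E₀(z,s) = ½ ∑_{(m,n) ≠ (0,0)} y^s / |mz+n|^{2s}`, meaningful for `Re s > 1`. -/
def eisenstein (z : ℍ) (s : ℂ) : ℂ :=
  1 / 2 * ∑' p : {p : ℤ × ℤ // p ≠ 0},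
    (z.im : ℂ) ^ s / ((‖(p.1.1 : ℂ) * z + p.1.2‖ : ℝ) : ℂ) ^ (2 * s)

/-- `f` is the analytic continuation to all of `ℂ` of `s ↦ s(s-1) π^{-s} Γ(s) E₀(z,s)`, which is
given by the series for `Re s > 1`. -/
def IsDoublyCompleted (z : ℍ) (f : ℂ → ℂ) : Prop :=
  Differentiable ℂ f ∧
    ∀ s : ℂ, 1 < s.re → f s = s * (s - 1) * (Real.pi : ℂ) ^ (-s) * Complex.Gamma s * eisenstein z s

theorem IsDoublyCompleted.unique {z : ℍ} {f g : ℂ → ℂ} (hf : IsDoublyCompleted z f)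
    (hg : IsDoublyCompleted z g) : f = g := by
  refine AnalyticOnNhd.eq_of_eventuallyEq (𝕜 := ℂ) (z₀ := 2)
    (fun s _ ↦ hf.1.analyticAt s) (fun s _ ↦ hg.1.analyticAt s) ?_
  have : {s : ℂ | 1 < s.re} ∈ 𝓝 (2 : ℂ) :=
    (isOpen_lt continuous_const Complex.continuous_re).mem_nhds (by simp)
  filter_upwards [this] with s hs
  rw [hf.2 s hs, hg.2 s hs]

/-- The doubly-completed Eisenstein series: the entire function of `s` that continues
`s(s-1) π^{-s} Γ(s) E₀(z,s)` (unique by `IsDoublyCompleted.unique`). -/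
def doublyCompletedEisenstein (z : ℍ) : ℂ → ℂ :=
  Classical.epsilon (IsDoublyCompleted z)

/-- The `n`-th Taylor coefficient `F_n(z)` at `s = 0` of the doubly-completed Eisenstein series. -/
def F (n : ℕ) (z : ℍ) : ℂ :=
  iteratedDeriv n (doublyCompletedEisenstein z) 0 / (n.factorial : ℂ)

end PolyharmonicMaass

end

/-!
By Poisson summation for the theta function `θ_z(t) = ∑ exp (-π t |mz + n|² / y)`,
`Ê(z, s) = 1/2 + s (s - 1) / 2 * ∫_1^∞ (θ_z(t) - 1) (t ^ (s - 1) + t ^ (-s)) dt`, an entire function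
of `s` whose Taylor coefficients are lattice sums of Laplace transforms of powers of `log t`.
Since `Δ₀` acts on each exponential as `t² ∂_t² + 2t ∂_t`, integrating by parts gives
`Δ₀ F_n = F_{n-2} - F_{n-1}`, hence `Δ₀ⁿ F_n = (-1)ⁿ / 2`.

Conversely, if `Δ₀^{k+1} f = 0` then `g = Δ₀ᵏ f` is harmonic and automorphic, so `∂g/∂z` is
holomorphic of weight two; an interior gradient estimate bounds its growth at the cusp, so it is a
level one modular form of weight two and vanishes. The same applies to the conjugate of `g`, so `g`
is constant, and subtracting a multiple of `F_k` from `f` lowers the order.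
-/

open scoped UpperHalfPlane

noncomputable section

namespace PolyharmonicMaass

open UpperHalfPlane hiding I
open Filter Asymptotics Complex MeasureTheory
open scoped MatrixGroups ContDiff Topology Laplacian ComplexConjugate

/-! ### Wirtinger derivatives -/

/-- The real-linear map `v ↦ A v + B v̄` of `ℂ`, which is the differential of a function whose
Wirtinger derivatives `∂f/∂z` and `∂f/∂z̄` are `A` and `B`. -/
def wirtinger (A B : ℂ) : ℂ →L[ℝ] ℂ :=
  A • ContinuousLinearMap.id ℝ ℂ + B • conjCLE.toContinuousLinearMap

@[simp]
theorem wirtinger_apply (A B v : ℂ) : wirtinger A B v = A * v + B * conj v := by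
  simp [wirtinger]

/-- `f` is real differentiable at `z`, with Wirtinger derivatives `∂f/∂z = A` and
`∂f/∂z̄ = B`. -/
def HasWirtingerAt (f : ℂ → ℂ) (A B z : ℂ) : Prop :=
  HasFDerivAt f (wirtinger A B) z

/-- The Wirtinger derivative `∂f/∂z`, with the junk value `0` where `f` is not differentiable. -/
def dz (f : ℂ → ℂ) (z : ℂ) : ℂ :=
  (fderiv ℝ f z 1 - I * fderiv ℝ f z I) / 2

/-- The Wirtinger derivative `∂f/∂z̄`, with the junk value `0` where `f` is not
differentiable. -/
def dzbar (f : ℂ → ℂ) (z : ℂ) : ℂ :=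
  (fderiv ℝ f z 1 + I * fderiv ℝ f z I) / 2

theorem realLinear_ext {E : Type*} [AddCommGroup E] [Module ℝ E] [TopologicalSpace E]
    {L L' : ℂ →L[ℝ] E} (h_one : L 1 = L' 1) (h_I : L I = L' I) : L = L' := by
  refine ContinuousLinearMap.coe_injective (basisOneI.ext fun i ↦ ?_)
  fin_cases i
  · simpa using h_one
  · simpa using h_I

theorem wirtinger_dz_dzbar (f : ℂ → ℂ) (z : ℂ) : wirtinger (dz f z) (dzbar f z) = fderiv ℝ f z := by
  refine realLinear_ext ?_ ?_
  · simp only [wirtinger_apply, dz, dzbar, map_one]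
    ring
  · simp only [wirtinger_apply, dz, dzbar, conj_I]
    linear_combination -fderiv ℝ f z I * I_mul_I

theorem hasWirtingerAt_of_differentiableAt {f : ℂ → ℂ} {z : ℂ} (hf : DifferentiableAt ℝ f z) :
    HasWirtingerAt f (dz f z) (dzbar f z) z := by
  rw [HasWirtingerAt, wirtinger_dz_dzbar]
  exact hf.hasFDerivAt

theorem hasWirtingerAt_of_hasDerivAt {f : ℂ → ℂ} {f' z : ℂ} (hf : HasDerivAt f f' z) :
    HasWirtingerAt f f' 0 z := by
  refine (hf.hasFDerivAt.restrictScalars ℝ).congr_fderiv ?_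
  ext v
  simp [mul_comm]

theorem hasWirtingerAt_const (c z : ℂ) : HasWirtingerAt (fun _ ↦ c) 0 0 z :=
  hasWirtingerAt_of_hasDerivAt (hasDerivAt_const z c)

theorem hasWirtingerAt_im (z : ℂ) :
    HasWirtingerAt (fun w ↦ (w.im : ℂ)) (-I / 2) (I / 2) z := by
  refine (ofRealCLM.comp imCLM).hasFDerivAt.congr_fderiv ?_
  refine realLinear_ext ?_ ?_
  · simp only [ContinuousLinearMap.comp_apply, imCLM_apply, ofRealCLM_apply, one_im, ofReal_zero,
      wirtinger_apply, map_one]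
    ring
  · simp only [ContinuousLinearMap.comp_apply, imCLM_apply, ofRealCLM_apply, Complex.I_im,
      ofReal_one, wirtinger_apply, conj_I]
    linear_combination I_mul_I

namespace HasWirtingerAt

variable {f g : ℂ → ℂ} {A B A' B' z : ℂ}

theorem congr_coeff (hf : HasWirtingerAt f A B z) (hA : A = A') (hB : B = B') :
    HasWirtingerAt f A' B' z :=
  hA ▸ hB ▸ hf

theorem congr_of_eventuallyEq (hf : HasWirtingerAt f A B z) (h : g =ᶠ[𝓝 z] f) :
    HasWirtingerAt g A B z :=
  HasFDerivAt.congr_of_eventuallyEq hf h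

theorem differentiableAt (hf : HasWirtingerAt f A B z) : DifferentiableAt ℝ f z :=
  HasFDerivAt.differentiableAt hf

theorem dz_eq (hf : HasWirtingerAt f A B z) : dz f z = A := by
  rw [dz, HasFDerivAt.fderiv hf]
  simp only [wirtinger_apply, map_one, conj_I]
  linear_combination (B - A) / 2 * I_mul_I

theorem dzbar_eq (hf : HasWirtingerAt f A B z) : dzbar f z = B := by
  rw [dzbar, HasFDerivAt.fderiv hf]
  simp only [wirtinger_apply, map_one, conj_I]
  linear_combination (A - B) / 2 * I_mul_I

theorem hasDerivAt (hf : HasWirtingerAt f A 0 z) : HasDerivAt f A z := by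
  refine hasFDerivAt_of_restrictScalars ℝ hf ?_
  ext
  simp [mul_comm]

theorem add (hf : HasWirtingerAt f A B z) (hg : HasWirtingerAt g A' B' z) :
    HasWirtingerAt (fun w ↦ f w + g w) (A + A') (B + B') z := by
  refine (HasFDerivAt.add hf hg).congr_fderiv ?_
  ext v
  simp only [add_apply, wirtinger_apply]
  ring

theorem mul (hf : HasWirtingerAt f A B z) (hg : HasWirtingerAt g A' B' z) :
    HasWirtingerAt (fun w ↦ f w * g w) (A * g z + f z * A') (B * g z + f z * B') z := by
  refine (HasFDerivAt.mul hf hg).congr_fderiv ?_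
  ext v
  simp only [add_apply, smul_apply, wirtinger_apply, smul_eq_mul]
  ring

theorem const_mul (c : ℂ) (hf : HasWirtingerAt f A B z) :
    HasWirtingerAt (fun w ↦ c * f w) (c * A) (c * B) z :=
  ((hasWirtingerAt_const c z).mul hf).congr_coeff (by ring) (by ring)

theorem star (hf : HasWirtingerAt f A B z) :
    HasWirtingerAt (fun w ↦ conj (f w)) (conj B) (conj A) z := by
  refine ((conjCLE.toContinuousLinearMap.hasFDerivAt (x := f z)).comp z hf).congr_fderiv ?_
  ext v
  simp only [ContinuousLinearMap.comp_apply, ContinuousLinearEquiv.coe_coe, wirtinger_apply,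
    ContinuousAlgEquiv.coeCLE_apply, conjCAE_apply, map_add, map_mul, Complex.conj_conj]
  ring

theorem comp_hasDerivAt {G : ℂ → ℂ} {G' : ℂ} (hf : HasWirtingerAt f A B (G z))
    (hG : HasDerivAt G G' z) :
    HasWirtingerAt (fun w ↦ f (G w)) (A * G') (B * conj G') z := by
  refine (HasFDerivAt.comp z hf (hG.hasFDerivAt.restrictScalars ℝ)).congr_fderiv ?_
  ext v
  simp only [ContinuousLinearMap.comp_apply, ContinuousLinearMap.coe_restrictScalars',
    ContinuousLinearMap.toSpanSingleton_apply, smul_eq_mul, wirtinger_apply, map_mul]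
  ring

theorem scomp {q : ℂ → ℝ} {Φ : ℝ → ℂ} {Φ' : ℂ} (hq : HasWirtingerAt (fun w ↦ (q w : ℂ)) A B z)
    (hΦ : HasDerivAt Φ Φ' (q z)) :
    HasWirtingerAt (fun w ↦ Φ (q w)) (Φ' * A) (Φ' * B) z := by
  have hq' : HasFDerivAt q (reCLM.comp (wirtinger A B)) z := by
    simpa using! reCLM.hasFDerivAt.comp z hq
  have him (v : ℂ) : ((wirtinger A B v).re : ℂ) = wirtinger A B v := by
    have : imCLM.comp (wirtinger A B) = 0 :=
      (imCLM.hasFDerivAt.comp z hq).unique (by simpa using! hasFDerivAt_const (0 : ℝ) z)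
    exact Complex.ext (by simp) (by simpa using! (DFunLike.congr_fun this v).symm)
  refine (hΦ.hasFDerivAt.comp z hq').congr_fderiv (ContinuousLinearMap.ext fun v ↦ ?_)
  simp only [ContinuousLinearMap.comp_apply, ContinuousLinearMap.toSpanSingleton_apply,
    reCLM_apply, real_smul, him]
  rw [wirtinger_apply, wirtinger_apply]
  ring

end HasWirtingerAt

section SecondOrder

variable {f g : ℂ → ℂ} {z : ℂ} {n : WithTop ℕ∞}

theorem dz_congr (h : f =ᶠ[𝓝 z] g) : dz f z = dz g z := by
  rw [dz, dz, h.fderiv_eq]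

theorem dzbar_congr (h : f =ᶠ[𝓝 z] g) : dzbar f z = dzbar g z := by
  rw [dzbar, dzbar, h.fderiv_eq]

theorem contDiffAt_dz (hf : ContDiffAt ℝ (n + 1) f z) : ContDiffAt ℝ n (dz f) z := by
  have h := hf.fderiv_right (m := n) le_rfl
  exact ((h.clm_apply contDiffAt_const).sub
    (contDiffAt_const.mul (h.clm_apply contDiffAt_const))).div_const 2

theorem contDiffAt_dzbar (hf : ContDiffAt ℝ (n + 1) f z) : ContDiffAt ℝ n (dzbar f) z := by
  have h := hf.fderiv_right (m := n) le_rfl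
  exact ((h.clm_apply contDiffAt_const).add
    (contDiffAt_const.mul (h.clm_apply contDiffAt_const))).div_const 2

theorem laplacian_eq_fderiv_fderiv (f : ℂ → ℂ) (z : ℂ) :
    Δ f z = fderiv ℝ (fderiv ℝ f) z 1 1 + fderiv ℝ (fderiv ℝ f) z I I := by
  simp [InnerProductSpace.laplacian_eq_iteratedFDeriv_complexPlane, iteratedFDeriv_two_apply]

theorem laplacian_eq_dzbar_dz (hf : ContDiffAt ℝ 2 f z) : Δ f z = 4 * dzbar (dz f) z := by
  have hd := ((hf.fderiv_right (m := 1) le_rfl).differentiableAt one_ne_zero).hasFDerivAt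
  have hdir (v : ℂ) := hd.clm_apply (hasFDerivAt_const v z)
  have hdz := ((hdir 1).fun_sub ((hdir I).const_mul I)).mul_const (2⁻¹ : ℂ)
  have hsymm := (hf.isSymmSndFDerivAt (by simp)).eq 1 I
  rw [dzbar, show dz f = _ from funext fun w ↦ div_eq_mul_inv _ _, hdz.fderiv,
    laplacian_eq_fderiv_fderiv]
  simp only [ContinuousLinearMap.comp_zero, zero_add, smul_apply, sub_apply,
    ContinuousLinearMap.flip_apply, hsymm, smul_eq_mul]
  linear_combination fderiv ℝ (fderiv ℝ f) z I I * I_mul_I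

theorem laplacian_eq_dz_dzbar (hf : ContDiffAt ℝ 2 f z) : Δ f z = 4 * dz (dzbar f) z := by
  have hd := ((hf.fderiv_right (m := 1) le_rfl).differentiableAt one_ne_zero).hasFDerivAt
  have hdir (v : ℂ) := hd.clm_apply (hasFDerivAt_const v z)
  have hdz := ((hdir 1).fun_add ((hdir I).const_mul I)).mul_const (2⁻¹ : ℂ)
  have hsymm := (hf.isSymmSndFDerivAt (by simp)).eq 1 I
  rw [dz, show dzbar f = _ from funext fun w ↦ div_eq_mul_inv _ _, hdz.fderiv,
    laplacian_eq_fderiv_fderiv]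
  simp only [ContinuousLinearMap.comp_zero, zero_add, smul_add, add_apply, smul_apply,
    ContinuousLinearMap.flip_apply, hsymm, smul_eq_mul]
  linear_combination fderiv ℝ (fderiv ℝ f) z I I * I_mul_I

theorem laplacian_comp_holomorphic {G : ℂ → ℂ} (hf : ContDiffAt ℝ 2 f (G z))
    (hG : AnalyticAt ℂ G z) : Δ (f ∘ G) z = (‖deriv G z‖ : ℂ) ^ 2 * Δ f (G z) := by
  have hdz : dz (f ∘ G) =ᶠ[𝓝 z] fun w ↦ dz f (G w) * deriv G w := by
    filter_upwards [hG.continuousAt.eventually (hf.eventually (by simp)), hG.eventually_analyticAt]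
      with w hfw hGw
    exact ((hasWirtingerAt_of_differentiableAt (hfw.differentiableAt two_ne_zero)).comp_hasDerivAt
      hGw.differentiableAt.hasDerivAt).dz_eq
  have hdf := (contDiffAt_dz (n := 1) hf).differentiableAt one_ne_zero
  have hG' := hasWirtingerAt_of_hasDerivAt hG.deriv.differentiableAt.hasDerivAt
  rw [laplacian_eq_dzbar_dz (hf.comp z (hG.contDiffAt.restrict_scalars ℝ)), dzbar_congr hdz,
    (((hasWirtingerAt_of_differentiableAt hdf).comp_hasDerivAt
      hG.differentiableAt.hasDerivAt).mul hG').dzbar_eq, laplacian_eq_dzbar_dz hf,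
    ← Complex.mul_conj']
  ring

end SecondOrder

/-! ### Isometries of the upper half-plane -/

theorem eventually_im_pos (z : ℍ) : ∀ᶠ w : ℂ in 𝓝 (z : ℂ), 0 < w.im :=
  isOpen_upperHalfPlaneSet.mem_nhds z.im_pos

theorem IsSmooth.iterate_hypLaplacian {f : ℍ → ℂ} (hf : IsSmooth f) (k : ℕ) :
    IsSmooth (PolyharmonicMaass.hypLaplacian^[k] f) := by
  induction k with
  | zero => exact hf
  | succ k ih => rw [Function.iterate_succ_apply']; exact ih.hypLaplacian

/-- The self-map `τ` of the upper half-plane is the restriction of a holomorphic function `G` and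
preserves the hyperbolic metric `|dz| / Im z`. `G` is an argument because derivatives are taken
on `ℂ`. -/
structure IsHolomorphicIsometry (τ : ℍ → ℍ) (G : ℂ → ℂ) : Prop where
  coe_eq : ∀ z : ℍ, (τ z : ℂ) = G z
  differentiableOn : DifferentiableOn ℂ G {z : ℂ | 0 < z.im}
  im_eq : ∀ z : ℍ, (τ z).im = ‖deriv G z‖ * z.im

namespace IsHolomorphicIsometry

variable {τ : ℍ → ℍ} {G : ℂ → ℂ}

theorem analyticAt (h : IsHolomorphicIsometry τ G) (z : ℍ) : AnalyticAt ℂ G z :=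
  h.differentiableOn.analyticAt (isOpen_upperHalfPlaneSet.mem_nhds z.im_pos)

theorem comp_ofComplex_eventuallyEq (h : IsHolomorphicIsometry τ G) {α : Type*} (f : ℍ → α)
    (z : ℍ) :
    (f ∘ τ) ∘ ofComplex =ᶠ[𝓝 (z : ℂ)] (f ∘ ofComplex) ∘ G := by
  filter_upwards [eventually_im_pos z] with w hw
  have hG : ↑(τ ⟨w, hw⟩) = G w := h.coe_eq ⟨w, hw⟩
  rw [Function.comp_apply, Function.comp_apply, Function.comp_apply, Function.comp_apply,
    ofComplex_apply_of_im_pos hw, ← hG, ofComplex_apply]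

theorem isSmooth_comp (h : IsHolomorphicIsometry τ G) {f : ℍ → ℂ} (hf : IsSmooth f) :
    IsSmooth (f ∘ τ) := by
  intro z hz
  have hG : ↑(τ ⟨z, hz⟩) = G z := h.coe_eq ⟨z, hz⟩
  have hcomp : ContDiffAt ℝ ∞ ((f ∘ ofComplex) ∘ G) z :=
    (hG ▸ hf.contDiffAt (τ ⟨z, hz⟩)).comp z
      ((h.analyticAt ⟨z, hz⟩).contDiffAt.restrict_scalars ℝ)
  exact (hcomp.congr_of_eventuallyEq
    (h.comp_ofComplex_eventuallyEq f ⟨z, hz⟩)).contDiffWithinAt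

theorem hypLaplacian_comp (h : IsHolomorphicIsometry τ G) {f : ℍ → ℂ} (hf : IsSmooth f) :
    hypLaplacian (f ∘ τ) = hypLaplacian f ∘ τ := by
  funext z
  simp only [hypLaplacian, Function.comp_apply]
  rw [(InnerProductSpace.laplacian_congr_nhds (h.comp_ofComplex_eventuallyEq f z)).eq_of_nhds,
    laplacian_comp_holomorphic, h.im_eq, ← h.coe_eq]
  · push_cast
    ring
  · rw [← h.coe_eq]
    exact (hf.contDiffAt _).of_le (WithTop.coe_le_coe.2 le_top)
  · exact h.analyticAt z

theorem iterate_hypLaplacian_comp (h : IsHolomorphicIsometry τ G) {f : ℍ → ℂ} (hf : IsSmooth f)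
    (k : ℕ) :
    hypLaplacian^[k] (f ∘ τ) = hypLaplacian^[k] f ∘ τ := by
  induction k with
  | zero => rfl
  | succ k ih =>
    rw [Function.iterate_succ_apply', ih, Function.iterate_succ_apply', h.hypLaplacian_comp]
    exact hf.iterate_hypLaplacian k

theorem dz_comp (h : IsHolomorphicIsometry τ G) {f : ℍ → ℂ} (hf : IsSmooth f) (z : ℍ) :
    dz ((f ∘ τ) ∘ ofComplex) z = dz (f ∘ ofComplex) (τ z) * deriv G z := by
  have hd := (hf.contDiffAt (τ z)).differentiableAt (by simp)
  rw [h.coe_eq] at hd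
  rw [dz_congr (h.comp_ofComplex_eventuallyEq f z), h.coe_eq]
  exact ((hasWirtingerAt_of_differentiableAt hd).comp_hasDerivAt
    (h.analyticAt z).differentiableAt.hasDerivAt).dz_eq

end IsHolomorphicIsometry

theorem det_coe_eq (γ : SL(2, ℤ)) : γ 0 0 * γ 1 1 - γ 0 1 * γ 1 0 = 1 := by
  rw [← Matrix.det_fin_two, γ.det_coe]

/-- The Möbius transformation of `ℂ` given by an integral matrix, with value `0` at its
pole. -/
def moebius (γ : SL(2, ℤ)) (z : ℂ) : ℂ := (γ 0 0 * z + γ 0 1) / (γ 1 0 * z + γ 1 1)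

theorem denom_ne_zero_of_im_pos (γ : SL(2, ℤ)) {z : ℂ} (hz : 0 < z.im) :
    (γ 1 0 * z + γ 1 1 : ℂ) ≠ 0 := by
  have := UpperHalfPlane.denom_ne_zero (γ : GL (Fin 2) ℝ) ⟨z, hz⟩
  simpa [UpperHalfPlane.denom] using this

theorem hasDerivAt_moebius (γ : SL(2, ℤ)) {z : ℂ} (hz : 0 < z.im) :
    HasDerivAt (moebius γ) (1 / (γ 1 0 * z + γ 1 1) ^ 2) z := by
  have hdenom := denom_ne_zero_of_im_pos γ hz
  have hnum_deriv : HasDerivAt (fun z : ℂ ↦ (γ 0 0 * z + γ 0 1 : ℂ)) (γ 0 0) z := by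
    simpa using ((hasDerivAt_id z).const_mul (γ 0 0 : ℂ)).add_const (γ 0 1 : ℂ)
  have hdenom_deriv : HasDerivAt (fun z : ℂ ↦ (γ 1 0 * z + γ 1 1 : ℂ)) (γ 1 0) z := by
    simpa using ((hasDerivAt_id z).const_mul (γ 1 0 : ℂ)).add_const (γ 1 1 : ℂ)
  refine (hnum_deriv.div hdenom_deriv hdenom).congr_deriv ?_
  rw [div_left_inj' (pow_ne_zero 2 hdenom)]
  have hdet : (γ 0 0 * γ 1 1 - γ 0 1 * γ 1 0 : ℂ) = 1 := by exact_mod_cast det_coe_eq γ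
  linear_combination hdet

theorem coe_smul_eq_moebius (γ : SL(2, ℤ)) (z : ℍ) : ((γ • z : ℍ) : ℂ) = moebius γ z := by
  rw [moebius, UpperHalfPlane.coe_specialLinearGroup_apply]
  simp

theorem isHolomorphicIsometry_smul (γ : SL(2, ℤ)) :
    IsHolomorphicIsometry (fun z ↦ γ • z) (moebius γ) where
  coe_eq := coe_smul_eq_moebius γ
  differentiableOn z hz := (hasDerivAt_moebius γ hz).differentiableAt.differentiableWithinAt
  im_eq z := by
    rw [(hasDerivAt_moebius γ z.im_pos).deriv, ModularGroup.im_smul_eq_div_normSq,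
      ModularGroup.denom_apply, norm_div, norm_one, norm_pow, Complex.sq_norm]
    ring

/-- The map `z ↦ x + y z` of the upper half-plane, where `w = x + i y`. -/
def affineMap (w z : ℍ) : ℍ :=
  ⟨w.re + w.im * z, by simp [w.im_pos, z.im_pos]⟩

theorem coe_affineMap (w z : ℍ) : (affineMap w z : ℂ) = w.re + w.im * z := rfl

theorem isHolomorphicIsometry_affineMap (w : ℍ) :
    IsHolomorphicIsometry (affineMap w) (fun z ↦ w.re + w.im * z) where
  coe_eq z := rfl
  differentiableOn := by fun_prop
  im_eq z := by
    have hderiv : deriv (fun z : ℂ ↦ (w.re + w.im * z : ℂ)) z = w.im := by simp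
    rw [hderiv, norm_real, Real.norm_of_nonneg w.im_pos.le, ← UpperHalfPlane.coe_im,
      coe_affineMap]
    simp

/-! ### Integration by parts against test functions -/

section TestFunctions

variable {U : Set ℂ} {ψ H : ℂ → ℂ}

theorem contDiffOn_dz {n : WithTop ℕ∞} (hU : IsOpen U) (hH : ContDiffOn ℝ (n + 1) H U) :
    ContDiffOn ℝ n (dz H) U :=
  fun _ hz ↦ (contDiffAt_dz (hH.contDiffAt (hU.mem_nhds hz))).contDiffWithinAt

theorem contDiff_dz {n : WithTop ℕ∞} (hψ : ContDiff ℝ (n + 1) ψ) : ContDiff ℝ n (dz ψ) :=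
  contDiff_iff_contDiffAt.2 fun _ ↦ contDiffAt_dz hψ.contDiffAt

theorem contDiff_dzbar {n : WithTop ℕ∞} (hψ : ContDiff ℝ (n + 1) ψ) : ContDiff ℝ n (dzbar ψ) :=
  contDiff_iff_contDiffAt.2 fun _ ↦ contDiffAt_dzbar hψ.contDiffAt

theorem tsupport_dz_subset (ψ : ℂ → ℂ) : tsupport (dz ψ) ⊆ tsupport ψ := by
  refine closure_minimal (fun z hz ↦ ?_) (isClosed_tsupport ψ)
  by_contra h
  have hψ : fderiv ℝ ψ z = 0 := image_eq_zero_of_notMem_tsupport (h <| tsupport_fderiv_subset ℝ ·)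
  exact hz (by simp [dz, hψ])

theorem tsupport_dzbar_subset (ψ : ℂ → ℂ) : tsupport (dzbar ψ) ⊆ tsupport ψ := by
  refine closure_minimal (fun z hz ↦ ?_) (isClosed_tsupport ψ)
  by_contra h
  have hψ : fderiv ℝ ψ z = 0 := image_eq_zero_of_notMem_tsupport (h <| tsupport_fderiv_subset ℝ ·)
  exact hz (by simp [dzbar, hψ])

theorem mul_eq_mul_of_tsupport_subset {H' : ℂ → ℂ} (hs : tsupport ψ ⊆ U) (h : Set.EqOn H H' U)
    (z : ℂ) : ψ z * H z = ψ z * H' z := by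
  by_cases hz : z ∈ tsupport ψ
  · rw [h (hs hz)]
  · simp only [image_eq_zero_of_notMem_tsupport hz, zero_mul]

theorem integrable_mul_of_tsupport_subset (hU : IsOpen U) (hψ : Continuous ψ)
    (hc : HasCompactSupport ψ) (hs : tsupport ψ ⊆ U) (hH : ContinuousOn H U) :
    Integrable (fun z ↦ ψ z * H z) := by
  refine (continuous_of_tsupport fun z hz ↦ ?_).integrable_of_hasCompactSupport hc.mul_right
  exact hψ.continuousAt.mul (hH.continuousAt (hU.mem_nhds (hs (tsupport_mul_subset_left hz))))

theorem integral_mul_fderiv_of_tsupport_subset (hU : IsOpen U) (hψ : ContDiff ℝ 1 ψ)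
    (hc : HasCompactSupport ψ) (hs : tsupport ψ ⊆ U) (hH : ContDiffOn ℝ 1 H U) (v : ℂ) :
    ∫ z, ψ z * fderiv ℝ H z v = -∫ z, fderiv ℝ ψ z v * H z := by
  have hψv : Continuous (fun z ↦ fderiv ℝ ψ z v) :=
    (hψ.continuous_fderiv one_ne_zero).clm_apply continuous_const
  have hHv : ContinuousOn (fun z ↦ fderiv ℝ H z v) U :=
    (hH.continuousOn_fderiv_of_isOpen hU le_rfl).clm_apply continuousOn_const
  have hsv : tsupport (fun z ↦ fderiv ℝ ψ z v) ⊆ tsupport ψ := tsupport_fderiv_apply_subset ℝ v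
  refine integral_mul_fderiv_eq_neg_fderiv_mul_of_integrable ?_ ?_ ?_ ?_ ?_
  · exact integrable_mul_of_tsupport_subset hU hψv (hc.mono' (subset_closure.trans hsv))
      (hsv.trans hs) hH.continuousOn
  · exact integrable_mul_of_tsupport_subset hU hψ.continuous hc hs hHv
  · exact integrable_mul_of_tsupport_subset hU hψ.continuous hc hs hH.continuousOn
  · exact fun z _ ↦ hψ.differentiable one_ne_zero z
  · exact fun z hz ↦ (hH.differentiableOn one_ne_zero).differentiableAt (hU.mem_nhds (hs hz))

theorem integral_mul_fderiv_add_mul_fderiv (hU : IsOpen U) (hψ : ContDiff ℝ 1 ψ)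
    (hc : HasCompactSupport ψ) (hs : tsupport ψ ⊆ U) (hH : ContDiffOn ℝ 1 H U) (a b v w : ℂ) :
    ∫ z, ψ z * (a * fderiv ℝ H z v + b * fderiv ℝ H z w) =
      -∫ z, (a * fderiv ℝ ψ z v + b * fderiv ℝ ψ z w) * H z := by
  have hψH (v : ℂ) : Integrable fun z ↦ ψ z * fderiv ℝ H z v :=
    integrable_mul_of_tsupport_subset hU hψ.continuous hc hs
      ((hH.continuousOn_fderiv_of_isOpen hU le_rfl).clm_apply continuousOn_const)
  have hsv (v : ℂ) : tsupport (fun z ↦ fderiv ℝ ψ z v) ⊆ tsupport ψ :=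
    tsupport_fderiv_apply_subset ℝ v
  have hHψ (v : ℂ) : Integrable fun z ↦ fderiv ℝ ψ z v * H z :=
    integrable_mul_of_tsupport_subset hU
      ((hψ.continuous_fderiv one_ne_zero).clm_apply continuous_const)
      (hc.mono' (subset_closure.trans (hsv v))) ((hsv v).trans hs) hH.continuousOn
  calc ∫ z, ψ z * (a * fderiv ℝ H z v + b * fderiv ℝ H z w)
      = ∫ z, (a * (ψ z * fderiv ℝ H z v) + b * (ψ z * fderiv ℝ H z w)) := by
        congr with z; ring
    _ = -(∫ z, (a * (fderiv ℝ ψ z v * H z) + b * (fderiv ℝ ψ z w * H z))) := by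
        rw [integral_add ((hψH v).const_mul a) ((hψH w).const_mul b),
          integral_add ((hHψ v).const_mul a) ((hHψ w).const_mul b)]
        simp only [integral_const_mul, integral_mul_fderiv_of_tsupport_subset hU hψ hc hs hH]
        ring
    _ = -∫ z, (a * fderiv ℝ ψ z v + b * fderiv ℝ ψ z w) * H z := by
        congr with z; ring

theorem integral_mul_dz (hU : IsOpen U) (hψ : ContDiff ℝ 1 ψ) (hc : HasCompactSupport ψ)
    (hs : tsupport ψ ⊆ U) (hH : ContDiffOn ℝ 1 H U) :
    ∫ z, ψ z * dz H z = -∫ z, dz ψ z * H z := by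
  convert integral_mul_fderiv_add_mul_fderiv hU hψ hc hs hH (1 / 2) (-I / 2) 1 I using 5 <;>
  · rw [dz]; ring

theorem integral_mul_dzbar (hU : IsOpen U) (hψ : ContDiff ℝ 1 ψ) (hc : HasCompactSupport ψ)
    (hs : tsupport ψ ⊆ U) (hH : ContDiffOn ℝ 1 H U) :
    ∫ z, ψ z * dzbar H z = -∫ z, dzbar ψ z * H z := by
  convert integral_mul_fderiv_add_mul_fderiv hU hψ hc hs hH (1 / 2) (I / 2) 1 I using 5 <;>
  · rw [dzbar]; ring

theorem laplacian_eq_dz_dzbar_of_contDiff (hψ : ContDiff ℝ 2 ψ) :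
    Δ ψ = fun z ↦ 4 * dz (dzbar ψ) z :=
  funext fun _ ↦ laplacian_eq_dz_dzbar hψ.contDiffAt

theorem contDiff_laplacian {n : WithTop ℕ∞} (hψ : ContDiff ℝ (n + 2) ψ) :
    ContDiff ℝ n (Δ ψ) := by
  rw [laplacian_eq_dz_dzbar_of_contDiff (hψ.of_le le_add_self)]
  exact contDiff_const.mul (contDiff_dz (contDiff_dzbar (by rwa [add_assoc, one_add_one_eq_two])))

theorem tsupport_laplacian_subset (hψ : ContDiff ℝ 2 ψ) : tsupport (Δ ψ) ⊆ tsupport ψ := by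
  rw [laplacian_eq_dz_dzbar_of_contDiff hψ]
  exact tsupport_mul_subset_right.trans
    ((tsupport_dz_subset _).trans (tsupport_dzbar_subset ψ))

theorem integral_mul_laplacian (hU : IsOpen U) (hψ : ContDiff ℝ 2 ψ) (hc : HasCompactSupport ψ)
    (hs : tsupport ψ ⊆ U) (hH : ContDiffOn ℝ 2 H U) :
    ∫ z, ψ z * Δ H z = ∫ z, Δ ψ z * H z := by
  have hψ' : ContDiff ℝ 1 (dzbar ψ) := contDiff_dzbar hψ
  have hs' := tsupport_dzbar_subset ψ
  calc ∫ z, ψ z * Δ H z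
      = ∫ z, ψ z * (4 * dzbar (dz H) z) := integral_congr_ae <| ae_of_all _ <|
        mul_eq_mul_of_tsupport_subset hs fun z hz ↦
          laplacian_eq_dzbar_dz (hH.contDiffAt (hU.mem_nhds hz))
    _ = 4 * ∫ z, ψ z * dzbar (dz H) z := by
        rw [← integral_const_mul]
        congr with z; ring
    _ = 4 * ∫ z, dz (dzbar ψ) z * H z := by
        rw [integral_mul_dzbar hU (hψ.of_le one_le_two) hc hs (contDiffOn_dz hU hH),
          integral_mul_dz hU hψ' (hc.mono' (subset_closure.trans hs')) (hs'.trans hs)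
            (hH.of_le one_le_two), neg_neg]
    _ = ∫ z, Δ ψ z * H z := by
        rw [laplacian_eq_dz_dzbar_of_contDiff hψ, ← integral_const_mul]
        congr with z; ring

end TestFunctions

theorem norm_integral_mul_comp_ofComplex_le {ψ : ℂ → ℂ} (hψ : Integrable ψ)
    (hs : tsupport ψ ⊆ {z | 0 < z.im}) {h : ℍ → ℂ} {M : ℝ}
    (hM : ∀ z : ℍ, (z : ℂ) ∈ tsupport ψ → ‖h z‖ ≤ M) :
    ‖∫ z, ψ z * h (ofComplex z)‖ ≤ (∫ z, ‖ψ z‖) * M := by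
  rw [← integral_mul_const]
  refine norm_integral_le_of_norm_le (hψ.norm.mul_const M) (ae_of_all _ fun z ↦ ?_)
  rw [norm_mul]
  by_cases hz : z ∈ tsupport ψ
  · have hz' : 0 < z.im := hs hz
    refine mul_le_mul_of_nonneg_left (hM _ ?_) (norm_nonneg _)
    rwa [ofComplex_apply_of_im_pos hz']
  · simp [image_eq_zero_of_notMem_tsupport hz]

theorem exists_norm_integral_mul_iterate_hypLaplacian_le (k : ℕ) {ψ : ℂ → ℂ}
    (hψ : ContDiff ℝ ∞ ψ) (hc : HasCompactSupport ψ) (hs : tsupport ψ ⊆ {z | 0 < z.im}) :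
    ∃ C : ℝ, ∀ (h : ℍ → ℂ) (M : ℝ), IsSmooth h → (∀ z : ℍ, (z : ℂ) ∈ tsupport ψ → ‖h z‖ ≤ M) →
      ‖∫ z : ℂ, ψ z * hypLaplacian^[k] h (ofComplex z)‖ ≤ C * M := by
  induction k generalizing ψ with
  | zero =>
    exact ⟨∫ z, ‖ψ z‖, fun h M _ hM ↦ norm_integral_mul_comp_ofComplex_le
      (hψ.continuous.integrable_of_hasCompactSupport hc) hs hM⟩
  | succ k ih =>
    set χ : ℂ → ℂ := fun z ↦ (z.im : ℂ) ^ 2 * ψ z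
    have hχ : ContDiff ℝ ∞ χ := ((ofRealCLM.contDiff.comp imCLM.contDiff).pow 2).mul hψ
    have hχs : tsupport χ ⊆ tsupport ψ := tsupport_mul_subset_right
    have hΔs : tsupport (Δ χ) ⊆ tsupport ψ :=
      (tsupport_laplacian_subset (hχ.of_le ENat.LEInfty.out)).trans hχs
    obtain ⟨C, hC⟩ := ih (contDiff_laplacian (n := ∞) hχ)
      (hc.mono' (subset_closure.trans hΔs)) (hΔs.trans hs)
    refine ⟨C, fun h M hh hM ↦ ?_⟩
    convert hC h M hh fun z hz ↦ hM z (hΔs hz) using 2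
    have hk : ContDiffOn ℝ 2 (hypLaplacian^[k] h ∘ ofComplex) {z | 0 < z.im} :=
      (hh.iterate_hypLaplacian k).of_le ENat.LEInfty.out
    refine Eq.trans (integral_congr_ae (ae_of_all _ fun z ↦ ?_))
      (integral_mul_laplacian isOpen_upperHalfPlaneSet (hχ.of_le ENat.LEInfty.out) hc.mul_left
        (hχs.trans hs) hk)
    have hΔ : Set.EqOn (fun z ↦ hypLaplacian^[k + 1] h (ofComplex z))
        (fun z ↦ (z.im : ℂ) ^ 2 * Δ (hypLaplacian^[k] h ∘ ofComplex) z) {z | 0 < z.im} := by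
      intro w (hw : 0 < w.im)
      simp only [Function.iterate_succ_apply', hypLaplacian, ofComplex_apply_of_im_pos hw,
        ← coe_im]
    exact (mul_eq_mul_of_tsupport_subset hs hΔ z).trans
      ((mul_left_comm _ _ _).trans (mul_assoc _ _ _).symm)

/-! ### The mean value property with a radial weight -/

theorem integral_circle_mul_add {f : ℂ → ℂ} {c z : ℂ} {R : ℝ}
    (hf : DifferentiableOn ℂ f (Metric.closedBall c R)) (hz : ‖z‖ ≤ R) :
    ∫ θ in 0..2 * Real.pi, f (circleMap 0 1 θ * z + c) = 2 * Real.pi * f c := by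
  have hmaps : Set.MapsTo (fun w ↦ w * z + c) (closure (Metric.ball 0 |1|))
      (Metric.closedBall c R) := by
    intro w hw
    rw [abs_one, closure_ball _ one_ne_zero, mem_closedBall_zero_iff] at hw
    simpa using (mul_le_mul hw hz (norm_nonneg z) zero_le_one).trans (one_mul R).le
  have hmean := (hf.comp (by fun_prop) hmaps).diffContOnCl.circleAverage
  rw [Real.circleAverage_def, inv_smul_eq_iff₀ (by positivity), real_smul] at hmean
  simpa using hmean

theorem measurePreserving_circleMap_mul (θ : ℝ) :
    MeasurePreserving (fun z : ℂ ↦ circleMap 0 1 θ * z) := by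
  convert (rotation (Circle.exp θ)).measurePreserving using 1
  ext z
  simp [circleMap]

theorem integral_radial_mul {ρ : ℝ → ℂ} {f : ℂ → ℂ} {c : ℂ} {R : ℝ}
    (hf : DifferentiableOn ℂ f (Metric.closedBall c R)) (hρ : ∀ r, R < r → ρ r = 0)
    (hint : Integrable fun z ↦ ρ ‖z - c‖ * f z) :
    ∫ z, ρ ‖z - c‖ * f z = (∫ z, ρ ‖z - c‖) * f c := by
  let G : ℂ → ℂ := fun z ↦ ρ ‖z‖ * f (z + c)
  have hG : Integrable G := by simpa [G] using hint.comp_add_right c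
  have hrot (θ : ℝ) : ∫ z, G (circleMap 0 1 θ * z) = ∫ z, G z :=
    (measurePreserving_circleMap_mul θ).integral_comp
      (measurableEmbedding_mulLeft₀ (circleMap_ne_center one_ne_zero)) G
  have hprod : Integrable (fun p : ℝ × ℂ ↦ G (circleMap 0 1 p.1 * p.2))
      ((volume.restrict (Set.Ioc 0 (2 * Real.pi))).prod volume) :=
    MeasurePreserving.integrable_comp_of_integrable
      ((MeasurePreserving.id _).skew_product (by fun_prop)
        (ae_of_all _ fun θ ↦ (measurePreserving_circleMap_mul θ).map_eq)) (hG.comp_snd _)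
  have hmean (z : ℂ) :
      ∫ θ in 0..2 * Real.pi, G (circleMap 0 1 θ * z) = ρ ‖z‖ * (2 * Real.pi * f c) := by
    simp only [G, norm_mul, norm_circleMap_zero, abs_one, one_mul,
      intervalIntegral.integral_const_mul]
    rcases le_or_gt ‖z‖ R with hz | hz
    · rw [integral_circle_mul_add hf hz]
    · simp [hρ _ hz]
  have hπ : (2 * Real.pi : ℂ) ≠ 0 := by simp [Real.pi_ne_zero]
  refine mul_left_cancel₀ hπ ?_
  calc 2 * Real.pi * ∫ z, ρ ‖z - c‖ * f z
      = 2 * Real.pi * ∫ z, G z := by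
        rw [← integral_add_right_eq_self _ c]
        simp [G]
    _ = ∫ θ in 0..2 * Real.pi, ∫ z, G (circleMap 0 1 θ * z) := by
        simp [hrot]
    _ = ∫ z, ∫ θ in 0..2 * Real.pi, G (circleMap 0 1 θ * z) := by
        simp only [intervalIntegral.integral_of_le Real.two_pi_pos.le]
        exact integral_integral_swap hprod
    _ = 2 * Real.pi * ((∫ z, ρ ‖z - c‖) * f c) := by
        simp only [hmean, integral_mul_const]
        rw [← integral_add_right_eq_self (fun z ↦ ρ ‖z - c‖) c]
        simp only [add_sub_cancel_right]
        ring

/-- A smooth nonnegative weight, radial about `i` and supported in the ball of radius `1/2` about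
`i`; it is the test function of the interior gradient estimate. -/
def radialBump (z : ℂ) : ℝ := Real.smoothTransition (1 / 4 - ‖z - I‖ ^ 2)

theorem contDiff_radialBump : ContDiff ℝ ∞ fun z ↦ (radialBump z : ℂ) :=
  ofRealCLM.contDiff.comp (Real.smoothTransition.contDiff.comp
    (contDiff_const.sub ((contDiff_id.sub contDiff_const).norm_sq ℝ)))

theorem tsupport_radialBump_subset :
    tsupport (fun z ↦ (radialBump z : ℂ)) ⊆ Metric.closedBall I (1 / 2) := by
  refine closure_minimal (fun z hz ↦ ?_) Metric.isClosed_closedBall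
  contrapose! hz
  rw [Metric.mem_closedBall, dist_eq_norm, not_le] at hz
  simp only [radialBump, Function.mem_support, not_not, ofReal_eq_zero]
  exact Real.smoothTransition.zero_of_nonpos (by nlinarith)

theorem hasCompactSupport_radialBump : HasCompactSupport fun z ↦ (radialBump z : ℂ) :=
  (isCompact_closedBall _ _).of_isClosed_subset (isClosed_tsupport _) tsupport_radialBump_subset

theorem im_mem_Icc_of_mem_closedBall_I {z : ℂ} (hz : z ∈ Metric.closedBall I (1 / 2)) :
    z.im ∈ Set.Icc (1 / 2) 2 := by
  rw [Metric.mem_closedBall, dist_eq_norm] at hz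
  have him := abs_le.1 ((abs_im_le_norm _).trans hz)
  rw [sub_im, Complex.I_im] at him
  constructor <;> linarith

theorem closedBall_I_subset : Metric.closedBall I (1 / 2) ⊆ {z : ℂ | 0 < z.im} :=
  fun _ hz ↦ one_half_pos.trans_le (im_mem_Icc_of_mem_closedBall_I hz).1

theorem integral_radialBump_ne_zero : ∫ z, (radialBump z : ℂ) ≠ 0 := by
  have hcont : Continuous radialBump := by unfold radialBump; fun_prop
  have hsupp : HasCompactSupport radialBump :=
    hasCompactSupport_radialBump.comp_left (g := Complex.re) rfl
  rw [integral_complex_ofReal, ofReal_ne_zero]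
  refine (hcont.integral_pos_of_hasCompactSupport_nonneg_nonzero hsupp
    (fun z ↦ Real.smoothTransition.nonneg _) (x := I) ?_).ne'
  simp [radialBump]

theorem integral_radialBump_mul {φ : ℂ → ℂ} (hφ : DifferentiableOn ℂ φ {z : ℂ | 0 < z.im}) :
    ∫ z, radialBump z * φ z = (∫ z, (radialBump z : ℂ)) * φ I := by
  refine integral_radial_mul (ρ := fun r ↦ (Real.smoothTransition (1 / 4 - r ^ 2) : ℂ))
    (hφ.mono closedBall_I_subset) (fun r hr ↦ ?_) ?_
  · rw [Real.smoothTransition.zero_of_nonpos (by nlinarith), ofReal_zero]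
  · exact integrable_mul_of_tsupport_subset isOpen_upperHalfPlaneSet
      contDiff_radialBump.continuous hasCompactSupport_radialBump
      (tsupport_radialBump_subset.trans closedBall_I_subset) hφ.continuousOn

theorem differentiableOn_dz_of_hypLaplacian_eq_zero {g : ℍ → ℂ} (hg : IsSmooth g)
    (h0 : hypLaplacian g = 0) : DifferentiableOn ℂ (dz (g ∘ ofComplex)) {z : ℂ | 0 < z.im} := by
  intro z (hz : 0 < z.im)
  have hsmooth := hg.contDiffAt ⟨z, hz⟩
  have hdzbar : dzbar (dz (g ∘ ofComplex)) z = 0 := by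
    have hΔ := congr_fun h0 ⟨z, hz⟩
    rw [hypLaplacian, laplacian_eq_dzbar_dz (hsmooth.of_le ENat.LEInfty.out)] at hΔ
    simpa [hz.ne'] using hΔ
  have hdiff : DifferentiableAt ℝ (dz (g ∘ ofComplex)) z :=
    (contDiffAt_dz (n := ∞) hsmooth).differentiableAt (by simp)
  have hW := hasWirtingerAt_of_differentiableAt hdiff
  rw [hdzbar] at hW
  exact hW.hasDerivAt.differentiableAt.differentiableWithinAt

/-- Since `∂g/∂z` is holomorphic for `g = Δ₀ᵏ h`, its value at `i` is a multiple of its integral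
against `radialBump`, and all derivatives can be moved onto the bump. -/
theorem exists_norm_dz_iterate_hypLaplacian_le (k : ℕ) :
    ∃ C : ℝ, ∀ (h : ℍ → ℂ) (M : ℝ), IsSmooth h → hypLaplacian^[k + 1] h = 0 →
      (∀ z : ℍ, (z : ℂ) ∈ Metric.closedBall I (1 / 2) → ‖h z‖ ≤ M) →
      ‖dz (hypLaplacian^[k] h ∘ ofComplex) I‖ ≤ C * M := by
  have hsupp := tsupport_radialBump_subset.trans closedBall_I_subset
  have hdsupp := (tsupport_dz_subset (fun z ↦ (radialBump z : ℂ))).trans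
    tsupport_radialBump_subset
  obtain ⟨C, hC⟩ := exists_norm_integral_mul_iterate_hypLaplacian_le k
    (contDiff_dz contDiff_radialBump)
    ((isCompact_closedBall _ _).of_isClosed_subset (isClosed_tsupport _) hdsupp)
    (hdsupp.trans closedBall_I_subset)
  set c := ‖∫ z, (radialBump z : ℂ)‖
  have hc : 0 < c := norm_pos_iff.2 integral_radialBump_ne_zero
  refine ⟨C / c, fun h M hh h0 hM ↦ ?_⟩
  rw [Function.iterate_succ_apply'] at h0
  have hgs := hh.iterate_hypLaplacian k
  set g := hypLaplacian^[k] h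
  have hmean := integral_radialBump_mul (differentiableOn_dz_of_hypLaplacian_eq_zero hgs h0)
  rw [integral_mul_dz isOpen_upperHalfPlaneSet (contDiff_radialBump.of_le ENat.LEInfty.out)
    hasCompactSupport_radialBump hsupp (ContDiffOn.of_le hgs ENat.LEInfty.out)] at hmean
  rw [div_mul_eq_mul_div, le_div_iff₀ hc, mul_comm, ← norm_mul, ← hmean, norm_neg]
  exact hC h M hh fun z hz ↦ hM z (hdsupp hz)

theorem rpow_le_two_rpow_abs {t α : ℝ} (ht : t ∈ Set.Icc (1 / 2) 2) : t ^ α ≤ 2 ^ |α| := by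
  have ht0 : 0 < t := one_half_pos.trans_le ht.1
  rcases le_or_gt 0 α with hα | hα
  · rw [abs_of_nonneg hα]
    exact Real.rpow_le_rpow ht0.le ht.2 hα
  · rw [abs_of_neg hα, Real.rpow_neg zero_le_two, ← Real.inv_rpow zero_le_two, ← one_div]
    exact Real.rpow_le_rpow_of_nonpos one_half_pos ht.1 hα.le

theorem exists_norm_comp_affineMap_le {f : ℍ → ℂ} {α : ℝ}
    (hf : f =O[atImInfty] fun z : ℍ ↦ z.im ^ α) :
    ∃ D : ℝ, ∀ᶠ w in atImInfty, ∀ z : ℍ, (z : ℂ) ∈ Metric.closedBall I (1 / 2) →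
      ‖f (affineMap w z)‖ ≤ D * w.im ^ α := by
  obtain ⟨D, hD0, hD⟩ := hf.exists_nonneg
  obtain ⟨A, hA⟩ := (atImInfty_mem _).1 hD.bound
  refine ⟨D * 2 ^ |α|, (atImInfty_mem _).2 ⟨2 * A, fun w hw z hz ↦ ?_⟩⟩
  have hzim := im_mem_Icc_of_mem_closedBall_I hz
  have him : (affineMap w z).im = z.im * w.im := by
    rw [mul_comm, ← UpperHalfPlane.coe_im, coe_affineMap]
    simp
  have hAim : A ≤ (affineMap w z).im := by
    rw [him]
    nlinarith [w.im_pos, hzim.1, UpperHalfPlane.coe_im z]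
  calc ‖f (affineMap w z)‖ ≤ D * (z.im ^ α * w.im ^ α) := by
        refine (hA _ hAim).trans_eq ?_
        rw [him, Real.norm_of_nonneg (by positivity), Real.mul_rpow z.im_pos.le w.im_pos.le]
    _ ≤ D * (2 ^ |α| * w.im ^ α) := by
        gcongr
        exact rpow_le_two_rpow_abs hzim
    _ = D * 2 ^ |α| * w.im ^ α := (mul_assoc ..).symm

theorem dz_comp_affineMap {g : ℍ → ℂ} (hg : IsSmooth g) (w : ℍ) :
    dz ((g ∘ affineMap w) ∘ ofComplex) I = dz (g ∘ ofComplex) w * w.im := by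
  have hI : affineMap w UpperHalfPlane.I = w := by
    ext
    rw [coe_affineMap, UpperHalfPlane.coe_I]
    exact re_add_im (w : ℂ)
  have h := (isHolomorphicIsometry_affineMap w).dz_comp hg UpperHalfPlane.I
  rw [hI] at h
  simpa using h

theorem isBigO_dz_iterate_hypLaplacian {f : ℍ → ℂ} (hf : IsSmooth f) (hgr : ModerateGrowth f)
    (k : ℕ) (h0 : hypLaplacian^[k + 1] f = 0) :
    ∃ β : ℝ, (fun z : ℍ ↦ dz (hypLaplacian^[k] f ∘ ofComplex) z) =O[atImInfty]
      fun z ↦ z.im ^ β := by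
  obtain ⟨α, hα⟩ := hgr
  obtain ⟨D, hD⟩ := exists_norm_comp_affineMap_le hα
  obtain ⟨C, hC⟩ := exists_norm_dz_iterate_hypLaplacian_le k
  refine ⟨α, IsBigO.of_bound (C * D) ?_⟩
  filter_upwards [hD, (atImInfty_mem {w | 1 ≤ w.im}).2 ⟨1, fun _ h ↦ h⟩] with w hw hw1
  have hiso := isHolomorphicIsometry_affineMap w
  have hbound := hC (f ∘ affineMap w) _ (hiso.isSmooth_comp hf)
    (by rw [hiso.iterate_hypLaplacian_comp hf, h0]; rfl) hw
  rw [hiso.iterate_hypLaplacian_comp hf, dz_comp_affineMap (hf.iterate_hypLaplacian k), norm_mul,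
    norm_real, Real.norm_of_nonneg w.im_pos.le, ← mul_assoc] at hbound
  rw [Real.norm_of_nonneg (Real.rpow_nonneg w.im_pos.le _)]
  exact (le_mul_of_one_le_right (norm_nonneg _) hw1).trans hbound

open scoped ModularForm Manifold

open Function (Periodic)

theorem exists_tendsto_of_periodic_of_isLittleO {h : ℝ} (hh : 0 < h) {f : ℂ → ℂ}
    (hf : Periodic f h) (hhol : ∀ᶠ z in comap Complex.im atTop, DifferentiableAt ℂ f z)
    (ho : f =o[comap Complex.im atTop] fun z ↦ (Periodic.qParam h z)⁻¹) :
    ∃ c, Tendsto f (comap Complex.im atTop) (𝓝 c) := by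
  have hcusp : Periodic.cuspFunction h f =o[𝓝[≠] 0] fun q ↦ q⁻¹ := by
    refine (ho.comp_tendsto (Periodic.invQParam_tendsto hh)).congr' ?_ ?_ <;>
      refine eventually_nhdsWithin_of_forall fun q hq ↦ ?_
    · rw [Periodic.cuspFunction_eq_of_nonzero _ _ hq, Function.comp_def]
    · simp [Periodic.qParam_right_inv hh.ne' hq]
  have hconst (c : ℂ) : (fun _ ↦ c) =o[𝓝[≠] (0 : ℂ)] fun q ↦ q⁻¹ :=
    isLittleO_const_left.2 (Or.inr (tendsto_norm_atTop_iff_cobounded.2 tendsto_inv₀_nhdsNE_zero))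
  have hlim := tendsto_limUnder_of_differentiable_on_punctured_nhds_of_isLittleO
    (Periodic.eventually_differentiableAt_cuspFunction_nhds_ne_zero hh hf hhol)
    (by simpa using hcusp.sub (hconst _))
  refine ⟨_, (hlim.comp (Periodic.qParam_tendsto hh)).congr fun z ↦ ?_⟩
  exact Periodic.eq_cuspFunction hh.ne' hf z

theorem isLittleO_im_rpow_inv_qParam {h : ℝ} (hh : 0 < h) (β : ℝ) :
    (fun z : ℂ ↦ z.im ^ β) =o[comap Complex.im atTop] fun z ↦ (Periodic.qParam h z)⁻¹ := by
  have hexp := (isLittleO_rpow_exp_pos_mul_atTop β (b := 2 * Real.pi / h)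
    (by positivity)).comp_tendsto (tendsto_comap (f := Complex.im) (x := atTop))
  refine hexp.trans_isBigO (isBigO_of_le _ fun z ↦ le_of_eq ?_)
  rw [norm_inv, Periodic.norm_qParam, ← Real.exp_neg, Function.comp_apply,
    Real.norm_of_nonneg (Real.exp_pos _).le]
  congr 1
  ring

theorem isBoundedAtImInfty_of_isBigO_im_rpow {k : ℤ} (f : SlashInvariantForm 𝒮ℒ k) (hol : MDiff f)
    {β : ℝ} (hO : f =O[atImInfty] fun z ↦ z.im ^ β) : IsBoundedAtImInfty f := by
  have him : ∀ᶠ z in comap Complex.im atTop, 0 < z.im :=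
    tendsto_comap.eventually (eventually_gt_atTop 0)
  have hhol : ∀ᶠ z in comap Complex.im atTop, DifferentiableAt ℂ (f ∘ ofComplex) z := by
    filter_upwards [him] with z hz
    exact (UpperHalfPlane.mdifferentiable_iff.1 hol).differentiableAt
      (isOpen_upperHalfPlaneSet.mem_nhds hz)
  have hO' : (f ∘ ofComplex) =O[comap Complex.im atTop] fun z ↦ z.im ^ β := by
    refine (hO.comp_tendsto tendsto_comap_im_ofComplex).congr' .rfl ?_
    filter_upwards [him] with z hz
    simp [ofComplex_apply_of_im_pos hz, ← UpperHalfPlane.coe_im]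
  obtain ⟨c, hc⟩ := exists_tendsto_of_periodic_of_isLittleO one_pos
    (SlashInvariantFormClass.periodic_comp_ofComplex f (by simp)) hhol
    (hO'.trans_isLittleO (isLittleO_im_rpow_inv_qParam one_pos β))
  exact ((hc.comp tendsto_coe_atImInfty).congr fun z ↦ by simp).isBigO_one ℝ

theorem eq_zero_of_weight_two_of_isBigO_im_rpow (f : SlashInvariantForm 𝒮ℒ 2) (hol : MDiff f)
    {β : ℝ} (hO : f =O[atImInfty] fun z ↦ z.im ^ β) : ⇑f = 0 := by
  let f' : ModularForm 𝒮ℒ 2 :=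
    { f with
      holo' := hol
      bdd_at_cusps' := fun {c} hc ↦ by
        refine (OnePoint.isBoundedAt_iff_forall_SL2Z hc).2 fun γ _ ↦ ?_
        have hγ : ⇑f ∣[(2 : ℤ)] γ = f := f.slash_action_eq' _ ⟨γ, rfl⟩
        change IsBoundedAtImInfty (⇑f ∣[(2 : ℤ)] γ)
        rw [hγ]
        exact isBoundedAtImInfty_of_isBigO_im_rpow f hol hO }
  exact congr_arg DFunLike.coe
    (rank_zero_iff_forall_zero.1 ModularForm.levelOne_weight_two_rank_zero f')

/-- The derivative `∂f/∂z` of a smooth invariant function `f`, as a form of weight two. -/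
def weightTwoDeriv {f : ℍ → ℂ} (hf : IsSmooth f)
    (hinv : ∀ (γ : SL(2, ℤ)) (z : ℍ), f (γ • z) = f z) :
    SlashInvariantForm 𝒮ℒ 2 where
  toFun z := dz (f ∘ ofComplex) z
  slash_action_eq' := by
    rintro _ ⟨γ, rfl⟩
    funext w
    have hcomp := (isHolomorphicIsometry_smul γ).dz_comp hf w
    rw [show f ∘ (fun z ↦ γ • z) = f from funext (hinv γ),
      (hasDerivAt_moebius γ w.im_pos).deriv] at hcomp
    exact (ModularForm.SL_slash_apply ..).trans (by
      rw [hcomp, ModularGroup.denom_apply, zpow_neg, one_div]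
      rfl)

theorem iterate_hypLaplacian_smul_apply {f : ℍ → ℂ} (hf : f ∈ automorphicFunctions) (k : ℕ)
    (γ : SL(2, ℤ)) (z : ℍ) : hypLaplacian^[k] f (γ • z) = hypLaplacian^[k] f z := by
  have h := (isHolomorphicIsometry_smul γ).iterate_hypLaplacian_comp hf.1 k
  rw [show f ∘ (fun z ↦ γ • z) = f from funext (hf.2.1 γ)] at h
  exact (congr_fun h z).symm

theorem dz_iterate_hypLaplacian_eq_zero {f : ℍ → ℂ} (hf : f ∈ automorphicFunctions) (k : ℕ)
    (h0 : hypLaplacian^[k + 1] f = 0) (z : ℍ) :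
    dz (hypLaplacian^[k] f ∘ ofComplex) z = 0 := by
  have hs := hf.1.iterate_hypLaplacian k
  obtain ⟨β, hβ⟩ := isBigO_dz_iterate_hypLaplacian hf.1 hf.2.2 k h0
  rw [Function.iterate_succ_apply'] at h0
  have hol : MDiff fun z : ℍ ↦ dz (hypLaplacian^[k] f ∘ ofComplex) z := by
    refine UpperHalfPlane.mdifferentiable_iff.2
      ((differentiableOn_dz_of_hypLaplacian_eq_zero hs h0).congr fun z hz ↦ ?_)
    simp [ofComplex_apply_of_im_pos hz]
  exact congr_fun (eq_zero_of_weight_two_of_isBigO_im_rpow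
    (weightTwoDeriv hs (iterate_hypLaplacian_smul_apply hf k)) hol hβ) z

theorem IsSmooth.conj {f : ℍ → ℂ} (hf : IsSmooth f) : IsSmooth fun z ↦ conj (f z) :=
  conjCLE.contDiff.comp_contDiffOn hf

theorem conj_mem_automorphicFunctions {f : ℍ → ℂ} (hf : f ∈ automorphicFunctions) :
    (fun z ↦ conj (f z)) ∈ automorphicFunctions := by
  obtain ⟨hs, hinv, α, hα⟩ := hf
  exact ⟨hs.conj, fun γ z ↦ congr_arg _ (hinv γ z), α,
    (isBigO_of_le _ fun z ↦ (norm_conj (f z)).le).trans hα⟩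

theorem hypLaplacian_conj (f : ℍ → ℂ) :
    hypLaplacian (fun z ↦ conj (f z)) = fun z ↦ conj (hypLaplacian f z) := by
  funext z
  have hΔ := congr_fun
    (InnerProductSpace.laplacian_CLE_comp_left (f := f ∘ ofComplex) (l := conjCLE)) z
  simp only [hypLaplacian, map_mul, map_pow, conj_ofReal]
  exact congr_arg _ hΔ

theorem iterate_hypLaplacian_conj (f : ℍ → ℂ) (k : ℕ) :
    hypLaplacian^[k] (fun z ↦ conj (f z)) = fun z ↦ conj (hypLaplacian^[k] f z) :=
  (Function.Semiconj.iterate_right (f := fun (f : ℍ → ℂ) z ↦ conj (f z))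
    (fun f ↦ (hypLaplacian_conj f).symm) k f).symm

theorem exists_iterate_hypLaplacian_eq_const {f : ℍ → ℂ} (hf : f ∈ automorphicFunctions) (k : ℕ)
    (h0 : hypLaplacian^[k + 1] f = 0) : ∃ c : ℂ, hypLaplacian^[k] f = fun _ ↦ c := by
  have hs := hf.1.iterate_hypLaplacian k
  have h0' : hypLaplacian^[k + 1] (fun z ↦ conj (f z)) = 0 := by
    rw [iterate_hypLaplacian_conj, h0]
    simp only [Pi.zero_apply, map_zero]
    rfl
  have hdz := dz_iterate_hypLaplacian_eq_zero hf k h0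
  have hdzbar (z : ℍ) : dzbar (hypLaplacian^[k] f ∘ ofComplex) z = 0 := by
    have hconj := dz_iterate_hypLaplacian_eq_zero (conj_mem_automorphicFunctions hf) k h0' z
    have hW := (hasWirtingerAt_of_differentiableAt
      ((hs.contDiffAt z).differentiableAt (by simp))).star
    rw [iterate_hypLaplacian_conj] at hconj
    exact (map_eq_zero _).1 (hW.dz_eq.symm.trans hconj)
  have hfderiv {z : ℂ} (hz : 0 < z.im) : fderiv ℝ (hypLaplacian^[k] f ∘ ofComplex) z = 0 := by
    rw [← wirtinger_dz_dzbar, hdz ⟨z, hz⟩, hdzbar ⟨z, hz⟩]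
    ext v
    simp
  refine ⟨hypLaplacian^[k] f UpperHalfPlane.I, funext fun z ↦ ?_⟩
  have hconst := (convex_halfSpace_im_gt 0).is_const_of_fderivWithin_eq_zero (𝕜 := ℝ)
    (ContDiffOn.differentiableOn hs (by simp)) (fun w hw ↦ by
      rw [fderivWithin_of_isOpen isOpen_upperHalfPlaneSet hw, hfderiv hw]) z.im_pos
    UpperHalfPlane.I.im_pos
  simpa only [Function.comp_apply, ofComplex_apply] using hconst

/-! ### The quadratic forms `|mz + n|² / y` and their theta series -/

/-- The nonzero integral vectors, which index the lattice sums below; the same subtype as in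
`eisenstein`. -/
abbrev Lattice : Type := {p : ℤ × ℤ // p ≠ 0}

/-- The positive definite quadratic form `|mz + n|² / y` of discriminant `-4` attached to
`z = x + iy`. -/
def quad (z : ℂ) (p : ℤ × ℤ) : ℝ := Complex.normSq (p.1 * z + p.2) / z.im

theorem linear_ne_zero_of_im_pos {z : ℂ} (hz : 0 < z.im) {p : ℤ × ℤ} (hp : p ≠ 0) :
    (p.1 * z + p.2 : ℂ) ≠ 0 := by
  intro h
  have him := congr_arg Complex.im h
  have hre := congr_arg Complex.re h
  simp only [Complex.add_im, Complex.mul_im, Complex.intCast_re, Complex.intCast_im, zero_mul,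
    add_zero, Complex.zero_im, mul_eq_zero, Int.cast_eq_zero, hz.ne', or_false] at him
  simp only [him, Int.cast_zero, zero_mul, zero_add, Complex.intCast_re, Complex.zero_re,
    Int.cast_eq_zero] at hre
  exact hp (Prod.ext him hre)

theorem quad_pos {z : ℂ} (hz : 0 < z.im) {p : ℤ × ℤ} (hp : p ≠ 0) : 0 < quad z p :=
  div_pos (Complex.normSq_pos.2 (linear_ne_zero_of_im_pos hz hp)) hz

theorem quad_nonneg {z : ℂ} (hz : 0 < z.im) (p : ℤ × ℤ) : 0 ≤ quad z p :=
  div_nonneg (Complex.normSq_nonneg _) hz.le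

theorem quad_zero (z : ℂ) : quad z 0 = 0 := by simp [quad]

theorem norm_vec_eq_norm_prod (a b : ℤ) : ‖![a, b]‖ = ‖(a, b)‖ := by
  rw [EisensteinSeries.norm_eq_max_natAbs, Prod.norm_def, Int.norm_eq_abs, Int.norm_eq_abs]
  simp

theorem quad_ge_of_mem_verticalStrip {A B : ℝ} (hB : 0 < B) {z : ℍ} (hz : z ∈ verticalStrip A B)
    {p : ℤ × ℤ} (hp : p ≠ 0) :
    EisensteinSeries.r ⟨⟨A, B⟩, hB⟩ ^ 2 * ‖p‖ ^ 2 / z.im ≤ quad z p := by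
  have hvec : ![p.1, p.2] ≠ 0 := fun h ↦ hp (Prod.ext (congr_fun h 0) (congr_fun h 1))
  have hmax := EisensteinSeries.r_mul_max_le z hvec
  rw [norm_vec_eq_norm_prod] at hmax
  have hlower : EisensteinSeries.r ⟨⟨A, B⟩, hB⟩ * ‖p‖ ≤ ‖(p.1 * z + p.2 : ℂ)‖ :=
    (mul_le_mul_of_nonneg_right (EisensteinSeries.r_lower_bound_on_verticalStrip z hB hz)
      (norm_nonneg _)).trans (by simpa using hmax)
  rw [quad, ← Complex.sq_norm, ← mul_pow]
  exact div_le_div_of_nonneg_right (pow_le_pow_left₀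
    (mul_nonneg (EisensteinSeries.r_pos _).le (norm_nonneg _)) hlower 2) z.im_pos.le

theorem summable_norm_sq_rpow {k : ℝ} (hk : 1 < k) :
    Summable fun p : Lattice ↦ ((‖p.1‖ ^ 2) ^ k)⁻¹ := by
  have hsum : Summable fun p : ℤ × ℤ ↦ ‖p‖ ^ (-(2 * k)) := by
    refine ((finTwoArrowEquiv ℤ).summable_iff).1
      ((EisensteinSeries.summable_one_div_norm_rpow (k := 2 * k) (by linarith)).congr fun x ↦ ?_)
    have hx : x = ![x 0, x 1] := by
      ext i
      fin_cases i <;> rfl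
    conv_lhs => rw [hx, norm_vec_eq_norm_prod]
    rfl
  refine (hsum.subtype {p : ℤ × ℤ | p ≠ 0}).congr fun p ↦ ?_
  rw [Function.comp_apply, Real.rpow_neg (norm_nonneg _), Real.rpow_mul (norm_nonneg _),
    Real.rpow_two]

theorem exists_forall_mem_ball_le_quad {z₀ : ℂ} (hz₀ : 0 < z₀.im) :
    ∃ c > 0, ∀ z ∈ Metric.ball z₀ (z₀.im / 2), z₀.im / 2 < z.im ∧
      ∀ p : ℤ × ℤ, p ≠ 0 → c * ‖p‖ ^ 2 ≤ quad z p := by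
  have hB : 0 < z₀.im / 2 := by linarith
  set r := EisensteinSeries.r ⟨⟨|z₀.re| + z₀.im / 2, z₀.im / 2⟩, hB⟩
  have hr : 0 < r := EisensteinSeries.r_pos _
  refine ⟨r ^ 2 / (2 * z₀.im), by positivity, fun z hz ↦ ?_⟩
  rw [Metric.mem_ball, dist_eq_norm] at hz
  have him := abs_lt.1 ((Complex.abs_im_le_norm _).trans_lt hz)
  have hre := (Complex.abs_re_le_norm _).trans_lt hz
  simp only [Complex.sub_im, Complex.sub_re] at him hre
  have hz_gt : z₀.im / 2 < z.im := by linarith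
  have hz_pos : 0 < z.im := by linarith
  have hstrip : (⟨z, hz_pos⟩ : ℍ) ∈ verticalStrip (|z₀.re| + z₀.im / 2) (z₀.im / 2) := by
    rw [mem_verticalStrip_iff]
    refine ⟨?_, hz_gt.le⟩
    change |z.re| ≤ _
    linarith [abs_sub_abs_le_abs_sub z.re z₀.re]
  refine ⟨hz_gt, fun p hp ↦ le_trans ?_ (quad_ge_of_mem_verticalStrip hB hstrip hp)⟩
  rw [div_mul_eq_mul_div]
  refine div_le_div_of_nonneg_left (by positivity) hz_pos ?_
  change z.im ≤ _
  linarith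

theorem inv_rpow_le_of_mul_norm_sq_le {c : ℝ} (hc : 0 < c) {k q : ℝ} (hk : 0 ≤ k) {p : ℤ × ℤ}
    (hp : p ≠ 0) (h : c * ‖p‖ ^ 2 ≤ q) : (q ^ k)⁻¹ ≤ (c ^ k)⁻¹ * ((‖p‖ ^ 2) ^ k)⁻¹ := by
  have hp' : 0 < ‖p‖ ^ 2 := by positivity
  rw [← mul_inv, ← Real.mul_rpow hc.le hp'.le]
  exact inv_anti₀ (by positivity) (Real.rpow_le_rpow (by positivity) h hk)

theorem summable_quad_rpow {z : ℂ} (hz : 0 < z.im) {k : ℝ} (hk : 1 < k) :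
    Summable fun p : Lattice ↦ (quad z p ^ k)⁻¹ := by
  obtain ⟨c, hc, h⟩ := exists_forall_mem_ball_le_quad hz
  refine Summable.of_nonneg_of_le (fun p ↦ inv_nonneg.2 (Real.rpow_nonneg (quad_nonneg hz _) _))
    (fun p ↦ inv_rpow_le_of_mul_norm_sq_le hc (by linarith) p.2
      ((h z (Metric.mem_ball_self (by linarith))).2 p p.2)) ((summable_norm_sq_rpow hk).mul_left _)

theorem summable_quad_pow {z : ℂ} (hz : 0 < z.im) {k : ℕ} (hk : 2 ≤ k) :
    Summable fun p : Lattice ↦ (quad z p ^ k)⁻¹ := by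
  have : (1 : ℝ) < k := by exact_mod_cast hk
  simpa [Real.rpow_natCast] using summable_quad_rpow hz this

theorem exp_neg_le_factorial_mul_inv_pow {x : ℝ} (hx : 0 < x) (k : ℕ) :
    Real.exp (-x) ≤ k.factorial * (x ^ k)⁻¹ := by
  rw [Real.exp_neg, ← div_eq_mul_inv, ← inv_div]
  exact inv_anti₀ (by positivity) (Real.pow_div_factorial_le_exp x hx.le k)

theorem summable_pow_mul_exp_lattice {z : ℂ} (hz : 0 < z.im) {t : ℝ} (ht : 0 < t) (k : ℕ) :
    Summable fun p : Lattice ↦ quad z p ^ k * Real.exp (-(t * quad z p)) := by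
  refine Summable.of_nonneg_of_le
    (fun p ↦ mul_nonneg (pow_nonneg (quad_nonneg hz _) _) (Real.exp_pos _).le) (fun p ↦ ?_)
    ((summable_quad_pow hz le_rfl).mul_left ((k + 2).factorial * (t ^ (k + 2))⁻¹))
  have hq := quad_pos hz p.2
  calc quad z p ^ k * Real.exp (-(t * quad z p))
      ≤ quad z p ^ k * ((k + 2).factorial * ((t * quad z p) ^ (k + 2))⁻¹) := by
        gcongr
        exact exp_neg_le_factorial_mul_inv_pow (mul_pos ht hq) (k + 2)
    _ = (k + 2).factorial * (t ^ (k + 2))⁻¹ * (quad z p ^ 2)⁻¹ := by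
        field_simp
        ring

theorem summable_exp_lattice {z : ℂ} (hz : 0 < z.im) {t : ℝ} (ht : 0 < t) :
    Summable fun p : Lattice ↦ Real.exp (-(t * quad z p)) := by
  simpa using summable_pow_mul_exp_lattice hz ht 0

theorem summable_of_summable_lattice {f : ℤ × ℤ → ℝ} (h : Summable fun p : Lattice ↦ f p) :
    Summable f := by
  have hcompl : Summable fun p : {p : ℤ × ℤ // p ∉ ({0} : Finset (ℤ × ℤ))} ↦ f p :=
    (Equiv.summable_iff (Equiv.subtypeEquivRight fun p ↦ by simp)).1 h
  exact (Finset.summable_compl_iff {0}).1 hcompl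

theorem tsum_eq_add_tsum_lattice {f : ℤ × ℤ → ℝ} (h : Summable f) :
    ∑' p, f p = f 0 + ∑' p : Lattice, f p := by
  have hcompl : {p : ℤ × ℤ | p ≠ 0} = ((({0} : Finset (ℤ × ℤ)) : Set (ℤ × ℤ))ᶜ) := by
    ext p
    simp
  rw [← h.sum_add_tsum_compl (s := {0}), Finset.sum_singleton, ← tsum_congr_set_coe f hcompl]
  rfl

theorem summable_exp_quad {z : ℂ} (hz : 0 < z.im) {t : ℝ} (ht : 0 < t) :
    Summable fun p : ℤ × ℤ ↦ Real.exp (-(t * quad z p)) :=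
  summable_of_summable_lattice (summable_exp_lattice hz ht)

theorem summable_quad_mul_exp {z : ℂ} (hz : 0 < z.im) {t : ℝ} (ht : 0 < t) :
    Summable fun p : ℤ × ℤ ↦ quad z p * Real.exp (-(t * quad z p)) :=
  summable_of_summable_lattice (f := fun p ↦ quad z p * Real.exp (-(t * quad z p)))
    (by simpa using summable_pow_mul_exp_lattice hz ht 1)

/-- The theta series `∑ exp(-π t |mz + n|² / y)` over all integral vectors, whose Mellin transform
is the completed Eisenstein series. -/
def theta (z : ℂ) (t : ℝ) : ℝ := ∑' p : ℤ × ℤ, Real.exp (-(Real.pi * t * quad z p))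

theorem theta_eq_one_add {z : ℂ} (hz : 0 < z.im) {t : ℝ} (ht : 0 < t) :
    theta z t = 1 + ∑' p : Lattice, Real.exp (-(Real.pi * t * quad z p)) := by
  rw [theta, tsum_eq_add_tsum_lattice (summable_exp_quad hz (by positivity)), quad_zero, mul_zero,
    neg_zero, Real.exp_zero]

/-- The terms of the theta series, up to the factor `(y/t)^{1/2}`, after Poisson summation in the
second variable. -/
def dualTerm (z : ℂ) (t : ℝ) (p : ℤ × ℤ) : ℂ :=
  Complex.exp (-(Real.pi * z.im * (t * p.1 ^ 2 + t⁻¹ * p.2 ^ 2) : ℝ) -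
    2 * Real.pi * I * z.re * p.1 * p.2)

theorem dualTerm_inv_swap (z : ℂ) (t : ℝ) (p : ℤ × ℤ) :
    dualTerm z t⁻¹ p.swap = dualTerm z t p := by
  simp only [dualTerm, Prod.fst_swap, Prod.snd_swap, inv_inv]
  congr 1
  push_cast
  ring

theorem norm_dualTerm (z : ℂ) {t : ℝ} (ht : 0 < t) (p : ℤ × ℤ) :
    ‖dualTerm z t p‖ = Real.exp (-(Real.pi * z.im * quad ⟨0, t⟩ p)) := by
  have hphase : (2 * Real.pi * I * z.re * p.1 * p.2 : ℂ) =
      ((2 * Real.pi * z.re * p.1 * p.2 : ℝ) : ℂ) * I := by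
    push_cast
    ring
  rw [dualTerm, Complex.norm_exp, hphase, ← Complex.ofReal_neg, Complex.sub_re, Complex.ofReal_re,
    Complex.re_ofReal_mul, Complex.I_re, mul_zero, sub_zero]
  congr 1
  simp only [quad, Complex.normSq_apply, Complex.add_re, Complex.mul_re, Complex.intCast_re,
    Complex.intCast_im, Complex.add_im, Complex.mul_im]
  field_simp
  ring

theorem summable_dualTerm {z : ℂ} (hz : 0 < z.im) {t : ℝ} (ht : 0 < t) :
    Summable (dualTerm z t) :=
  Summable.of_norm ((summable_exp_quad (z := ⟨0, t⟩) ht (t := Real.pi * z.im)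
    (by positivity)).congr fun p ↦ (norm_dualTerm z ht p).symm)

theorem exp_quad_eq_mul_exp {z : ℂ} (hz : 0 < z.im) {t : ℝ} (ht : 0 < t) (m n : ℤ) :
    (Real.exp (-(Real.pi * t * quad z (m, n))) : ℂ) =
      Complex.exp (-(Real.pi * z.im * t * m ^ 2)) * Complex.exp (-Real.pi / ((z.im / t : ℝ) : ℂ) *
        (n + I * (-(I * m * z.re))) ^ 2) := by
  have ht' : (t : ℂ) ≠ 0 := by exact_mod_cast ht.ne'
  have hy' : (z.im : ℂ) ≠ 0 := by exact_mod_cast hz.ne'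
  have hre : (n + I * (-(I * m * z.re)) : ℂ) = m * z.re + n := by
    linear_combination (-(m * z.re) : ℂ) * Complex.I_mul_I
  rw [hre, Complex.ofReal_exp, ← Complex.exp_add, quad, Complex.normSq_apply]
  congr 1
  simp only [Complex.add_re, Complex.mul_re, Complex.intCast_re, Complex.intCast_im, zero_mul,
    sub_zero, Complex.add_im, Complex.mul_im, add_zero]
  push_cast
  field_simp
  ring

theorem dualTerm_eq_mul_exp (z : ℂ) {t : ℝ} (ht : 0 < t) (m n : ℤ) :
    dualTerm z t (m, n) = Complex.exp (-(Real.pi * z.im * t * m ^ 2)) *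
      Complex.exp (-Real.pi * ((z.im / t : ℝ) : ℂ) * n ^ 2 +
        2 * Real.pi * (-(I * m * z.re)) * n) := by
  have ht' : (t : ℂ) ≠ 0 := by exact_mod_cast ht.ne'
  rw [dualTerm, ← Complex.exp_add]
  congr 1
  push_cast
  field_simp
  ring

theorem theta_eq_mul_tsum_dualTerm {z : ℂ} (hz : 0 < z.im) {t : ℝ} (ht : 0 < t) :
    (theta z t : ℂ) = ((z.im / t : ℝ) : ℂ) ^ (1 / 2 : ℂ) * ∑' p, dualTerm z t p := by
  have hsum : Summable fun p : ℤ × ℤ ↦ (Real.exp (-(Real.pi * t * quad z p)) : ℂ) :=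
    Complex.summable_ofReal.2 (summable_exp_quad hz (by positivity))
  have ha : 0 < ((z.im / t : ℝ) : ℂ).re := by
    rw [Complex.ofReal_re]
    positivity
  have hsqrt : ((z.im / t : ℝ) : ℂ) ^ (1 / 2 : ℂ) ≠ 0 :=
    (Complex.cpow_ne_zero_iff_of_exponent_ne_zero (by norm_num)).2
      (by exact_mod_cast (div_pos hz ht).ne')
  rw [theta, Complex.ofReal_tsum, hsum.tsum_prod, (summable_dualTerm hz ht).tsum_prod,
    ← tsum_mul_left]
  refine tsum_congr fun m ↦ ?_
  simp_rw [exp_quad_eq_mul_exp hz ht, dualTerm_eq_mul_exp z ht]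
  rw [tsum_mul_left, tsum_mul_left, Complex.tsum_exp_neg_quadratic ha (-(I * m * z.re))]
  field_simp

theorem theta_inv {z : ℂ} (hz : 0 < z.im) {t : ℝ} (ht : 0 < t) : theta z t⁻¹ = t * theta z t := by
  have hdual : ∑' p, dualTerm z t⁻¹ p = ∑' p, dualTerm z t p := by
    rw [← (Equiv.prodComm ℤ ℤ).tsum_eq]
    exact tsum_congr fun p ↦ dualTerm_inv_swap z t p
  have hsqrt : ((z.im / t⁻¹ : ℝ) : ℂ) ^ (1 / 2 : ℂ) = t * ((z.im / t : ℝ) : ℂ) ^ (1 / 2 : ℂ) := by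
    have hhalf : (1 / 2 : ℂ) = ((1 / 2 : ℝ) : ℂ) := by push_cast; rfl
    rw [hhalf, ← Complex.ofReal_cpow (by positivity), ← Complex.ofReal_cpow (by positivity),
      ← Complex.ofReal_mul, ← Real.sqrt_eq_rpow, ← Real.sqrt_eq_rpow,
      show z.im / t⁻¹ = t ^ 2 * (z.im / t) by field_simp, Real.sqrt_mul (by positivity),
      Real.sqrt_sq ht.le]
  have h := theta_eq_mul_tsum_dualTerm hz (inv_pos.2 ht)
  rw [hdual, hsqrt, mul_assoc, ← theta_eq_mul_tsum_dualTerm hz ht] at h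
  exact_mod_cast h

theorem hasDerivAt_theta {z : ℂ} (hz : 0 < z.im) {t : ℝ} (ht : 0 < t) :
    HasDerivAt (theta z)
      (∑' p : ℤ × ℤ, -(Real.pi * quad z p) * Real.exp (-(Real.pi * t * quad z p))) t := by
  have hmem : t ∈ Set.Ioi (t / 2) := half_lt_self ht
  have hu := (summable_quad_mul_exp hz (t := Real.pi * (t / 2)) (by positivity)).mul_left Real.pi
  refine hasDerivAt_tsum_of_isPreconnected hu isOpen_Ioi isPreconnected_Ioi
    (g := fun (p : ℤ × ℤ) (r : ℝ) ↦ Real.exp (-(Real.pi * r * quad z p)))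
    (g' := fun p r ↦ -(Real.pi * quad z p) * Real.exp (-(Real.pi * r * quad z p)))
    (fun p r _ ↦ ?_) (fun p r hr ↦ ?_) hmem (summable_exp_quad hz (by positivity)) hmem
  · have hlin : HasDerivAt (fun r : ℝ ↦ -(Real.pi * r * quad z p)) (-(Real.pi * quad z p)) r := by
      simpa using! (((hasDerivAt_id r).const_mul Real.pi).mul_const (quad z p)).neg
    exact hlin.exp.congr_deriv (by ring)
  · have hq := quad_nonneg hz p
    rw [norm_mul, norm_neg, Real.norm_of_nonneg (by positivity),
      Real.norm_of_nonneg (Real.exp_pos _).le, mul_assoc]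
    gcongr
    exact (Set.mem_Ioi.1 hr).le

theorem two_mul_deriv_theta_one_add_theta_one {z : ℂ} (hz : 0 < z.im) :
    2 * deriv (theta z) 1 + theta z 1 = 0 := by
  have hd : HasDerivAt (theta z) (deriv (theta z) 1) 1 :=
    (hasDerivAt_theta hz one_pos).differentiableAt.hasDerivAt
  have hinv : HasDerivAt (fun t ↦ theta z t⁻¹) (-deriv (theta z) 1) 1 := by
    have hd' : HasDerivAt (theta z) (deriv (theta z) 1) (1 : ℝ)⁻¹ := by rwa [inv_one]
    simpa using! hd'.comp 1 (hasDerivAt_inv (one_ne_zero (α := ℝ)))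
  have hmul : HasDerivAt (fun t ↦ t * theta z t) (theta z 1 + deriv (theta z) 1) 1 := by
    simpa using! (hasDerivAt_id (1 : ℝ)).mul hd
  have heq : (fun t ↦ theta z t⁻¹) =ᶠ[𝓝 1] fun t ↦ t * theta z t := by
    filter_upwards [lt_mem_nhds one_pos] with t ht using theta_inv hz ht
  linarith [(hinv.congr_of_eventuallyEq heq.symm).unique hmul]

/-- Differentiating `θ(1/t) = t θ(t)` at `t = 1`; this evaluates the boundary terms in
`IsWeight.laplaceSymbol_two_sub`. -/
theorem hasSum_two_mul_sub_one_mul_exp {z : ℂ} (hz : 0 < z.im) :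
    HasSum (fun p : Lattice ↦
      (2 * (Real.pi * quad z p) - 1) * Real.exp (-(Real.pi * quad z p))) 1 := by
  have hD := (summable_quad_mul_exp hz Real.pi_pos).mul_left (2 * Real.pi)
  have hθ := summable_exp_quad hz Real.pi_pos
  have hderiv : 2 * deriv (theta z) 1 =
      -∑' p : ℤ × ℤ, 2 * Real.pi * (quad z p * Real.exp (-(Real.pi * quad z p))) := by
    rw [(hasDerivAt_theta hz one_pos).deriv, ← tsum_mul_left, ← tsum_neg]
    refine tsum_congr fun p ↦ ?_
    rw [mul_one]
    ring
  have htotal : ∑' p : ℤ × ℤ, (2 * Real.pi * (quad z p * Real.exp (-(Real.pi * quad z p))) -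
      Real.exp (-(Real.pi * quad z p))) = 0 := by
    have h := two_mul_deriv_theta_one_add_theta_one hz
    simp only [hderiv, theta, mul_one] at h
    rw [hD.tsum_sub hθ]
    linarith
  rw [tsum_eq_add_tsum_lattice (hD.sub hθ), quad_zero] at htotal
  simp only [zero_mul, mul_zero, neg_zero, Real.exp_zero, zero_sub] at htotal
  refine (((hD.sub hθ).subtype _).hasSum_iff.2 (neg_add_eq_zero.1 htotal).symm).congr_fun
    fun p ↦ ?_
  rw [Function.comp_apply]
  ring

/-! ### Lattice sums of functions of `|mz + n|² / y` -/

section TermwiseDifferentiation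

variable {ι : Type*} {U : Set ℂ}

/-- The families of functions that are dominated by a summable sequence near every point of `U`, so
that their sum converges locally uniformly there. -/
def locallyDominated (ι : Type*) (U : Set ℂ) : Submodule ℂ (ι → ℂ → ℂ) where
  carrier := {T | ∀ z ∈ U, ∃ u : ι → ℝ, Summable u ∧ ∀ᶠ w in 𝓝 z, ∀ i, ‖T i w‖ ≤ u i}
  zero_mem' := fun _ _ ↦ ⟨0, summable_zero, .of_forall fun _ _ ↦ norm_zero.le⟩
  add_mem' := by
    intro S T hS hT z hz
    obtain ⟨u, hu, hSu⟩ := hS z hz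
    obtain ⟨v, hv, hTv⟩ := hT z hz
    refine ⟨u + v, hu.add hv, ?_⟩
    filter_upwards [hSu, hTv] with w hSw hTw i using norm_add_le_of_le (hSw i) (hTw i)
  smul_mem' := by
    intro c T hT z hz
    obtain ⟨u, hu, hTu⟩ := hT z hz
    refine ⟨fun i ↦ ‖c‖ * u i, hu.mul_left _, ?_⟩
    filter_upwards [hTu] with w hw i
    rw [Pi.smul_apply, Pi.smul_apply, norm_smul]
    gcongr
    exact hw i

theorem summable_of_mem_locallyDominated {T : ι → ℂ → ℂ} (hT : T ∈ locallyDominated ι U) {z : ℂ}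
    (hz : z ∈ U) : Summable fun i ↦ T i z := by
  obtain ⟨u, hu, hTu⟩ := hT z hz
  exact Summable.of_norm_bounded hu hTu.self_of_nhds

theorem norm_wirtinger_le (A B : ℂ) : ‖wirtinger A B‖ ≤ ‖A‖ + ‖B‖ := by
  refine ContinuousLinearMap.opNorm_le_bound _ (by positivity) fun v ↦ ?_
  rw [wirtinger_apply, add_mul]
  exact norm_add_le_of_le (norm_mul _ _).le ((norm_mul _ _).trans (by rw [RCLike.norm_conj])).le

theorem hasWirtingerAt_tsum (hU : IsOpen U) {T A B : ι → ℂ → ℂ} (hT : T ∈ locallyDominated ι U)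
    (hA : A ∈ locallyDominated ι U) (hB : B ∈ locallyDominated ι U)
    (h : ∀ i, ∀ z ∈ U, HasWirtingerAt (T i) (A i z) (B i z) z) {z : ℂ} (hz : z ∈ U) :
    HasWirtingerAt (fun w ↦ ∑' i, T i w) (∑' i, A i z) (∑' i, B i z) z := by
  obtain ⟨u, hu, hAu⟩ := hA z hz
  obtain ⟨v, hv, hBv⟩ := hB z hz
  obtain ⟨r, hr, hball⟩ := Metric.eventually_nhds_iff_ball.1
    (hAu.and (hBv.and (hU.mem_nhds hz)))
  have hz_mem := Metric.mem_ball_self (x := z) hr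
  refine (hasFDerivAt_tsum_of_isPreconnected (𝕜 := ℝ) (f := T)
    (f' := fun i w ↦ wirtinger (A i w) (B i w)) (hu.add hv) Metric.isOpen_ball
    (convex_ball z r).isPreconnected (fun i w hw ↦ h i w (hball w hw).2.2) (fun i w hw ↦ ?_) hz_mem
    (summable_of_mem_locallyDominated hT hz) hz_mem).congr_fderiv ?_
  · exact (norm_wirtinger_le _ _).trans
      (add_le_add ((hball w hw).1 i) ((hball w hw).2.1 i))
  · exact (((summable_of_mem_locallyDominated hA hz).hasSum.smul_const
      (ContinuousLinearMap.id ℝ ℂ)).add ((summable_of_mem_locallyDominated hB hz).hasSum.smul_const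
        conjCLE.toContinuousLinearMap)).tsum_eq

theorem exists_hasWirtingerAt_of_mem_span {G : Set (ι → ℂ → ℂ)}
    (hG : ∀ T ∈ G, ∃ A ∈ Submodule.span ℂ G, ∃ B ∈ Submodule.span ℂ G,
      ∀ i, ∀ z ∈ U, HasWirtingerAt (T i) (A i z) (B i z) z)
    {T : ι → ℂ → ℂ} (hT : T ∈ Submodule.span ℂ G) :
    ∃ A ∈ Submodule.span ℂ G, ∃ B ∈ Submodule.span ℂ G,
      ∀ i, ∀ z ∈ U, HasWirtingerAt (T i) (A i z) (B i z) z := by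
  induction hT using Submodule.span_induction with
  | mem T hT => exact hG T hT
  | zero => exact ⟨0, zero_mem _, 0, zero_mem _, fun _ z _ ↦ hasWirtingerAt_const 0 z⟩
  | add S T _ _ hS hT =>
    obtain ⟨A, hA, B, hB, hS⟩ := hS
    obtain ⟨A', hA', B', hB', hT⟩ := hT
    exact ⟨A + A', add_mem hA hA', B + B', add_mem hB hB', fun i z hz ↦ (hS i z hz).add (hT i z hz)⟩
  | smul c T _ hT =>
    obtain ⟨A, hA, B, hB, hT⟩ := hT
    exact ⟨c • A, Submodule.smul_mem _ c hA, c • B, Submodule.smul_mem _ c hB,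
      fun i z hz ↦ (hT i z hz).const_mul c⟩

theorem contDiffOn_tsum_of_mem_span (hU : IsOpen U) {G : Set (ι → ℂ → ℂ)}
    (hdom : G ⊆ locallyDominated ι U)
    (hG : ∀ T ∈ G, ∃ A ∈ Submodule.span ℂ G, ∃ B ∈ Submodule.span ℂ G,
      ∀ i, ∀ z ∈ U, HasWirtingerAt (T i) (A i z) (B i z) z)
    {T : ι → ℂ → ℂ} (hT : T ∈ Submodule.span ℂ G) :
    ContDiffOn ℝ ∞ (fun z ↦ ∑' i, T i z) U := by
  have hspan := Submodule.span_le.2 hdom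
  refine contDiffOn_infty.2 fun n ↦ ?_
  induction n generalizing T with
  | zero =>
    obtain ⟨A, hA, B, hB, h⟩ := exists_hasWirtingerAt_of_mem_span hG hT
    rw [Nat.cast_zero, contDiffOn_zero]
    exact fun z hz ↦ (hasWirtingerAt_tsum hU (hspan hT) (hspan hA) (hspan hB) h
      hz).differentiableAt.continuousAt.continuousWithinAt
  | succ n ih =>
    obtain ⟨A, hA, B, hB, h⟩ := exists_hasWirtingerAt_of_mem_span hG hT
    have hderiv (z : ℂ) (hz : z ∈ U) :=
      hasWirtingerAt_tsum hU (hspan hT) (hspan hA) (hspan hB) h hz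
    rw [Nat.cast_succ, contDiffOn_succ_iff_fderiv_of_isOpen hU]
    refine ⟨fun z hz ↦ (hderiv z hz).differentiableAt.differentiableWithinAt, by simp, ?_⟩
    exact (((ih hA).smul contDiffOn_const).add ((ih hB).smul contDiffOn_const)).congr
      fun z hz ↦ HasFDerivAt.fderiv (hderiv z hz)

end TermwiseDifferentiation

/-- The phase `(m z̄ + n) / (m z + n)`. -/
def phase (p : ℤ × ℤ) (z : ℂ) : ℂ := conj (p.1 * z + p.2 : ℂ) / (p.1 * z + p.2)

/-- The summand `yʲ εᵏ φ(π |mz + n|² / y)`, where `ε` is the phase of `mz + n`. Up to the factor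
`φ`, these are the functions that arise from `|mz + n|² / y` by differentiation in `z` and `z̄`. -/
def latticeTerm (j k : ℤ) (φ : ℝ → ℂ) (p : Lattice) (z : ℂ) : ℂ :=
  (z.im : ℂ) ^ j * phase p z ^ k * φ (Real.pi * quad z p)

section Term

variable {z : ℂ} {p : ℤ × ℤ}

theorem norm_phase (hz : 0 < z.im) (hp : p ≠ 0) : ‖phase p z‖ = 1 := by
  rw [phase, norm_div, RCLike.norm_conj, div_self]
  exact norm_ne_zero_iff.2 (linear_ne_zero_of_im_pos hz hp)

theorem coe_im_ne_zero (hz : 0 < z.im) : (z.im : ℂ) ≠ 0 := by exact_mod_cast hz.ne'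

theorem two_I_mul_im_mul_fst (z : ℂ) (p : ℤ × ℤ) :
    2 * I * z.im * p.1 = (p.1 * z + p.2 : ℂ) - conj (p.1 * z + p.2 : ℂ) := by
  have h := Complex.sub_conj z
  push_cast at h
  simp only [map_add, map_mul, map_intCast]
  linear_combination -(p.1 : ℂ) * h

theorem hasWirtingerAt_im_zpow (hz : 0 < z.im) (j : ℤ) :
    HasWirtingerAt (fun w ↦ (w.im : ℂ) ^ j) (-I / 2 * j * (z.im : ℂ) ^ (j - 1))
      (I / 2 * j * (z.im : ℂ) ^ (j - 1)) z :=
  ((hasWirtingerAt_im z).scomp (Φ := fun y ↦ (y : ℂ) ^ j)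
    (hasDerivAt_zpow j _ (Or.inl (coe_im_ne_zero hz))).comp_ofReal).congr_coeff
      (by ring) (by ring)

theorem hasWirtingerAt_phase_zpow (hz : 0 < z.im) (hp : p ≠ 0) (k : ℤ) :
    HasWirtingerAt (fun w ↦ phase p w ^ k)
      (I / 2 * k * (z.im : ℂ)⁻¹ * (phase p z ^ k - phase p z ^ (k + 1)))
      (I / 2 * k * (z.im : ℂ)⁻¹ * (phase p z ^ k - phase p z ^ (k - 1))) z := by
  have hu := linear_ne_zero_of_im_pos hz hp
  have hconj := (map_ne_zero (starRingEnd ℂ)).2 hu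
  have hy := coe_im_ne_zero hz
  have hlin : HasDerivAt (fun w : ℂ ↦ (p.1 * w + p.2 : ℂ)) p.1 z := by
    simpa using! ((hasDerivAt_id z).const_mul (p.1 : ℂ)).add_const (p.2 : ℂ)
  have hpow (l : ℤ) := hasWirtingerAt_of_hasDerivAt
    ((hasDerivAt_zpow l _ (Or.inl hu)).comp z hlin)
  have hm := two_I_mul_im_mul_fst z p
  refine (((hpow k).star.mul (hpow (-k))).congr_of_eventuallyEq
    (.of_forall fun w ↦ ?_)).congr_coeff ?_ ?_
  · simp only [phase, div_zpow, Function.comp_apply, map_zpow₀, zpow_neg]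
    rw [div_eq_mul_inv]
  · simp only [phase, div_zpow, Function.comp_apply, map_zpow₀, map_zero, zpow_neg, zpow_add₀ hconj,
      zpow_add₀ hu, zpow_sub₀ hu, zpow_one]
    field_simp
    push_cast
    linear_combination (conj (p.1 * z + p.2 : ℂ) ^ k * k) *
      (I * hm - 2 * z.im * p.1 * I_mul_I)
  · rw [map_mul, map_mul, map_intCast, map_intCast, map_zpow₀]
    simp only [phase, div_zpow, Function.comp_apply, zpow_neg, zpow_sub₀ hconj, zpow_sub₀ hu,
      zpow_one, map_zpow₀]
    field_simp
    linear_combination (k : ℂ) * (2 * z.im * p.1 * I_mul_I - I * hm)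

theorem hasWirtingerAt_quad (hz : 0 < z.im) (hp : p ≠ 0) :
    HasWirtingerAt (fun w ↦ (quad w p : ℂ)) (I / 2 * (z.im : ℂ)⁻¹ * quad z p * phase p z)
      (-(I / 2 * (z.im : ℂ)⁻¹ * quad z p * (phase p z)⁻¹)) z := by
  have hu := linear_ne_zero_of_im_pos hz hp
  have hconj := (map_ne_zero (starRingEnd ℂ)).2 hu
  have hy := coe_im_ne_zero hz
  have hlin : HasDerivAt (fun w : ℂ ↦ (p.1 * w + p.2 : ℂ)) p.1 z := by
    simpa using! ((hasDerivAt_id z).const_mul (p.1 : ℂ)).add_const (p.2 : ℂ)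
  have hlin' := hasWirtingerAt_of_hasDerivAt hlin
  have hquad (w : ℂ) : (quad w p : ℂ) =
      (p.1 * w + p.2) * conj (p.1 * w + p.2 : ℂ) * (w.im : ℂ) ^ (-1 : ℤ) := by
    rw [quad, Complex.ofReal_div, Complex.normSq_eq_conj_mul_self, zpow_neg_one]
    ring
  have hm := two_I_mul_im_mul_fst z p
  refine (((hlin'.mul hlin'.star).mul (hasWirtingerAt_im_zpow hz (-1))).congr_of_eventuallyEq
    (.of_forall hquad)).congr_coeff ?_ ?_
  · rw [hquad, phase]
    simp only [map_zero, zpow_neg_one, zpow_sub₀ hy, zpow_one]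
    field_simp
    push_cast
    linear_combination conj (p.1 * z + p.2 : ℂ) * (2 * z.im * p.1 * I_mul_I - I * hm)
  · rw [hquad, phase]
    simp only [map_intCast, zpow_neg_one, zpow_sub₀ hy, zpow_one]
    field_simp
    push_cast
    linear_combination (p.1 * z + p.2 : ℂ) * (2 * z.im * p.1 * I_mul_I - I * hm)

end Term

/-- A space of functions on `(0, ∞)` that decay quadratically at infinity and that is stable under
the Euler operator `φ ↦ x φ'`, as needed to differentiate the sum of a `latticeTerm` any number of
times. -/
structure IsSymbolSpace (S : Submodule ℂ (ℝ → ℂ)) : Prop where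
  exists_euler : ∀ φ ∈ S, ∃ ψ ∈ S, ∀ x, 0 < x → HasDerivAt φ (ψ x / x) x
  exists_bound : ∀ φ ∈ S, ∃ C, ∀ x, 0 < x → ‖φ x‖ ≤ C * (x ^ 2)⁻¹

theorem latticeTerm_mem_locallyDominated {φ : ℝ → ℂ} {C : ℝ}
    (hφ : ∀ x, 0 < x → ‖φ x‖ ≤ C * (x ^ 2)⁻¹) (j k : ℤ) :
    latticeTerm j k φ ∈ locallyDominated Lattice {z | 0 < z.im} := by
  intro z₀ (hz₀ : 0 < z₀.im)
  obtain ⟨c, hc, hquad⟩ := exists_forall_mem_ball_le_quad hz₀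
  have hC : 0 ≤ C := by simpa using (norm_nonneg _).trans (hφ 1 one_pos)
  have him : ContinuousAt (fun w : ℂ ↦ ‖(w.im : ℂ) ^ j‖) z₀ :=
    (hasWirtingerAt_im_zpow hz₀ j).differentiableAt.continuousAt.norm
  set M := ‖(z₀.im : ℂ) ^ j‖ + 1
  refine ⟨fun p ↦ M * (C * (((Real.pi * c) ^ (2 : ℝ))⁻¹ * ((‖p.1‖ ^ 2) ^ (2 : ℝ))⁻¹)),
    (((summable_norm_sq_rpow one_lt_two).mul_left _).mul_left _).mul_left _, ?_⟩
  filter_upwards [him.eventually (gt_mem_nhds (lt_add_one _)),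
    Metric.ball_mem_nhds z₀ (half_pos hz₀)] with z hM hz p
  obtain ⟨hz_gt, hz_quad⟩ := hquad z hz
  have hz_pos : 0 < z.im := by linarith
  have hq := mul_pos Real.pi_pos (quad_pos hz_pos p.2)
  rw [latticeTerm, norm_mul, norm_mul, norm_zpow (phase _ _), norm_phase hz_pos p.2, one_zpow,
    mul_one]
  refine mul_le_mul hM.le ((hφ _ hq).trans ?_) (norm_nonneg _) (by positivity)
  rw [← Real.rpow_two]
  refine mul_le_mul_of_nonneg_left
    (inv_rpow_le_of_mul_norm_sq_le (by positivity) two_pos.le p.2 ?_) hC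
  rw [mul_assoc]
  exact mul_le_mul_of_nonneg_left (hz_quad p p.2) Real.pi_pos.le

theorem hasWirtingerAt_latticeTerm {φ ψ : ℝ → ℂ} (hφ : ∀ x, 0 < x → HasDerivAt φ (ψ x / x) x)
    (j k : ℤ) (p : Lattice) {z : ℂ} (hz : 0 < z.im) :
    HasWirtingerAt (latticeTerm j k φ p)
      (I / 2 * ((k - j) * latticeTerm (j - 1) k φ p z +
        latticeTerm (j - 1) (k + 1) (ψ - (k : ℂ) • φ) p z))
      (I / 2 * ((k + j) * latticeTerm (j - 1) k φ p z -
        latticeTerm (j - 1) (k - 1) (ψ + (k : ℂ) • φ) p z)) z := by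
  have hy := coe_im_ne_zero hz
  have hphase : phase p z ≠ 0 := norm_ne_zero_iff.1 (by rw [norm_phase hz p.2]; exact one_ne_zero)
  have hq := quad_pos hz p.2
  have hq' : (quad z p : ℂ) ≠ 0 := by exact_mod_cast hq.ne'
  have hπ : (Real.pi : ℂ) ≠ 0 := by exact_mod_cast Real.pi_ne_zero
  have hπq : HasWirtingerAt (fun w ↦ ((Real.pi * quad w p : ℝ) : ℂ)) _ _ z :=
    ((hasWirtingerAt_quad hz p.2).const_mul Real.pi).congr_of_eventuallyEq
      (.of_forall fun w ↦ Complex.ofReal_mul _ _)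
  refine (((hasWirtingerAt_im_zpow hz j).mul (hasWirtingerAt_phase_zpow hz p.2 k)).mul
    (hπq.scomp (hφ _ (mul_pos Real.pi_pos hq)))).congr_coeff ?_ ?_ <;>
  · simp only [latticeTerm, Pi.sub_apply, Pi.add_apply, Pi.smul_apply, smul_eq_mul,
      zpow_add₀ hphase, zpow_sub₀ hphase, zpow_sub₀ hy, zpow_one, Complex.ofReal_mul]
    field_simp
    ring

theorem IsSymbolSpace.contDiffOn_tsum_latticeTerm {S : Submodule ℂ (ℝ → ℂ)} (hS : IsSymbolSpace S)
    {φ : ℝ → ℂ} (hφ : φ ∈ S) (j k : ℤ) :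
    ContDiffOn ℝ ∞ (fun z ↦ ∑' p, latticeTerm j k φ p z) {z | 0 < z.im} := by
  set G : Set (Lattice → ℂ → ℂ) := {T | ∃ j k, ∃ φ ∈ S, T = latticeTerm j k φ}
  have hG (j k : ℤ) {φ : ℝ → ℂ} (hφ : φ ∈ S) : latticeTerm j k φ ∈ Submodule.span ℂ G :=
    Submodule.subset_span ⟨j, k, φ, hφ, rfl⟩
  refine contDiffOn_tsum_of_mem_span (G := G) isOpen_upperHalfPlaneSet ?_ ?_ (hG j k hφ)
  · rintro _ ⟨j, k, φ, hφ, rfl⟩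
    obtain ⟨C, hC⟩ := hS.exists_bound φ hφ
    exact latticeTerm_mem_locallyDominated hC j k
  · rintro _ ⟨j, k, φ, hφ, rfl⟩
    obtain ⟨ψ, hψ, hderiv⟩ := hS.exists_euler φ hφ
    exact ⟨_, Submodule.smul_mem _ (I / 2) (add_mem (Submodule.smul_mem _ (k - j : ℂ) (hG _ _ hφ))
        (hG (j - 1) (k + 1) (sub_mem hψ (Submodule.smul_mem _ (k : ℂ) hφ)))),
      _, Submodule.smul_mem _ (I / 2) (sub_mem (Submodule.smul_mem _ (k + j : ℂ) (hG _ _ hφ))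
        (hG (j - 1) (k - 1) (add_mem hψ (Submodule.smul_mem _ (k : ℂ) hφ)))),
      fun p z hz ↦ hasWirtingerAt_latticeTerm hderiv j k p hz⟩

theorem IsSymbolSpace.hasWirtingerAt_tsum_latticeTerm {S : Submodule ℂ (ℝ → ℂ)}
    (hS : IsSymbolSpace S) {φ ψ : ℝ → ℂ} (hφ : φ ∈ S) (hψ : ψ ∈ S)
    (hderiv : ∀ x, 0 < x → HasDerivAt φ (ψ x / x) x) (j k : ℤ) {z : ℂ} (hz : 0 < z.im) :
    HasWirtingerAt (fun w ↦ ∑' p, latticeTerm j k φ p w)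
      (∑' p, I / 2 * ((k - j) * latticeTerm (j - 1) k φ p z +
        latticeTerm (j - 1) (k + 1) (ψ - (k : ℂ) • φ) p z))
      (∑' p, I / 2 * ((k + j) * latticeTerm (j - 1) k φ p z -
        latticeTerm (j - 1) (k - 1) (ψ + (k : ℂ) • φ) p z)) z := by
  have hmem (j k : ℤ) {χ : ℝ → ℂ} (hχ : χ ∈ S) :
      latticeTerm j k χ ∈ locallyDominated Lattice {z | 0 < z.im} := by
    obtain ⟨C, hC⟩ := hS.exists_bound χ hχ
    exact latticeTerm_mem_locallyDominated hC j k
  exact hasWirtingerAt_tsum isOpen_upperHalfPlaneSet (hmem j k hφ)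
    (Submodule.smul_mem _ (I / 2) (add_mem (Submodule.smul_mem _ (k - j : ℂ) (hmem (j - 1) k hφ))
      (hmem (j - 1) (k + 1) (sub_mem hψ (Submodule.smul_mem _ (k : ℂ) hφ)))))
    (Submodule.smul_mem _ (I / 2) (sub_mem (Submodule.smul_mem _ (k + j : ℂ) (hmem (j - 1) k hφ))
      (hmem (j - 1) (k - 1) (add_mem hψ (Submodule.smul_mem _ (k : ℂ) hφ)))))
    (fun p w hw ↦ hasWirtingerAt_latticeTerm hderiv j k p hw) hz

theorem IsSymbolSpace.sq_im_mul_laplacian_tsum {S : Submodule ℂ (ℝ → ℂ)} (hS : IsSymbolSpace S)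
    {φ ψ χ : ℝ → ℂ} (hφ : φ ∈ S) (hψ : ψ ∈ S) (hχ : χ ∈ S)
    (hφψ : ∀ x, 0 < x → HasDerivAt φ (ψ x / x) x) (hψχ : ∀ x, 0 < x → HasDerivAt ψ (χ x / x) x)
    {z : ℂ} (hz : 0 < z.im) :
    (z.im : ℂ) ^ 2 * Δ (fun w ↦ ∑' p, latticeTerm 0 0 φ p w) z =
      ∑' p : Lattice, (ψ (Real.pi * quad z p) + χ (Real.pi * quad z p)) := by
  have hdz : dz (fun w ↦ ∑' p, latticeTerm 0 0 φ p w) =ᶠ[𝓝 z]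
      fun w ↦ I / 2 * ∑' p, latticeTerm (-1) 1 ψ p w := by
    filter_upwards [isOpen_upperHalfPlaneSet.mem_nhds hz] with w hw
    rw [(hS.hasWirtingerAt_tsum_latticeTerm hφ hψ hφψ 0 0 hw).dz_eq, ← tsum_mul_left]
    exact tsum_congr fun p ↦ by simp
  rw [laplacian_eq_dzbar_dz (((hS.contDiffOn_tsum_latticeTerm hφ 0 0).contDiffAt
    (isOpen_upperHalfPlaneSet.mem_nhds hz)).of_le ENat.LEInfty.out), dzbar_congr hdz,
    ((hS.hasWirtingerAt_tsum_latticeTerm hψ hχ hψχ (-1) 1 hz).const_mul _).dzbar_eq,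
    ← tsum_mul_left, ← tsum_mul_left, ← tsum_mul_left]
  refine tsum_congr fun p ↦ ?_
  have hy := coe_im_ne_zero hz
  simp only [latticeTerm, Int.reduceNeg, Int.cast_one, Int.cast_neg, add_neg_cancel, zero_mul,
    Int.reduceSub, zpow_neg, zpow_zero, mul_one, one_smul, Pi.add_apply, zero_sub, sub_self]
  field_simp
  linear_combination -4 * (ψ (Real.pi * quad z p) + χ (Real.pi * quad z p)) * I_mul_I

/-! ### Laplace transforms over `(1, ∞)` and their lattice sums -/

theorem integrableOn_pow_mul_exp {x : ℝ} (hx : 0 < x) (N : ℕ) :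
    IntegrableOn (fun t : ℝ ↦ t ^ N * Real.exp (-(x * t))) (Set.Ioi 0) := by
  have h := integrableOn_rpow_mul_exp_neg_mul_rpow (p := 1) (s := N) (b := x)
    (by linarith [(Nat.cast_nonneg N : (0 : ℝ) ≤ N)]) one_pos hx
  simpa [Real.rpow_natCast] using h

theorem setIntegral_pow_mul_exp_le {x : ℝ} (hx : 0 < x) (N : ℕ) :
    ∫ t in Set.Ioi (1 : ℝ), t ^ N * Real.exp (-(x * t)) ≤ N.factorial * (x ^ (N + 1))⁻¹ := by
  have hGamma := Real.integral_rpow_mul_exp_neg_mul_Ioi (a := N + 1) (r := x) (by positivity) hx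
  simp only [add_sub_cancel_right, Real.rpow_natCast] at hGamma
  refine (setIntegral_mono_set (integrableOn_pow_mul_exp hx N) ?_
    (Set.Ioi_subset_Ioi zero_le_one).eventuallyLE).trans (le_of_eq ?_)
  · filter_upwards [ae_restrict_mem measurableSet_Ioi] with t (ht : 0 < t)
    exact mul_nonneg (pow_nonneg ht.le N) (Real.exp_pos _).le
  · rw [hGamma, Real.Gamma_nat_eq_factorial, ← Nat.cast_succ, Real.rpow_natCast, one_div, inv_pow,
      mul_comm]

/-- A weight on `(1, ∞)` of polynomial growth, to be integrated against `e^{-xt}`. -/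
structure IsWeight (w : ℝ → ℝ) (M : ℝ) (K : ℕ) : Prop where
  continuousOn : ContinuousOn w (Set.Ioi 1)
  bound : ∀ t, 1 < t → |w t| ≤ M * t ^ K

/-- The truncated Laplace transform `∫₁^∞ e^{-xt} tˡ w(t) dt`. -/
def laplace (w : ℝ → ℝ) (l : ℕ) (x : ℝ) : ℝ :=
  ∫ t in Set.Ioi (1 : ℝ), Real.exp (-(x * t)) * (t ^ l * w t)

/-- The function `xˡ ∫₁^∞ e^{-xt} tˡ w(t) dt`. The powers of `x` make the span of these functions
stable under the Euler operator, see `IsWeight.isSymbolSpace`. -/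
def laplaceSymbol (w : ℝ → ℝ) (l : ℕ) (x : ℝ) : ℝ := x ^ l * laplace w l x

theorem laplaceSymbol_zero (w : ℝ → ℝ) (x : ℝ) : laplaceSymbol w 0 x = laplace w 0 x := by
  rw [laplaceSymbol, pow_zero, one_mul]

/-- The complex span of the functions `laplaceSymbol w l`. -/
def symbolSpan (w : ℝ → ℝ) : Submodule ℂ (ℝ → ℂ) :=
  Submodule.span ℂ (Set.range fun l x ↦ (laplaceSymbol w l x : ℂ))

theorem laplaceSymbol_mem_symbolSpan (w : ℝ → ℝ) (l : ℕ) :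
    (fun x ↦ (laplaceSymbol w l x : ℂ)) ∈ symbolSpan w :=
  Submodule.subset_span ⟨l, rfl⟩

namespace IsWeight

variable {w : ℝ → ℝ} {M : ℝ} {K : ℕ} {x : ℝ}

theorem zero (hM : 0 ≤ M) (K : ℕ) : IsWeight 0 M K where
  continuousOn := continuousOn_const
  bound t ht := by
    rw [Pi.zero_apply, abs_zero]
    exact mul_nonneg hM (pow_nonneg (zero_le_one.trans ht.le) K)

theorem sub {w' : ℝ → ℝ} {M' : ℝ} (hw : IsWeight w M K) (hw' : IsWeight w' M' K) :
    IsWeight (w - w') (M + M') K where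
  continuousOn := hw.continuousOn.sub hw'.continuousOn
  bound t ht := (abs_sub _ _).trans (by linarith [hw.bound t ht, hw'.bound t ht])

theorem nonneg (hw : IsWeight w M K) : 0 ≤ M :=
  nonneg_of_mul_nonneg_left ((abs_nonneg _).trans (hw.bound 2 one_lt_two)) (by positivity)

theorem aestronglyMeasurable (hw : IsWeight w M K) (l : ℕ) (x : ℝ) :
    AEStronglyMeasurable (fun t ↦ Real.exp (-(x * t)) * (t ^ l * w t))
      (volume.restrict (Set.Ioi 1)) :=
  ContinuousOn.aestronglyMeasurable
    (ContinuousOn.mul (by fun_prop) ((continuousOn_pow l).mul hw.continuousOn)) measurableSet_Ioi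

theorem norm_integrand_le (hw : IsWeight w M K) (l : ℕ) {r : ℝ} (hr : r ≤ x) {t : ℝ}
    (ht : 1 < t) :
    ‖Real.exp (-(x * t)) * (t ^ l * w t)‖ ≤ M * (t ^ (K + l) * Real.exp (-(r * t))) := by
  have ht0 : 0 < t := one_pos.trans ht
  rw [norm_mul, norm_mul, Real.norm_of_nonneg (Real.exp_pos _).le,
    Real.norm_of_nonneg (pow_nonneg ht0.le l), Real.norm_eq_abs]
  calc Real.exp (-(x * t)) * (t ^ l * |w t|)
      ≤ Real.exp (-(r * t)) * (t ^ l * (M * t ^ K)) := by gcongr; exact hw.bound t ht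
    _ = M * (t ^ (K + l) * Real.exp (-(r * t))) := by ring

theorem integrableOn_majorant (M : ℝ) (N : ℕ) (hx : 0 < x) :
    IntegrableOn (fun t : ℝ ↦ M * (t ^ N * Real.exp (-(x * t)))) (Set.Ioi 1) :=
  ((integrableOn_pow_mul_exp hx N).mono_set (Set.Ioi_subset_Ioi zero_le_one)).const_mul M

theorem integrableOn (hw : IsWeight w M K) (l : ℕ) (hx : 0 < x) :
    IntegrableOn (fun t ↦ Real.exp (-(x * t)) * (t ^ l * w t)) (Set.Ioi 1) := by
  refine Integrable.mono' (integrableOn_majorant M (K + l) hx) (hw.aestronglyMeasurable l x) ?_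
  filter_upwards [ae_restrict_mem measurableSet_Ioi] with t ht
  exact hw.norm_integrand_le l le_rfl ht

theorem integral_norm_le (hw : IsWeight w M K) (l : ℕ) (hx : 0 < x) :
    ∫ t in Set.Ioi (1 : ℝ), ‖Real.exp (-(x * t)) * (t ^ l * w t)‖ ≤
      M * ((K + l).factorial * (x ^ (K + l + 1))⁻¹) := by
  refine (setIntegral_mono_on (hw.integrableOn l hx).norm (integrableOn_majorant M (K + l) hx)
    measurableSet_Ioi fun t ht ↦ hw.norm_integrand_le l le_rfl ht).trans ?_
  rw [integral_const_mul]
  exact mul_le_mul_of_nonneg_left (setIntegral_pow_mul_exp_le hx _) hw.nonneg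

theorem norm_laplace_le (hw : IsWeight w M K) (l : ℕ) (hx : 0 < x) :
    ‖laplace w l x‖ ≤ M * ((K + l).factorial * (x ^ (K + l + 1))⁻¹) :=
  (norm_integral_le_integral_norm _).trans (hw.integral_norm_le l hx)

theorem norm_laplaceSymbol_le (hw : IsWeight w M 1) (l : ℕ) (hx : 0 < x) :
    ‖laplaceSymbol w l x‖ ≤ M * (1 + l).factorial * (x ^ 2)⁻¹ := by
  rw [laplaceSymbol, norm_mul, Real.norm_of_nonneg (pow_nonneg hx.le l)]
  calc x ^ l * ‖laplace w l x‖
      ≤ x ^ l * (M * ((1 + l).factorial * (x ^ (1 + l + 1))⁻¹)) := by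
        gcongr
        exact hw.norm_laplace_le l hx
    _ = M * (1 + l).factorial * (x ^ 2)⁻¹ := by
        rw [show 1 + l + 1 = l + 2 by ring, pow_add]
        field_simp

theorem hasDerivAt_laplace (hw : IsWeight w M K) (l : ℕ) (hx : 0 < x) :
    HasDerivAt (laplace w l) (-laplace w (l + 1) x) x := by
  refine (hasDerivAt_integral_of_dominated_loc_of_deriv_le (𝕜 := ℝ)
    (μ := volume.restrict (Set.Ioi (1 : ℝ))) (s := Metric.ball x (x / 2))
    (F := fun ξ t ↦ Real.exp (-(ξ * t)) * (t ^ l * w t))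
    (F' := fun ξ t ↦ -(Real.exp (-(ξ * t)) * (t ^ (l + 1) * w t)))
    (Metric.ball_mem_nhds _ (half_pos hx)) (.of_forall fun ξ ↦ hw.aestronglyMeasurable l ξ)
    (hw.integrableOn l hx) (hw.aestronglyMeasurable (l + 1) x).neg ?_
    (integrableOn_majorant M (K + (l + 1)) (half_pos hx)) ?_).2.congr_deriv (integral_neg _)
  · filter_upwards [ae_restrict_mem measurableSet_Ioi] with t ht ξ hξ
    rw [norm_neg]
    refine hw.norm_integrand_le (l + 1) ?_ ht
    linarith [(abs_lt.1 (Real.dist_eq ξ x ▸ Metric.mem_ball.1 hξ)).1]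
  · refine ae_of_all _ fun t ξ _ ↦ ?_
    have hlin : HasDerivAt (fun ξ ↦ -(ξ * t)) (-t) ξ := (hasDerivAt_mul_const t).neg
    exact (hlin.exp.mul_const _).congr_deriv (by ring)

theorem hasDerivAt_laplaceSymbol (hw : IsWeight w M K) (l : ℕ) (hx : 0 < x) :
    HasDerivAt (laplaceSymbol w l) ((l * laplaceSymbol w l x - laplaceSymbol w (l + 1) x) / x)
      x := by
  refine ((hasDerivAt_pow l x).mul (hw.hasDerivAt_laplace l hx)).congr_deriv ?_
  rw [laplaceSymbol, laplaceSymbol, eq_div_iff hx.ne']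
  rcases l with _ | l
  · rw [Nat.cast_zero]
    ring
  · rw [Nat.add_sub_cancel]
    ring

theorem isSymbolSpace (hw : IsWeight w M 1) : IsSymbolSpace (symbolSpan w) where
  exists_euler φ hφ := by
    induction hφ using Submodule.span_induction with
    | mem φ hφ =>
      obtain ⟨l, rfl⟩ := hφ
      refine ⟨_, sub_mem (Submodule.smul_mem _ (l : ℂ) (laplaceSymbol_mem_symbolSpan w l))
        (laplaceSymbol_mem_symbolSpan w (l + 1)), fun x hx ↦
          (hw.hasDerivAt_laplaceSymbol l hx).ofReal_comp.congr_deriv ?_⟩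
      push_cast
      rfl
    | zero => exact ⟨0, zero_mem _, fun x _ ↦ (hasDerivAt_const x 0).congr_deriv (zero_div _).symm⟩
    | add φ φ' _ _ h h' =>
      obtain ⟨ψ, hψ, hderiv⟩ := h
      obtain ⟨ψ', hψ', hderiv'⟩ := h'
      exact ⟨ψ + ψ', add_mem hψ hψ', fun x hx ↦
        ((hderiv x hx).add (hderiv' x hx)).congr_deriv (add_div _ _ _).symm⟩
    | smul c φ _ h =>
      obtain ⟨ψ, hψ, hderiv⟩ := h
      exact ⟨c • ψ, Submodule.smul_mem _ c hψ, fun x hx ↦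
        ((hderiv x hx).const_mul c).congr_deriv (mul_div_assoc _ _ _).symm⟩
  exists_bound φ hφ := by
    induction hφ using Submodule.span_induction with
    | mem φ hφ =>
      obtain ⟨l, rfl⟩ := hφ
      exact ⟨_, fun x hx ↦ (Complex.norm_real _).trans_le (hw.norm_laplaceSymbol_le l hx)⟩
    | zero => exact ⟨0, fun x _ ↦ by simp⟩
    | add φ φ' _ _ h h' =>
      obtain ⟨C, hC⟩ := h
      obtain ⟨C', hC'⟩ := h'
      exact ⟨C + C', fun x hx ↦
        (norm_add_le_of_le (hC x hx) (hC' x hx)).trans_eq (add_mul _ _ _).symm⟩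
    | smul c φ _ h =>
      obtain ⟨C, hC⟩ := h
      refine ⟨‖c‖ * C, fun x hx ↦ ?_⟩
      rw [Pi.smul_apply, norm_smul, mul_assoc]
      exact mul_le_mul_of_nonneg_left (hC x hx) (norm_nonneg c)

theorem tendsto_exp_mul_pow_mul (hw : IsWeight w M K) (l : ℕ) (hx : 0 < x) :
    Tendsto (fun t ↦ Real.exp (-(x * t)) * (t ^ l * w t)) atTop (𝓝 0) := by
  have hlim := (tendsto_rpow_mul_exp_neg_mul_atTop_nhds_zero (K + l : ℕ) x hx).const_mul M
  simp only [mul_zero, Real.rpow_natCast, neg_mul] at hlim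
  refine squeeze_zero_norm' ?_ hlim
  filter_upwards [eventually_gt_atTop 1] with t ht using hw.norm_integrand_le l le_rfl ht

/-- Two integrations by parts; `v = t² w'` and `u = (t² w')'`. -/
theorem laplaceSymbol_two_sub {v u : ℝ → ℝ} {M' M'' : ℝ} {K' K'' : ℕ} (hw : IsWeight w M K)
    (hv : IsWeight v M' K') (hu : IsWeight u M'' K'')
    (hwv : ∀ t, 0 < t → HasDerivAt w (v t / t ^ 2) t) (hvu : ∀ t, 0 < t → HasDerivAt v (u t) t)
    (hx : 0 < x) :
    laplaceSymbol w 2 x - 2 * laplaceSymbol w 1 x =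
      (x * w 1 + v 1) * Real.exp (-x) + laplace u 0 x := by
  set H : ℝ → ℝ := fun t ↦
    -(x * (Real.exp (-(x * t)) * (t ^ 2 * w t))) - Real.exp (-(x * t)) * (t ^ 0 * v t)
  set H' : ℝ → ℝ := fun t ↦ x ^ 2 * (Real.exp (-(x * t)) * (t ^ 2 * w t)) -
    2 * x * (Real.exp (-(x * t)) * (t ^ 1 * w t)) - Real.exp (-(x * t)) * (t ^ 0 * u t) with hH'
  have hderiv (t : ℝ) (ht : 0 < t) : HasDerivAt H (H' t) t := by
    have hexp : HasDerivAt (fun t ↦ Real.exp (-(x * t))) (Real.exp (-(x * t)) * -x) t :=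
      (hasDerivAt_const_mul x).neg.exp
    refine (((hexp.mul ((hasDerivAt_pow 2 t).mul (hwv t ht))).const_mul x).neg.sub
      (hexp.mul ((hasDerivAt_pow 0 t).mul (hvu t ht)))).congr_deriv ?_
    simp only [hH', Pi.mul_apply]
    field_simp
    ring
  have hlim : Tendsto H atTop (𝓝 0) := by
    simpa [H] using ((hw.tendsto_exp_mul_pow_mul 2 hx).const_mul x).neg.sub
      (hv.tendsto_exp_mul_pow_mul 0 hx)
  have hint_two := (hw.integrableOn 2 hx).const_mul (x ^ 2)
  have hint_one := (hw.integrableOn 1 hx).const_mul (2 * x)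
  have hint_zero := hu.integrableOn 0 hx
  have hint : ∫ t in Set.Ioi (1 : ℝ), H' t =
      x ^ 2 * laplace w 2 x - 2 * x * laplace w 1 x - laplace u 0 x := by
    refine (integral_sub (hint_two.sub hint_one) hint_zero).trans (congrArg (· - _) ?_)
    exact (integral_sub hint_two hint_one).trans
      (congrArg₂ (· - ·) (integral_const_mul _ _) (integral_const_mul _ _))
  have hFTC := integral_Ioi_of_hasDerivAt_of_tendsto (a := 1)
    (hderiv 1 one_pos).continuousAt.continuousWithinAt
    (fun t ht ↦ hderiv t (zero_lt_one.trans ht)) ((hint_two.sub hint_one).sub hint_zero) hlim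
  rw [hint] at hFTC
  simp only [H, mul_one, one_pow, one_mul, pow_zero] at hFTC
  rw [laplaceSymbol, laplaceSymbol]
  linear_combination hFTC

theorem laplace_sub {w' : ℝ → ℝ} {M' : ℝ} {K' : ℕ} (hw : IsWeight w M K)
    (hw' : IsWeight w' M' K') (l : ℕ) (hx : 0 < x) :
    laplace (w - w') l x = laplace w l x - laplace w' l x := by
  refine (integral_congr_ae (.of_forall fun t ↦ ?_)).trans
    (integral_sub (hw.integrableOn l hx) (hw'.integrableOn l hx))
  simp only [Pi.sub_apply]
  ring

end IsWeight

/-- The sum over the lattice of the Laplace transforms `∫₁^∞ e^{-π t |mz + n|² / y} w(t) dt`. -/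
def laplaceSum (w : ℝ → ℝ) (z : ℂ) : ℂ := ∑' p : Lattice, (laplace w 0 (Real.pi * quad z p) : ℂ)

section LaplaceSum

variable {w : ℝ → ℝ} {M : ℝ} {z : ℂ}

theorem laplaceSum_zero : laplaceSum 0 = 0 := by
  funext z
  simp [laplaceSum, laplace]

theorem IsWeight.summable_laplace (hw : IsWeight w M 1) (hz : 0 < z.im) :
    Summable fun p : Lattice ↦ (laplace w 0 (Real.pi * quad z p) : ℂ) := by
  refine (summable_of_mem_locallyDominated (latticeTerm_mem_locallyDominated (C := _)
    (fun x hx ↦ (Complex.norm_real _).trans_le (hw.norm_laplaceSymbol_le 0 hx)) 0 0) hz).congr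
    fun p ↦ ?_
  rw [latticeTerm, zpow_zero, zpow_zero, one_mul, one_mul, laplaceSymbol_zero]

theorem IsWeight.laplaceSum_sub {w' : ℝ → ℝ} {M' : ℝ} (hw : IsWeight w M 1)
    (hw' : IsWeight w' M' 1) (hz : 0 < z.im) :
    laplaceSum (w - w') z = laplaceSum w z - laplaceSum w' z := by
  refine (tsum_congr fun p : Lattice ↦ ?_).trans
    ((hw.summable_laplace hz).tsum_sub (hw'.summable_laplace hz))
  rw [hw.laplace_sub hw' 0 (mul_pos Real.pi_pos (quad_pos hz p.2)), Complex.ofReal_sub]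

theorem laplaceSum_eq_tsum_latticeTerm (w : ℝ → ℝ) :
    laplaceSum w = fun z ↦ ∑' p, latticeTerm 0 0 (fun x ↦ (laplaceSymbol w 0 x : ℂ)) p z := by
  funext z
  exact tsum_congr fun p ↦ by
    rw [latticeTerm, zpow_zero, zpow_zero, one_mul, one_mul, laplaceSymbol_zero]

theorem IsWeight.contDiffOn_laplaceSum (hw : IsWeight w M 1) :
    ContDiffOn ℝ ∞ (laplaceSum w) {z | 0 < z.im} := by
  rw [laplaceSum_eq_tsum_latticeTerm]
  exact hw.isSymbolSpace.contDiffOn_tsum_latticeTerm (laplaceSymbol_mem_symbolSpan w 0) 0 0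

theorem IsWeight.sq_im_mul_laplacian_laplaceSum {v u : ℝ → ℝ} {M' M'' : ℝ} {K : ℕ}
    (hw : IsWeight w M 1) (hv : IsWeight v M' K) (hu : IsWeight u M'' 1)
    (hwv : ∀ t, 0 < t → HasDerivAt w (v t / t ^ 2) t) (hvu : ∀ t, 0 < t → HasDerivAt v (u t) t)
    (hone : w 1 = -2 * v 1) (hz : 0 < z.im) :
    (z.im : ℂ) ^ 2 * Δ (laplaceSum w) z = -v 1 + laplaceSum u z := by
  have hmem := laplaceSymbol_mem_symbolSpan w
  have hderiv (l : ℕ) (x : ℝ) (hx : 0 < x) := (hw.hasDerivAt_laplaceSymbol l hx).ofReal_comp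
  rw [laplaceSum_eq_tsum_latticeTerm, hw.isSymbolSpace.sq_im_mul_laplacian_tsum
    (ψ := fun x ↦ -(laplaceSymbol w 1 x : ℂ))
    (χ := fun x ↦ laplaceSymbol w 2 x - laplaceSymbol w 1 x) (hmem 0) (neg_mem (hmem 1))
    (sub_mem (hmem 2) (hmem 1)) (fun x hx ↦ (hderiv 0 x hx).congr_deriv (by simp))
    (fun x hx ↦ (hderiv 1 x hx).neg.congr_deriv (by push_cast; ring)) hz]
  have hterm (p : Lattice) : -(laplaceSymbol w 1 (Real.pi * quad z p) : ℂ) +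
      (laplaceSymbol w 2 (Real.pi * quad z p) - laplaceSymbol w 1 (Real.pi * quad z p)) =
      -v 1 * ((2 * (Real.pi * quad z p) - 1) * Real.exp (-(Real.pi * quad z p)) : ℝ) +
        laplace u 0 (Real.pi * quad z p) := by
    have h := hw.laplaceSymbol_two_sub hv hu hwv hvu (mul_pos Real.pi_pos (quad_pos hz p.2))
    rw [hone] at h
    have h' := congrArg ((↑) : ℝ → ℂ) h
    push_cast at h' ⊢
    linear_combination h'
  have hboundary := (Complex.hasSum_ofReal.2 (hasSum_two_mul_sub_one_mul_exp hz)).mul_left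
    (-v 1 : ℂ)
  rw [tsum_congr hterm, hboundary.summable.tsum_add (hu.summable_laplace hz),
    hboundary.tsum_eq, Complex.ofReal_one, mul_one, laplaceSum]

end LaplaceSum

/-! ### The logarithmic weights -/

section Shift

variable {R S : Type*} [Zero R] [Zero S]

/-- The sequence `c` with a zero put in front, that is, the coefficients of `s · ∑ cₙ sⁿ`. -/
def shift (c : ℕ → R) : ℕ → R
  | 0 => 0
  | n + 1 => c n

theorem shift_induction {P : R → Prop} {c : ℕ → R} (zero : P 0) (h : ∀ n, P (c n)) :
    ∀ n, P (shift c n)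
  | 0 => zero
  | n + 1 => h n

theorem apply_shift {g : R → S} (hg : g 0 = 0) (c : ℕ → R) :
    ∀ n, g (shift c n) = shift (fun n ↦ g (c n)) n
  | 0 => hg
  | _ + 1 => rfl

end Shift

/-- The function `(log t)ⁿ / n!`, the coefficient of `sⁿ` in `tˢ`. -/
def logPow (n : ℕ) (t : ℝ) : ℝ := Real.log t ^ n / n.factorial

/-- The coefficient of `sⁿ` in `t^{s-1} + t^{-s}`. -/
def logWeight (n : ℕ) (t : ℝ) : ℝ := logPow n t * (t⁻¹ + (-1) ^ n)

/-- The derivative of `logWeight`, times `t²`. -/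
def logWeightDeriv (n : ℕ) (t : ℝ) : ℝ :=
  shift logPow n t - logPow n t + (-1) ^ n * (t * shift logPow n t)

section LogWeight

variable {t : ℝ}

theorem hasDerivAt_logPow (n : ℕ) (ht : 0 < t) :
    HasDerivAt (logPow n) (shift logPow n t / t) t := by
  refine (((Real.hasDerivAt_log ht.ne').pow n).div_const (n.factorial : ℝ)).congr_deriv ?_
  rcases n with _ | n
  · simp [shift]
  · simp only [shift, logPow, Nat.add_sub_cancel, Nat.factorial_succ]
    push_cast
    field_simp

theorem hasDerivAt_shift_logPow (n : ℕ) (ht : 0 < t) :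
    HasDerivAt (shift logPow n) (shift (shift logPow) n t / t) t := by
  rcases n with _ | n
  · exact (hasDerivAt_const t 0).congr_deriv (zero_div t).symm
  · exact hasDerivAt_logPow n ht

theorem hasDerivAt_logWeight (n : ℕ) (ht : 0 < t) :
    HasDerivAt (logWeight n) (logWeightDeriv n t / t ^ 2) t := by
  refine ((hasDerivAt_logPow n ht).mul
    ((hasDerivAt_inv ht.ne').add_const ((-1) ^ n))).congr_deriv ?_
  rw [logWeightDeriv]
  field_simp
  ring

theorem hasDerivAt_logWeightDeriv (n : ℕ) (ht : 0 < t) :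
    HasDerivAt (logWeightDeriv n) ((shift (shift logWeight) n - shift logWeight n) t) t := by
  have hshift := hasDerivAt_shift_logPow n ht
  refine ((hshift.sub (hasDerivAt_logPow n ht)).add
    (((hasDerivAt_id t).mul hshift).const_mul ((-1 : ℝ) ^ n))).congr_deriv ?_
  rcases n with _ | _ | n <;>
  · simp only [shift, logWeight, id, Pi.sub_apply, Pi.zero_apply]
    field_simp
    ring

theorem logWeight_one (n : ℕ) : logWeight n 1 = if n = 0 then 2 else 0 := by
  rcases n with _ | n
  · norm_num [logWeight, logPow]
  · simp [logWeight, logPow]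

theorem logWeightDeriv_one (n : ℕ) : logWeightDeriv n 1 = if n = 0 then -1 else 0 := by
  rcases n with _ | _ | n
  · simp [logWeightDeriv, logPow, shift]
  · norm_num [logWeightDeriv, logPow, shift]
  · simp [logWeightDeriv, logPow, shift]

theorem logPow_nonneg (n : ℕ) (ht : 1 < t) : 0 ≤ logPow n t :=
  div_nonneg (pow_nonneg (Real.log_pos ht).le n) (Nat.cast_nonneg _)

theorem logPow_le (n : ℕ) {K : ℕ} (hK : K ≠ 0) (ht : 1 < t) :
    logPow n t ≤ ((K : ℝ) ^ n)⁻¹ * t ^ K := by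
  have hK_pos : 0 < (K : ℝ) := Nat.cast_pos.2 (Nat.pos_of_ne_zero hK)
  have hexp := Real.pow_div_factorial_le_exp (K * Real.log t)
    (mul_nonneg hK_pos.le (Real.log_pos ht).le) n
  rw [mul_comm, Real.exp_mul, Real.exp_log (one_pos.trans ht), Real.rpow_natCast, mul_pow,
    mul_comm, mul_div_assoc] at hexp
  rwa [logPow, inv_mul_eq_div, le_div_iff₀' (pow_pos hK_pos n)]

theorem isWeight_logWeight (n : ℕ) {K : ℕ} (hK : K ≠ 0) :
    IsWeight (logWeight n) (2 * ((K : ℝ) ^ n)⁻¹) K where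
  continuousOn t ht :=
    (hasDerivAt_logWeight n (one_pos.trans ht)).continuousAt.continuousWithinAt
  bound t ht := by
    have hfactor : |t⁻¹ + (-1) ^ n| ≤ 2 := by
      refine (abs_add_le _ _).trans ?_
      rw [abs_pow, abs_neg, abs_one, one_pow, abs_of_pos (inv_pos.2 (one_pos.trans ht))]
      linarith [inv_le_one_of_one_le₀ ht.le]
    calc |logWeight n t| = logPow n t * |t⁻¹ + (-1) ^ n| := by
          rw [logWeight, abs_mul, abs_of_nonneg (logPow_nonneg n ht)]
      _ ≤ ((K : ℝ) ^ n)⁻¹ * t ^ K * 2 :=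
          mul_le_mul (logPow_le n hK ht) hfactor (abs_nonneg _)
            (mul_nonneg (by positivity) (pow_nonneg (one_pos.trans ht).le K))
      _ = 2 * ((K : ℝ) ^ n)⁻¹ * t ^ K := by ring

theorem isWeight_logWeight_two_one (n : ℕ) : IsWeight (logWeight n) 2 1 := by
  simpa using isWeight_logWeight n one_ne_zero

theorem isWeight_logWeightDeriv (n : ℕ) : IsWeight (logWeightDeriv n) 3 2 where
  continuousOn t ht :=
    (hasDerivAt_logWeightDeriv n (one_pos.trans ht)).continuousAt.continuousWithinAt
  bound t ht := by
    have ht0 : 0 < t := one_pos.trans ht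
    have habs (n : ℕ) : |logPow n t| ≤ t := by
      simpa [abs_of_nonneg (logPow_nonneg n ht)] using logPow_le n one_ne_zero ht
    have habs_shift : |shift logPow n t| ≤ t :=
      shift_induction (P := fun w : ℝ → ℝ ↦ |w t| ≤ t) (by simpa using ht0.le) habs n
    calc |logWeightDeriv n t|
        ≤ |shift logPow n t| + |logPow n t| + t * |shift logPow n t| := by
          refine (abs_add_le _ _).trans (add_le_add (abs_sub _ _) (le_of_eq ?_))
          rw [abs_mul, abs_mul, abs_pow, abs_neg, abs_one, one_pow, one_mul, abs_of_pos ht0]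
      _ ≤ t + t + t * t := by gcongr; exact habs n
      _ ≤ 3 * t ^ 2 := by nlinarith

end LogWeight

/-- The coefficient of `sⁿ` in the sum of `∫₁^∞ e^{-π t |mz + n|² / y} (t^{s-1} + t^{-s}) dt` over
the lattice, see `hasSum_eisensteinCoeff`. -/
def eisensteinCoeff (n : ℕ) : ℂ → ℂ := laplaceSum (logWeight n)

theorem sq_im_mul_laplacian_eisensteinCoeff (n : ℕ) {z : ℂ} (hz : 0 < z.im) :
    (z.im : ℂ) ^ 2 * Δ (eisensteinCoeff n) z = (if n = 0 then 1 else 0) +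
      shift (shift eisensteinCoeff) n z - shift eisensteinCoeff n z := by
  have hzero : IsWeight 0 2 1 := .zero zero_le_two 1
  have hshift (n : ℕ) : IsWeight (shift logWeight n) 2 1 :=
    shift_induction (P := fun w ↦ IsWeight w 2 1) hzero isWeight_logWeight_two_one n
  have hshift_shift : IsWeight (shift (shift logWeight) n) 2 1 :=
    shift_induction (P := fun w ↦ IsWeight w 2 1) hzero hshift n
  have hsum (n : ℕ) : laplaceSum (shift logWeight n) = shift eisensteinCoeff n :=
    apply_shift laplaceSum_zero logWeight n
  have hsum_shift : laplaceSum (shift (shift logWeight) n) = shift (shift eisensteinCoeff) n := by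
    rw [apply_shift laplaceSum_zero, funext hsum]
  rw [eisensteinCoeff, (isWeight_logWeight_two_one n).sq_im_mul_laplacian_laplaceSum
    (isWeight_logWeightDeriv n) (hshift_shift.sub (hshift n)) (fun t ↦ hasDerivAt_logWeight n)
    (fun t ↦ hasDerivAt_logWeightDeriv n) ?_ hz, hshift_shift.laplaceSum_sub (hshift n) hz, hsum,
    hsum_shift, logWeightDeriv_one]
  · split_ifs <;> simp [add_sub_assoc]
  · rw [logWeight_one, logWeightDeriv_one]
    split_ifs <;> norm_num

/-! ### Analytic continuation of the Eisenstein series -/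

/-- The theta series without its constant term. -/
def cuspTheta (z : ℂ) (t : ℝ) : ℝ := ∑' p : Lattice, Real.exp (-(Real.pi * t * quad z p))

section CuspTheta

variable {z : ℂ}

theorem cuspTheta_inv (hz : 0 < z.im) {t : ℝ} (ht : 0 < t) :
    cuspTheta z t⁻¹ = t * cuspTheta z t + (t - 1) := by
  have h := theta_inv hz ht
  rw [theta_eq_one_add hz (inv_pos.2 ht), theta_eq_one_add hz ht] at h
  unfold cuspTheta
  linarith

theorem continuousOn_cuspTheta (hz : 0 < z.im) : ContinuousOn (cuspTheta z) (Set.Ioi 1) := by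
  refine continuousOn_tsum (fun p ↦ by fun_prop) (summable_exp_lattice hz Real.pi_pos)
    fun p t ht ↦ ?_
  rw [Real.norm_of_nonneg (Real.exp_pos _).le]
  refine Real.exp_le_exp.2 (neg_le_neg (mul_le_mul_of_nonneg_right ?_ (quad_nonneg hz _)))
  exact le_mul_of_one_le_right Real.pi_pos.le (le_of_lt ht)

theorem exists_norm_cuspTheta_le (hz : 0 < z.im) {k : ℕ} (hk : 2 ≤ k) :
    ∃ C, ∀ t, 0 < t → ‖cuspTheta z t‖ ≤ C * (t ^ k)⁻¹ := by
  refine ⟨(k.factorial * (Real.pi ^ k)⁻¹) * ∑' p : Lattice, (quad z p ^ k)⁻¹, fun t ht ↦ ?_⟩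
  have hmajorant : HasSum (fun p : Lattice ↦ k.factorial * (Real.pi ^ k)⁻¹ * (t ^ k)⁻¹ *
      (quad z p ^ k)⁻¹) _ := (summable_quad_pow hz hk).hasSum.mul_left _
  refine (tsum_of_norm_bounded hmajorant fun p ↦ ?_).trans_eq (mul_right_comm _ _ _)
  rw [Real.norm_of_nonneg (Real.exp_pos _).le]
  refine (exp_neg_le_factorial_mul_inv_pow
    (mul_pos (mul_pos Real.pi_pos ht) (quad_pos hz p.2)) k).trans_eq ?_
  rw [mul_pow, mul_pow, mul_inv, mul_inv]
  ring

theorem integrableOn_cpow_mul_cuspTheta (hz : 0 < z.im) (s : ℂ) :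
    IntegrableOn (fun t : ℝ ↦ (t : ℂ) ^ s * (cuspTheta z t : ℂ)) (Set.Ioi 1) := by
  obtain ⟨k, hk⟩ := exists_nat_gt (s.re + 2)
  obtain ⟨C, hC⟩ := exists_norm_cuspTheta_le hz (k := k + 2) (by omega)
  have hmajorant : IntegrableOn (fun t : ℝ ↦ C * t ^ (s.re - (k + 2 : ℕ))) (Set.Ioi 1) :=
    (integrableOn_Ioi_rpow_of_lt (by push_cast; linarith) one_pos).const_mul C
  refine Integrable.mono' hmajorant ?_ ?_
  · refine ContinuousOn.aestronglyMeasurable (ContinuousOn.mul (fun t ht ↦ ?_)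
      (Complex.continuous_ofReal.comp_continuousOn (continuousOn_cuspTheta hz))) measurableSet_Ioi
    exact (Complex.continuousAt_ofReal_cpow_const _ _
      (Or.inr (zero_lt_one.trans ht).ne')).continuousWithinAt
  · filter_upwards [ae_restrict_mem measurableSet_Ioi] with t ht
    have ht0 : 0 < t := zero_lt_one.trans ht
    rw [norm_mul, Complex.norm_cpow_eq_rpow_re_of_pos ht0, Complex.norm_real, Real.rpow_sub ht0,
      Real.rpow_natCast, div_eq_mul_inv, mul_left_comm]
    exact mul_le_mul_of_nonneg_left (hC t ht0) (by positivity)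

end CuspTheta

theorem hasMellin_indicator_Ioi {Φ : ℝ → ℂ} {s : ℂ}
    (hΦ : IntegrableOn (fun t : ℝ ↦ (t : ℂ) ^ (s - 1) * Φ t) (Set.Ioi 1)) :
    HasMellin ((Set.Ioi 1).indicator Φ) s (∫ t in Set.Ioi (1 : ℝ), (t : ℂ) ^ (s - 1) * Φ t) := by
  have hindicator : (fun t : ℝ ↦ (t : ℂ) ^ (s - 1) • (Set.Ioi 1).indicator Φ t) =
      (Set.Ioi 1).indicator fun t : ℝ ↦ (t : ℂ) ^ (s - 1) * Φ t := by
    funext t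
    by_cases ht : t ∈ Set.Ioi 1 <;> simp [ht]
  constructor
  · rw [MellinConvergent, hindicator]
    exact ((integrable_indicator_iff measurableSet_Ioi).2 hΦ).integrableOn
  · rw [mellin, hindicator, setIntegral_indicator measurableSet_Ioi, Set.inter_comm,
      Set.inter_eq_left.2 (Set.Ioi_subset_Ioi zero_le_one)]

/-- Riemann's splitting of a Mellin transform at `t = 1`. -/
theorem mellin_eq_setIntegral_Ioi_add {Φ Ψ : ℝ → ℂ} {s : ℂ} (hinv : ∀ t, 1 < t → Φ t⁻¹ = Ψ t)
    (hΦ : IntegrableOn (fun t : ℝ ↦ (t : ℂ) ^ (s - 1) * Φ t) (Set.Ioi 1))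
    (hΨ : IntegrableOn (fun t : ℝ ↦ (t : ℂ) ^ (-s - 1) * Ψ t) (Set.Ioi 1)) :
    mellin Φ s = (∫ t in Set.Ioi (1 : ℝ), (t : ℂ) ^ (s - 1) * Φ t) +
      ∫ t in Set.Ioi (1 : ℝ), (t : ℂ) ^ (-s - 1) * Ψ t := by
  have hMellinΦ := hasMellin_indicator_Ioi hΦ
  have hMellinΨ := hasMellin_indicator_Ioi hΨ
  have hconv : MellinConvergent (fun t ↦ (Set.Ioi 1).indicator Ψ t⁻¹) s := by
    simpa only [Real.rpow_neg_one] using (MellinConvergent.comp_rpow (f := (Set.Ioi 1).indicator Ψ)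
      (s := s) (a := -1) (by norm_num)).2 (by simpa [div_neg] using hMellinΨ.1)
  have hsplit : mellin Φ s = mellin (fun t ↦ (Set.Ioi 1).indicator Φ t +
      (Set.Ioi 1).indicator Ψ t⁻¹) s := by
    have hne : ∀ᵐ t ∂volume.restrict (Set.Ioi (0 : ℝ)), t ≠ 1 :=
      ae_restrict_of_ae (by simp [ae_iff])
    refine integral_congr_ae ?_
    filter_upwards [ae_restrict_mem measurableSet_Ioi, hne] with t (ht : 0 < t) ht1
    congr 1
    rcases lt_or_gt_of_ne ht1 with hlt | hgt
    · have hinv_gt : 1 < t⁻¹ := (one_lt_inv₀ ht).2 hlt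
      rw [Set.indicator_of_notMem (Set.notMem_Ioi.2 hlt.le),
        Set.indicator_of_mem (Set.mem_Ioi.2 hinv_gt), zero_add, ← hinv _ hinv_gt, inv_inv]
    · rw [Set.indicator_of_mem (Set.mem_Ioi.2 hgt), Set.indicator_of_notMem
        (Set.notMem_Ioi.2 (inv_le_one_of_one_le₀ hgt.le)), add_zero]
  rw [hsplit, (hasMellin_add hMellinΦ.1 hconv).2, hMellinΦ.2, mellin_comp_inv, hMellinΨ.2]

theorem integral_cpow_neg_sub_cpow {s : ℂ} (hs : 1 < s.re) :
    IntegrableOn (fun t : ℝ ↦ (t : ℂ) ^ (-s) - (t : ℂ) ^ (-s - 1)) (Set.Ioi 1) ∧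
      ∫ t in Set.Ioi (1 : ℝ), ((t : ℂ) ^ (-s) - (t : ℂ) ^ (-s - 1)) = 1 / (s - 1) - 1 / s := by
  have hre : (-s).re < -1 := by rw [Complex.neg_re]; linarith
  have hre_sub : (-s - 1).re < -1 := by
    rw [Complex.sub_re, Complex.neg_re, Complex.one_re]
    linarith
  have hint := integrableOn_Ioi_cpow_of_lt hre one_pos
  have hint_sub := integrableOn_Ioi_cpow_of_lt hre_sub one_pos
  refine ⟨hint.sub hint_sub, ?_⟩
  rw [integral_sub hint hint_sub, integral_Ioi_cpow_of_lt hre one_pos,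
    integral_Ioi_cpow_of_lt hre_sub one_pos, sub_add_cancel, Complex.ofReal_one, Complex.one_cpow,
    Complex.one_cpow, show -s + 1 = -(s - 1) by ring, neg_div_neg_eq, neg_div_neg_eq]

theorem mellin_cuspTheta {z : ℂ} (hz : 0 < z.im) {s : ℂ} (hs : 1 < s.re) :
    mellin (fun t ↦ (cuspTheta z t : ℂ)) s =
      (∫ t in Set.Ioi (1 : ℝ), ((t : ℂ) ^ (s - 1) + (t : ℂ) ^ (-s)) * (cuspTheta z t : ℂ)) +
        (1 / (s - 1) - 1 / s) := by
  have hinv (t : ℝ) (ht : 1 < t) :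
      (cuspTheta z t⁻¹ : ℂ) = t * (cuspTheta z t : ℂ) + (t - 1) := by
    rw [cuspTheta_inv hz (one_pos.trans ht)]
    push_cast
    rfl
  have hcongr (t : ℝ) (ht : t ∈ Set.Ioi 1) : (t : ℂ) ^ (-s) * (cuspTheta z t : ℂ) +
      ((t : ℂ) ^ (-s) - (t : ℂ) ^ (-s - 1)) =
        (t : ℂ) ^ (-s - 1) * (t * (cuspTheta z t : ℂ) + (t - 1)) := by
    have ht0 : (t : ℂ) ≠ 0 := Complex.ofReal_ne_zero.2 (one_pos.trans ht).ne'
    have hcpow : (t : ℂ) ^ (-s) = (t : ℂ) ^ (-s - 1) * t := by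
      rw [Complex.cpow_sub _ _ ht0, Complex.cpow_one, div_mul_cancel₀ _ ht0]
    rw [hcpow]
    ring
  have hint := integrableOn_cpow_mul_cuspTheta hz (s - 1)
  have hint_neg := integrableOn_cpow_mul_cuspTheta hz (-s)
  obtain ⟨hint_cpow, hvalue⟩ := integral_cpow_neg_sub_cpow hs
  rw [mellin_eq_setIntegral_Ioi_add hinv hint
    ((hint_neg.add hint_cpow).congr_fun hcongr measurableSet_Ioi),
    ← setIntegral_congr_fun measurableSet_Ioi hcongr, integral_add hint_neg hint_cpow, hvalue,
    ← add_assoc, ← integral_add hint hint_neg]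
  simp only [add_mul]

theorem cpow_im_div_norm (z : ℍ) (p : Lattice) (s : ℂ) :
    (z.im : ℂ) ^ s / ((‖(p.1.1 : ℂ) * z + p.1.2‖ : ℝ) : ℂ) ^ (2 * s) =
      ((quad z p : ℝ) : ℂ) ^ (-s) := by
  set N := ‖(p.1.1 : ℂ) * z + p.1.2‖ with hN
  have hN_pos : 0 < N := norm_pos_iff.2 (linear_ne_zero_of_im_pos (z := z) z.im_pos p.2)
  have hN_ne : (N : ℂ) ≠ 0 := Complex.ofReal_ne_zero.2 hN_pos.ne'
  have hquad : quad z p = N ^ 2 * z.im⁻¹ := by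
    rw [quad, hN, Complex.sq_norm]
    rfl
  rw [hquad, Complex.ofReal_mul,
    Complex.mul_cpow_ofReal_nonneg (sq_nonneg N) (inv_pos.2 z.im_pos).le, Complex.cpow_neg,
    Complex.cpow_neg, Complex.ofReal_inv, Complex.inv_cpow, inv_inv, two_mul,
    Complex.cpow_add _ _ hN_ne, sq, Complex.ofReal_mul,
    Complex.mul_cpow_ofReal_nonneg hN_pos.le hN_pos.le]
  · ring
  · rw [Complex.arg_ofReal_of_nonneg z.im_pos.le]
    exact Real.pi_pos.ne

theorem completed_eisenstein_eq_mellin (z : ℍ) {s : ℂ} (hs : 1 < s.re) :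
    (Real.pi : ℂ) ^ (-s) * Complex.Gamma s * eisenstein z s =
      1 / 2 * mellin (fun t ↦ (cuspTheta z t : ℂ)) s := by
  have hquad (p : Lattice) : 0 < quad z p := quad_pos z.im_pos p.2
  have hcuspTheta (t : ℝ) (ht : t ∈ Set.Ioi 0) : HasSum (fun p : Lattice ↦
      (1 : ℂ) * Real.exp (-(Real.pi * quad z p) * t)) (cuspTheta z t : ℂ) := by
    rw [cuspTheta, Complex.ofReal_tsum]
    refine (Complex.summable_ofReal.2 (summable_exp_lattice z.im_pos
      (mul_pos Real.pi_pos ht))).hasSum.congr_fun fun p ↦ ?_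
    rw [one_mul]
    congr 2
    ring
  have hmellin := hasSum_mellin (ι := Lattice) (fun p ↦ Or.inr (mul_pos Real.pi_pos (hquad p)))
    (zero_lt_one.trans hs) hcuspTheta <|
      ((summable_quad_rpow z.im_pos hs).mul_left (Real.pi ^ s.re)⁻¹).congr fun p ↦ by
        rw [Real.mul_rpow Real.pi_pos.le (hquad p).le, norm_one, one_div, mul_inv]
  rw [← hmellin.tsum_eq, eisenstein, mul_left_comm, ← tsum_mul_left]
  refine congrArg _ (tsum_congr fun p ↦ ?_)
  rw [cpow_im_div_norm, Complex.ofReal_mul,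
    Complex.mul_cpow_ofReal_nonneg Real.pi_pos.le (hquad p).le, Complex.cpow_neg, Complex.cpow_neg]
  ring

/-! ### Taylor expansion of the Eisenstein series -/

theorem hasSum_cpow_logPow {t : ℝ} (ht : 0 < t) (s : ℂ) :
    HasSum (fun n ↦ s ^ n * (logPow n t : ℂ)) ((t : ℂ) ^ s) := by
  have hexp := NormedSpace.expSeries_div_hasSum_exp (𝔸 := ℂ) (Real.log t * s)
  rw [← Complex.exp_eq_exp_ℂ, Complex.ofReal_log ht.le,
    ← Complex.cpow_def_of_ne_zero (Complex.ofReal_ne_zero.2 ht.ne'),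
    ← Complex.ofReal_log ht.le] at hexp
  refine hexp.congr_fun fun n ↦ ?_
  rw [logPow]
  push_cast
  ring

theorem hasSum_logWeight {t : ℝ} (ht : 0 < t) (s : ℂ) :
    HasSum (fun n ↦ s ^ n * (logWeight n t : ℂ)) ((t : ℂ) ^ (s - 1) + (t : ℂ) ^ (-s)) := by
  rw [Complex.cpow_sub _ _ (Complex.ofReal_ne_zero.2 ht.ne'), Complex.cpow_one]
  refine HasSum.congr_fun (((hasSum_cpow_logPow ht s).div_const (t : ℂ)).add
    (hasSum_cpow_logPow ht (-s))) fun n ↦ ?_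
  rw [logWeight, neg_pow s n]
  push_cast
  ring

/-- The term `sⁿ logWeight n t e^{-π t Q(p)}`, `Q = quad z`, in the expansion of the integrand
`(t^{s-1} + t^{-s}) cuspTheta z t`. -/
def cuspThetaTerm (z s : ℂ) (q : ℕ × Lattice) (t : ℝ) : ℂ :=
  s ^ q.1 * (Real.exp (-(Real.pi * quad z q.2 * t)) * logWeight q.1 t : ℝ)

section EisensteinCoeff

variable {z : ℂ}

theorem tsum_cuspThetaTerm (hz : 0 < z.im) (s : ℂ) {t : ℝ} (ht : 0 < t) :
    ∑' q, cuspThetaTerm z s q t =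
      ((t : ℂ) ^ (s - 1) + (t : ℂ) ^ (-s)) * (cuspTheta z t : ℂ) := by
  have hweight := hasSum_logWeight ht s
  have hexp : Summable fun p : Lattice ↦ (Real.exp (-(Real.pi * t * quad z p)) : ℂ) :=
    Complex.summable_ofReal.2 (summable_exp_lattice hz (mul_pos Real.pi_pos ht))
  rw [cuspTheta, Complex.ofReal_tsum, ← hweight.tsum_eq,
    tsum_mul_tsum_of_summable_norm hweight.summable.norm hexp.norm]
  refine tsum_congr fun q ↦ ?_
  rw [cuspThetaTerm, mul_right_comm Real.pi]
  push_cast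
  ring

theorem integrableOn_cuspThetaTerm (hz : 0 < z.im) (s : ℂ) (q : ℕ × Lattice) :
    IntegrableOn (cuspThetaTerm z s q) (Set.Ioi 1) := by
  have h := (isWeight_logWeight_two_one q.1).integrableOn 0
    (mul_pos Real.pi_pos (quad_pos hz q.2.2))
  simp only [pow_zero, one_mul] at h
  exact h.ofReal.const_mul _

theorem integral_cuspThetaTerm (z s : ℂ) (q : ℕ × Lattice) :
    ∫ t in Set.Ioi (1 : ℝ), cuspThetaTerm z s q t =
      s ^ q.1 * laplace (logWeight q.1) 0 (Real.pi * quad z q.2) := by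
  simp only [cuspThetaTerm, laplace, pow_zero, one_mul]
  rw [integral_const_mul, integral_complex_ofReal]

theorem integral_norm_cuspThetaTerm_le (hz : 0 < z.im) (s : ℂ) (q : ℕ × Lattice) {K : ℕ}
    (hK : K ≠ 0) :
    ∫ t in Set.Ioi (1 : ℝ), ‖cuspThetaTerm z s q t‖ ≤ (‖s‖ / K) ^ q.1 *
      (2 * (K.factorial * (Real.pi ^ (K + 1))⁻¹) * (quad z q.2 ^ (K + 1))⁻¹) := by
  have h := (isWeight_logWeight q.1 hK).integral_norm_le 0
    (mul_pos Real.pi_pos (quad_pos hz q.2.2))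
  simp only [pow_zero, one_mul, add_zero] at h
  simp only [cuspThetaTerm, norm_mul (s ^ q.1), Complex.norm_real, norm_pow]
  rw [integral_const_mul]
  refine (mul_le_mul_of_nonneg_left h (pow_nonneg (norm_nonneg s) _)).trans_eq ?_
  rw [div_pow, mul_pow, mul_inv]
  ring

/-- Taking `K > ‖s‖` in `integral_norm_cuspThetaTerm_le` gives a geometric series in `n`. -/
theorem summable_integral_norm_cuspThetaTerm (hz : 0 < z.im) (s : ℂ) :
    Summable fun q ↦ ∫ t in Set.Ioi (1 : ℝ), ‖cuspThetaTerm z s q t‖ := by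
  obtain ⟨K, hK⟩ := exists_nat_gt ‖s‖
  have hK_pos : (0 : ℝ) < K := (norm_nonneg s).trans_lt hK
  have hK_ne : K ≠ 0 := (Nat.cast_pos.1 hK_pos).ne'
  refine Summable.of_nonneg_of_le (fun q ↦ integral_nonneg fun _ ↦ norm_nonneg _)
    (fun q ↦ integral_norm_cuspThetaTerm_le hz s q hK_ne) ?_
  refine Summable.mul_of_nonneg (f := fun n : ℕ ↦ (‖s‖ / K) ^ n)
    (g := fun p : Lattice ↦ 2 * (K.factorial * (Real.pi ^ (K + 1))⁻¹) * (quad z p ^ (K + 1))⁻¹)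
    (summable_geometric_of_lt_one (by positivity) ((div_lt_one hK_pos).2 hK))
    ((summable_quad_pow hz (by omega)).mul_left _) (fun n ↦ by positivity) fun p ↦ ?_
  have := quad_pos hz p.2
  positivity

theorem hasSum_eisensteinCoeff (hz : 0 < z.im) (s : ℂ) :
    HasSum (fun n ↦ s ^ n * eisensteinCoeff n z)
      (∫ t in Set.Ioi (1 : ℝ), ((t : ℂ) ^ (s - 1) + (t : ℂ) ^ (-s)) * (cuspTheta z t : ℂ)) := by
  have hsum := hasSum_integral_of_summable_integral_norm (F := cuspThetaTerm z s)
    (integrableOn_cuspThetaTerm hz s) (summable_integral_norm_cuspThetaTerm hz s)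
  have hvalue := setIntegral_congr_fun (μ := volume) measurableSet_Ioi
    fun t (ht : 1 < t) ↦ tsum_cuspThetaTerm hz s (zero_lt_one.trans ht)
  simp only [integral_cuspThetaTerm] at hsum
  rw [← hvalue]
  exact hsum.prod_fiberwise fun n ↦
    ((isWeight_logWeight_two_one n).summable_laplace hz).hasSum.mul_left (s ^ n)

end EisensteinCoeff

section PowerSeries

variable {d : ℕ → ℂ} {G : ℂ → ℂ}

theorem hasFPowerSeriesOnBall_of_hasSum (h : ∀ s, HasSum (fun n ↦ s ^ n * d n) (G s)) :
    HasFPowerSeriesOnBall G (FormalMultilinearSeries.ofScalars ℂ d) 0 ⊤ where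
  r_le := by
    refine (FormalMultilinearSeries.radius_eq_top_of_summable_norm _ fun r ↦ ?_).ge
    refine (h (r : ℝ)).summable.norm.congr fun n ↦ ?_
    rw [FormalMultilinearSeries.ofScalars_norm, norm_mul, norm_pow, mul_comm, Complex.norm_real,
      NNReal.norm_eq]
  r_pos := ENNReal.zero_lt_top
  hasSum {y} _ := by
    rw [zero_add]
    refine (h y).congr_fun fun n ↦ ?_
    rw [FormalMultilinearSeries.ofScalars_apply_eq, smul_eq_mul, mul_comm]

theorem iteratedDeriv_zero_div_factorial_of_hasSum
    (h : ∀ s, HasSum (fun n ↦ s ^ n * d n) (G s)) (n : ℕ) :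
    iteratedDeriv n G 0 / n.factorial = d n := by
  have hcoeff := (hasFPowerSeriesOnBall_of_hasSum h).factorial_smul (y := 1) n
  rw [FormalMultilinearSeries.ofScalars_apply_eq, one_pow, smul_eq_mul, mul_one,
    nsmul_eq_mul] at hcoeff
  rw [iteratedDeriv_eq_iteratedFDeriv, ← hcoeff,
    mul_div_cancel_left₀ _ (Nat.cast_ne_zero.2 n.factorial_ne_zero)]

theorem differentiable_of_hasSum (h : ∀ s, HasSum (fun n ↦ s ^ n * d n) (G s)) :
    Differentiable ℂ G := fun s ↦
  ((hasFPowerSeriesOnBall_of_hasSum h).analyticOnNhd s (by simp)).differentiableAt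

end PowerSeries

theorem hasSum_pow_mul_shift {α : Type*} {c : ℕ → α → ℂ} {a : α} {s g : ℂ}
    (h : HasSum (fun n ↦ s ^ n * c n a) g) : HasSum (fun n ↦ s ^ n * shift c n a) (s * g) := by
  rw [← hasSum_nat_add_iff' 1]
  simp only [Finset.range_one, Finset.sum_singleton, shift, Pi.zero_apply, mul_zero, sub_zero]
  refine HasSum.congr_fun (h.mul_left s) fun n ↦ ?_
  ring

/-- The Taylor coefficients at `s = 0` of the doubly completed Eisenstein series. -/
def doublyCompletedCoeff (n : ℕ) (z : ℂ) : ℂ :=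
  1 / 2 * ((if n = 0 then 1 else 0) + shift (shift eisensteinCoeff) n z - shift eisensteinCoeff n z)

theorem hasSum_doublyCompletedCoeff {z : ℂ} (hz : 0 < z.im) (s : ℂ) :
    HasSum (fun n ↦ s ^ n * doublyCompletedCoeff n z) (1 / 2 * (1 + s * (s - 1) *
      ∫ t in Set.Ioi (1 : ℝ), ((t : ℂ) ^ (s - 1) + (t : ℂ) ^ (-s)) * (cuspTheta z t : ℂ))) := by
  have hone : HasSum (fun n : ℕ ↦ s ^ n * (if n = 0 then (1 : ℂ) else 0)) 1 := by
    simpa using hasSum_single (f := fun n : ℕ ↦ s ^ n * (if n = 0 then (1 : ℂ) else 0)) 0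
      fun n hn ↦ by simp [hn]
  have hshift := hasSum_pow_mul_shift (hasSum_eisensteinCoeff hz s)
  rw [mul_sub_one, sub_mul, mul_assoc, ← add_sub_assoc]
  refine (((hone.add (hasSum_pow_mul_shift hshift)).sub hshift).mul_left (1 / 2)).congr_fun
    fun n ↦ ?_
  rw [doublyCompletedCoeff]
  ring

theorem exists_isDoublyCompleted (z : ℍ) : ∃ G, IsDoublyCompleted z G ∧
    ∀ s, HasSum (fun n ↦ s ^ n * doublyCompletedCoeff n z) (G s) := by
  refine ⟨_, ⟨?_, fun s hs ↦ ?_⟩, hasSum_doublyCompletedCoeff z.im_pos⟩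
  · exact differentiable_of_hasSum (hasSum_doublyCompletedCoeff z.im_pos)
  · have hs_zero : s ≠ 0 := by
      rintro rfl
      exact zero_lt_one.not_gt hs
    have hs_one : s - 1 ≠ 0 := sub_ne_zero.2 <| by
      rintro rfl
      exact lt_irrefl _ hs
    rw [mul_assoc (s * (s - 1)), mul_assoc (s * (s - 1)), completed_eisenstein_eq_mellin z hs,
      mellin_cuspTheta z.im_pos hs]
    field_simp
    ring

theorem isDoublyCompleted_doublyCompletedEisenstein (z : ℍ) :
    IsDoublyCompleted z (doublyCompletedEisenstein z) :=
  Classical.epsilon_spec ((exists_isDoublyCompleted z).imp fun _ h ↦ h.1)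

theorem F_eq_doublyCompletedCoeff (n : ℕ) (z : ℍ) : F n z = doublyCompletedCoeff n z := by
  obtain ⟨G, hG, hsum⟩ := exists_isDoublyCompleted z
  rw [F, (isDoublyCompleted_doublyCompletedEisenstein z).unique hG]
  exact iteratedDeriv_zero_div_factorial_of_hasSum hsum n

/-! ### Automorphy of the Taylor coefficients -/

/-- The right action of `γ` on integral row vectors. -/
def rowMul (γ : SL(2, ℤ)) : ℤ × ℤ ≃+ ℤ × ℤ where
  toFun p := (p.1 * γ 0 0 + p.2 * γ 1 0, p.1 * γ 0 1 + p.2 * γ 1 1)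
  invFun p := (p.1 * γ 1 1 - p.2 * γ 1 0, p.2 * γ 0 0 - p.1 * γ 0 1)
  left_inv p := by
    ext
    · linear_combination p.1 * det_coe_eq γ
    · linear_combination p.2 * det_coe_eq γ
  right_inv p := by
    ext
    · linear_combination p.1 * det_coe_eq γ
    · linear_combination p.2 * det_coe_eq γ
  map_add' p q := by
    ext <;>
    · simp only [Prod.fst_add, Prod.snd_add]
      ring

theorem quad_smul (γ : SL(2, ℤ)) (z : ℍ) (p : ℤ × ℤ) :
    quad (γ • z : ℍ) p = quad z (rowMul γ p) := by
  have hdenom := denom_ne_zero_of_im_pos γ z.im_pos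
  have hlinear : (p.1 * ((γ • z : ℍ) : ℂ) + p.2) =
      ((rowMul γ p).1 * z + (rowMul γ p).2) / (γ 1 0 * z + γ 1 1) := by
    rw [coe_smul_eq_moebius, moebius, eq_div_iff hdenom, add_mul, mul_assoc,
      div_mul_cancel₀ _ hdenom]
    simp only [rowMul, AddEquiv.coe_mk, Equiv.coe_fn_mk]
    push_cast
    ring
  rw [quad, quad, hlinear, Complex.normSq_div, coe_im, ModularGroup.im_smul_eq_div_normSq,
    ModularGroup.denom_apply, coe_im,
    div_div_div_cancel_right₀ (Complex.normSq_eq_zero.not.2 hdenom)]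

theorem laplaceSum_smul (w : ℝ → ℝ) (γ : SL(2, ℤ)) (z : ℍ) :
    laplaceSum w (γ • z : ℍ) = laplaceSum w z := by
  have hne (p : ℤ × ℤ) : p ≠ 0 ↔ (rowMul γ).toEquiv p ≠ 0 :=
    (EmbeddingLike.map_ne_zero_iff (f := rowMul γ)).symm
  let e : Lattice ≃ Lattice := (rowMul γ).toEquiv.subtypeEquiv hne
  rw [laplaceSum, laplaceSum,
    ← e.tsum_eq fun p : Lattice ↦ (laplace w 0 (Real.pi * quad z p) : ℂ)]
  exact tsum_congr fun p ↦ by rw [quad_smul]; rfl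

section IsWeight

variable {w : ℝ → ℝ} {M : ℝ}

theorem IsWeight.isSmooth_laplaceSum (hw : IsWeight w M 1) :
    IsSmooth fun z : ℍ ↦ laplaceSum w z := by
  refine hw.contDiffOn_laplaceSum.congr fun z hz ↦ ?_
  rw [Function.comp_apply, ofComplex_apply_of_im_pos hz]

theorem IsWeight.exists_norm_laplaceSum_le_of_mem_verticalStrip (hw : IsWeight w M 1) :
    ∃ C, ∀ z ∈ verticalStrip 1 1, ‖laplaceSum w z‖ ≤ C * z.im ^ 2 := by
  set r := EisensteinSeries.r ⟨⟨1, 1⟩, one_pos⟩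
  have hr_pos : 0 < r := EisensteinSeries.r_pos _
  have hM := hw.nonneg
  have hsum : Summable fun p : Lattice ↦ ((‖p.1‖ ^ 2) ^ 2)⁻¹ := by
    simpa only [Real.rpow_two] using summable_norm_sq_rpow one_lt_two
  refine ⟨M * ((Real.pi * r ^ 2) ^ 2)⁻¹ * ∑' p : Lattice, ((‖p.1‖ ^ 2) ^ 2)⁻¹, fun z hz ↦ ?_⟩
  have hmajorant : HasSum (fun p : Lattice ↦ M * ((Real.pi * r ^ 2) ^ 2)⁻¹ * z.im ^ 2 *
      ((‖p.1‖ ^ 2) ^ 2)⁻¹) _ := hsum.hasSum.mul_left _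
  refine (tsum_of_norm_bounded hmajorant fun p ↦ ?_).trans_eq (mul_right_comm _ _ _)
  have hp : 0 < ‖p.1‖ := norm_pos_iff.2 p.2
  rw [Complex.norm_real]
  calc ‖laplace w 0 (Real.pi * quad z p)‖
      ≤ M * ((Real.pi * quad z p) ^ 2)⁻¹ := by
        simpa using hw.norm_laplace_le 0 (mul_pos Real.pi_pos (quad_pos z.im_pos p.2))
    _ ≤ M * ((Real.pi * (r ^ 2 * ‖p.1‖ ^ 2 / z.im)) ^ 2)⁻¹ := by
        have := Real.pi_pos
        gcongr
        exact quad_ge_of_mem_verticalStrip one_pos hz p.2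
    _ = _ := by field_simp

theorem IsWeight.exists_norm_laplaceSum_le (hw : IsWeight w M 1) :
    ∃ C, ∀ z : ℍ, 1 ≤ z.im → ‖laplaceSum w z‖ ≤ C * z.im ^ 2 := by
  obtain ⟨C, hC⟩ := hw.exists_norm_laplaceSum_le_of_mem_verticalStrip
  refine ⟨C, fun z hz ↦ ?_⟩
  obtain ⟨k, hk⟩ := ModularGroup_T_zpow_mem_verticalStrip z one_pos
  set γ := ModularGroup.T ^ (((1 : ℕ) : ℤ) * k) with hγ
  have him : (γ • z).im = z.im := by rw [hγ, modular_T_zpow_smul, vadd_im]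
  rw [← laplaceSum_smul w γ z, ← him]
  exact hC _ ⟨by simpa using hk.1, him ▸ hz⟩

theorem IsWeight.laplaceSum_mem_automorphicFunctions (hw : IsWeight w M 1) :
    (fun z : ℍ ↦ laplaceSum w z) ∈ automorphicFunctions := by
  refine ⟨hw.isSmooth_laplaceSum, laplaceSum_smul w, 2, ?_⟩
  obtain ⟨C, hC⟩ := hw.exists_norm_laplaceSum_le
  refine IsBigO.of_bound C ?_
  filter_upwards [(atImInfty_mem {z | 1 ≤ z.im}).2 ⟨1, fun _ h ↦ h⟩] with z hz
  rw [Real.rpow_two, Real.norm_of_nonneg (sq_nonneg z.im)]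
  exact hC z hz

end IsWeight

theorem const_mem_automorphicFunctions (c : ℂ) : (fun _ : ℍ ↦ c) ∈ automorphicFunctions := by
  refine ⟨contDiffOn_const, fun _ _ ↦ rfl, 0, ?_⟩
  simpa only [Real.rpow_zero] using isBigO_const_const c (one_ne_zero (α := ℝ)) atImInfty

theorem hypLaplacian_const (c : ℂ) : hypLaplacian (fun _ ↦ c) = 0 := by
  funext z
  have hcomp : (fun _ : ℍ ↦ c) ∘ ofComplex = fun _ : ℂ ↦ c := rfl
  simp [hypLaplacian, hcomp]

/-- The restriction of `eisensteinCoeff n` to the upper half-plane. -/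
def eisensteinCoeffℍ (n : ℕ) : ℍ → ℂ := fun z ↦ eisensteinCoeff n z

theorem eisensteinCoeffℍ_mem_automorphicFunctions (n : ℕ) :
    eisensteinCoeffℍ n ∈ automorphicFunctions :=
  (isWeight_logWeight_two_one n).laplaceSum_mem_automorphicFunctions

theorem hypLaplacian_eisensteinCoeffℍ (n : ℕ) :
    hypLaplacian (eisensteinCoeffℍ n) = (2 : ℂ) • F n := by
  funext z
  have hcongr : eisensteinCoeffℍ n ∘ ofComplex =ᶠ[𝓝 (z : ℂ)] eisensteinCoeff n := by
    filter_upwards [isOpen_upperHalfPlaneSet.mem_nhds z.im_pos] with w hw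
    rw [Function.comp_apply, ofComplex_apply_of_im_pos hw, eisensteinCoeffℍ]
  rw [hypLaplacian, (InnerProductSpace.laplacian_congr_nhds hcongr).eq_of_nhds]
  refine (sq_im_mul_laplacian_eisensteinCoeff n z.im_pos).trans ?_
  rw [Pi.smul_apply, F_eq_doublyCompletedCoeff, doublyCompletedCoeff, smul_eq_mul]
  ring

theorem F_zero : F 0 = fun _ ↦ 1 / 2 := by
  funext z
  simp [F_eq_doublyCompletedCoeff, doublyCompletedCoeff, shift]

theorem F_one : F 1 = (-1 / 2 : ℂ) • eisensteinCoeffℍ 0 := by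
  funext z
  simp only [F_eq_doublyCompletedCoeff, doublyCompletedCoeff, shift, Pi.smul_apply, smul_eq_mul,
    eisensteinCoeffℍ, one_ne_zero, if_false, Pi.zero_apply]
  ring

theorem F_add_two (n : ℕ) :
    F (n + 2) = (1 / 2 : ℂ) • eisensteinCoeffℍ n + (-1 / 2 : ℂ) • eisensteinCoeffℍ (n + 1) := by
  funext z
  simp only [F_eq_doublyCompletedCoeff, doublyCompletedCoeff, shift, Pi.add_apply, Pi.smul_apply,
    smul_eq_mul, eisensteinCoeffℍ, Nat.add_eq_zero_iff, OfNat.ofNat_ne_zero, and_false, if_false]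
  ring

theorem F_mem_automorphicFunctions : ∀ n, F n ∈ automorphicFunctions
  | 0 => F_zero ▸ const_mem_automorphicFunctions _
  | 1 => F_one ▸ Submodule.smul_mem _ _ (eisensteinCoeffℍ_mem_automorphicFunctions 0)
  | n + 2 => F_add_two n ▸
    add_mem (Submodule.smul_mem _ _ (eisensteinCoeffℍ_mem_automorphicFunctions n))
      (Submodule.smul_mem _ _ (eisensteinCoeffℍ_mem_automorphicFunctions (n + 1)))

theorem hypLaplacian_F_one : hypLaplacian (F 1) = (-1 : ℂ) • F 0 := by
  rw [F_one, hypLaplacian_smul _ (eisensteinCoeffℍ_mem_automorphicFunctions 0).1,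
    hypLaplacian_eisensteinCoeffℍ, smul_smul]
  norm_num

theorem hypLaplacian_F_add_two (n : ℕ) :
    hypLaplacian (F (n + 2)) = F n + (-1 : ℂ) • F (n + 1) := by
  have hsmooth (n : ℕ) := (eisensteinCoeffℍ_mem_automorphicFunctions n).1
  rw [F_add_two, hypLaplacian_add ((hsmooth n).smul _) ((hsmooth (n + 1)).smul _),
    hypLaplacian_smul _ (hsmooth n), hypLaplacian_smul _ (hsmooth (n + 1)),
    hypLaplacian_eisensteinCoeffℍ, hypLaplacian_eisensteinCoeffℍ, smul_smul, smul_smul]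
  norm_num

theorem iterate_hypLaplacian_F (n : ℕ) : hypLaplacian^[n] (F n) = fun _ ↦ (-1) ^ n / 2 := by
  induction n using Nat.twoStepInduction with
  | zero => rw [Function.iterate_zero_apply, F_zero, pow_zero]
  | one =>
    rw [Function.iterate_one, hypLaplacian_F_one, F_zero]
    funext z
    rw [Pi.smul_apply, smul_eq_mul, pow_one, mul_one_div]
  | more n ih ih_succ =>
    have hsmooth := (F_mem_automorphicFunctions (n + 1)).1
    rw [Function.iterate_succ_apply, hypLaplacian_F_add_two,
      iterate_hypLaplacian_add _ (F_mem_automorphicFunctions n).1 (hsmooth.smul _),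
      iterate_hypLaplacian_smul _ _ hsmooth, ih_succ, Function.iterate_succ_apply', ih,
      hypLaplacian_const, zero_add]
    funext z
    rw [Pi.smul_apply, smul_eq_mul, ← mul_div_assoc, ← pow_succ']

/-! ### The spaces of polyharmonic Maass forms -/

theorem V_mono : Monotone V := by
  refine monotone_nat_of_le_succ fun m f hf ↦ ⟨hf.1, ?_⟩
  rw [Function.iterate_succ_apply', hf.2]
  exact hypLaplacian_const 0

theorem F_mem_V (n : ℕ) : F n ∈ V (n + 1) := by
  refine ⟨F_mem_automorphicFunctions n, ?_⟩
  rw [Function.iterate_succ_apply', iterate_hypLaplacian_F, hypLaplacian_const]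

theorem F_notMem_V (n : ℕ) : F n ∉ V n := fun h ↦ by
  have hvalue := congr_fun ((iterate_hypLaplacian_F n).symm.trans h.2) UpperHalfPlane.I
  simp at hvalue

theorem exists_sub_smul_F_mem_V {m : ℕ} {f : ℍ → ℂ} (hf : f ∈ V (m + 1)) :
    ∃ c : ℂ, f - c • F m ∈ V m := by
  obtain ⟨c, hc⟩ := exists_iterate_hypLaplacian_eq_const hf.1 m hf.2
  have hF := F_mem_automorphicFunctions m
  refine ⟨2 * (-1) ^ m * c, Submodule.sub_mem _ hf.1 (Submodule.smul_mem _ _ hF), ?_⟩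
  rw [sub_eq_add_neg, ← neg_one_smul ℂ (_ • F m), smul_smul,
    iterate_hypLaplacian_add m hf.1.1 (hF.1.smul _), iterate_hypLaplacian_smul m _ hF.1, hc,
    iterate_hypLaplacian_F]
  funext z
  have hsign : ((-1 : ℂ) ^ m) * (-1) ^ m = 1 := by rw [← mul_pow, neg_one_mul, neg_neg, one_pow]
  simp only [Pi.add_apply, Pi.smul_apply, smul_eq_mul, Pi.zero_apply]
  linear_combination (-c) * hsign

theorem V_eq_span (m : ℕ) : V m = Submodule.span ℂ (Set.range fun i : Fin m ↦ F i) := by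
  refine le_antisymm ?_
    (Submodule.span_le.2 (Set.range_subset_iff.2 fun i ↦ V_mono i.2 (F_mem_V i)))
  induction m with
  | zero =>
    intro f hf
    rw [show f = 0 from hf.2]
    exact zero_mem _
  | succ m ih =>
    intro f hf
    obtain ⟨c, hc⟩ := exists_sub_smul_F_mem_V hf
    have hsub : Submodule.span ℂ (Set.range fun i : Fin m ↦ F i) ≤
        Submodule.span ℂ (Set.range fun i : Fin (m + 1) ↦ F i) :=
      Submodule.span_mono (Set.range_subset_iff.2 fun i ↦ ⟨i.castSucc, rfl⟩)
    rw [← sub_add_cancel f (c • F m)]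
    exact add_mem (hsub (ih hc)) (Submodule.smul_mem _ _ (Submodule.subset_span ⟨Fin.last m, rfl⟩))

theorem linearIndependent_F (m : ℕ) : LinearIndependent ℂ fun i : Fin m ↦ F i := by
  induction m with
  | zero => exact linearIndependent_empty_type
  | succ m ih =>
    refine linearIndependent_finSucc'.2 ⟨ih, fun h ↦ F_notMem_V m ?_⟩
    rw [V_eq_span]
    exact h

theorem V_succ_eq_VHalf (m : ℕ) : V (m + 1) = VHalf m := by
  apply le_antisymm
  · intro f hf
    refine ⟨hf.1, ?_⟩
    obtain ⟨c, hc⟩ := exists_iterate_hypLaplacian_eq_const hf.1 m hf.2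
    exact ⟨ModularForm.const c, hc⟩
  · intro f hf
    refine ⟨hf.1, ?_⟩
    obtain ⟨g, hg⟩ := hf.2
    obtain ⟨c, hc⟩ := ModularFormClass.levelOne_weight_zero_const g
    rw [Function.iterate_succ_apply', hg, hc]
    exact hypLaplacian_const c

end PolyharmonicMaass

end

theorem theorem1p1 :
    (∀ z : ℍ, PolyharmonicMaass.IsDoublyCompleted z
      (PolyharmonicMaass.doublyCompletedEisenstein z)) ∧
    ∀ m : ℕ, 1 ≤ m →
      PolyharmonicMaass.V m = PolyharmonicMaass.VHalf (m - 1) ∧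
      Module.finrank ℂ (PolyharmonicMaass.V m) = m ∧
      ∃ b : Module.Basis (Fin m) ℂ (PolyharmonicMaass.V m),
        ∀ i : Fin m, (b i : ℍ → ℂ) = PolyharmonicMaass.F i := by
  refine ⟨PolyharmonicMaass.isDoublyCompleted_doublyCompletedEisenstein, fun m hm ↦ ?_⟩
  let b := (Module.Basis.span (PolyharmonicMaass.linearIndependent_F m)).map
    (LinearEquiv.ofEq _ _ (PolyharmonicMaass.V_eq_span m).symm)
  refine ⟨?_, ?_, b, fun i ↦ ?_⟩
  · obtain ⟨k, rfl⟩ := Nat.exists_eq_add_of_le' hm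
    exact PolyharmonicMaass.V_succ_eq_VHalf k
  · rw [Module.finrank_eq_card_basis b, Fintype.card_fin]
  · simp [b, Module.Basis.span_apply]
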